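/- Let $R$ be a commutative ring and let $A=\bigoplus_{i\in\mathbb Z}A^i$ be a graded $R$-module with an $A_\infty$ algebra structure: $R$-multilinear maps $\mu_k:A^{\otimes k}\to A$ ($k\ge 1$) of degree $2-k$ such that, for all $n\ge 1$, $\sum_{r+s+t=n,\ s\ge1}(-1)^{r+st}\mu_{r+1+t}(\mathrm{id}^{\otimes r}\otimes\mu_s\otimes\mathrm{id}^{\otimes t})=0$ (with the Koszul sign rule on elements). Let $TA=\bigoplus_{n\ge0}A^{\otimes n}$ be graded by $|a_1\otimes\cdots\otimes a_n|=|a_1|+\cdots+|a_n|+n$, and let $\bullet$ be the shuffle product $$(a_1\otimes\cdots\otimes a_n)\bullet(a_{n+1}\otimes\cdots\otimes a_{n+m})=\sum_{\sigma}(-1)^{\kappa}\,a_{\sigma^{-1}(1)}\otimes\cdots\otimes a_{\sigma^{-1}(n+m)},$$ where $\sigma$ runs over the permutations with $\sigma(1)<\cdots<\sigma(n)$ and $\sigma(n+1)<\cdots<\sigma(n+m)$, and $(-1)^\kappa$ contains a factor $(-1)^{(|a_i|+1)(|a_j|+1)}$ for every pair $i<j$ with $\sigma(i)>\sigma(j)$.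 For $k\ge1$ let $\Delta_{3-2k}:TA\to TA$ be the linear map $$\Delta_{3-2k}(a_1\otimes\cdots\otimes a_n)=\sum_{r=0}^{n-k}(-1)^{|a_1|+\cdots+|a_r|+r+\sum_{j=1}^{k}(k-j)|a_{r+j}|}\;a_1\otimes\cdots\otimes a_r\otimes\mu_k(a_{r+1},\dots,a_{r+k})\otimes a_{r+k+1}\otimes\cdots\otimes a_n .$$ Then each $\Delta_{3-2k}$ is a coderivation of the tensor (deconcatenation) coproduct of $TA$ that lifts $\mu_k$, that is, its components $A^{\otimes n}\to A$ are $(a_1,\dots,a_k)\mapsto(-1)^{\sum_j(k-j)|a_j|}\mu_k(a_1,\dots,a_k)$ for $n=k$ and $0$ for $n\ne k$. Moreover, $(TA,\bullet,\Delta_1,\Delta_{-1},\Delta_{-3},\dots)$ is a commutative $BV_\infty$ algebra in the sense of Kravchenko, that is: 1. $(TA,\Delta_1,\bullet)$ is a differential graded commutative associative algebra (with unit $1\in A^{\otimes0}$ and differential of degree $+1$); 2. each $\Delta_{3-2k}$, $k\ge1$, has degree $3-2k$; 3. each $\Delta_{3-2k}$, $k\ge1$, has operator-order $k$: for all homogeneous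 $x_1,\dots,x_{k+1}\in TA$, $$\sum(-1)^{k+1-r+\kappa}\,\Delta_{3-2k}(x_{i_1}\bullet\cdots\bullet x_{i_r})\bullet x_{i_{r+1}}\bullet\cdots\bullet x_{i_{k+1}}=0,$$ where the sum is over the nonempty subsets $\{i_1<\cdots<i_r\}$ of $\{1,\dots,k+1\}$ with complement $\{i_{r+1}<\cdots<i_{k+1}\}$, and $(-1)^\kappa$ is the Koszul sign of the reordering of $x_1,\dots,x_{k+1}$; 4. for every $n$, $\sum_{j+k=n}\Delta_j\Delta_k=0$, where $j,k\in\{1,-1,-3,\dots\}$. -/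

import Mathlib

open scoped TensorProduct DirectSum

noncomputable section

namespace HomotopyBV

/-! ### Graded commutative algebras, operator-order, Kravchenko's commutative BV∞ algebras -/

section General

variable {R X : Type*} [CommRing R] [AddCommGroup X] [Module R X]

/-- `T` is homogeneous of degree `e` with respect to the grading `𝒳`. -/
def HasDegree (𝒳 : ℤ → Submodule R X) (T : X →ₗ[R] X) (e : ℤ) : Prop :=
  ∀ (i : ℤ) (x : X), x ∈ 𝒳 i → T x ∈ 𝒳 (i + e)

/-- `(X, mul, one)`, graded by `𝒳`, is a (unital) graded commutative associative algebra. -/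
structure IsGradedCommAlgebra (𝒳 : ℤ → Submodule R X) (mul : X →ₗ[R] X →ₗ[R] X) (one : X) :
    Prop where
  /-- `X` is the direct sum of its homogeneous pieces. -/
  isInternal : DirectSum.IsInternal 𝒳
  one_mem : one ∈ 𝒳 0
  mul_mem : ∀ (i j : ℤ) (x y : X), x ∈ 𝒳 i → y ∈ 𝒳 j → mul x y ∈ 𝒳 (i + j)
  one_mul : ∀ x : X, mul one x = x
  mul_one : ∀ x : X, mul x one = x
  mul_assoc : ∀ x y z : X, mul (mul x y) z = mul x (mul y z)
  mul_comm : ∀ (i j : ℤ) (x y : X), x ∈ 𝒳 i → y ∈ 𝒳 j →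
    mul x y = (i * j).negOnePow • mul y x

/-- `(X, d, mul, one)` is a differential graded commutative associative algebra, with a
differential of degree `+1`. -/
structure IsDGCommAlgebra (𝒳 : ℤ → Submodule R X) (mul : X →ₗ[R] X →ₗ[R] X) (one : X)
    (d : X →ₗ[R] X) : Prop extends IsGradedCommAlgebra 𝒳 mul one where
  d_degree : HasDegree 𝒳 d 1
  d_sq : d ∘ₗ d = 0
  d_mul : ∀ (i : ℤ) (x y : X), x ∈ 𝒳 i → d (mul x y) = mul (d x) y + i.negOnePow • mul x (d y)

/-- The product `x₁ • ⋯ • xᵣ` of a list of elements. -/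
def listProd (mul : X →ₗ[R] X →ₗ[R] X) (one : X) (l : List X) : X :=
  l.foldr (fun x y => mul x y) one

/-- The Koszul sign of the reordering of homogeneous elements `x₁, …, xₘ` of degrees
`d₁, …, dₘ` in which the elements with index in `S` are moved to the front (the order inside `S`
and inside its complement being kept): a factor `(-1)^(dᵢ dⱼ)` for every pair `i < j` with
`i ∉ S`, `j ∈ S`. -/
def subsetSign {m : ℕ} (d : Fin m → ℤ) (S : Finset (Fin m)) : ℤˣ :=
  ∏ i : Fin m, ∏ j : Fin m, if i < j ∧ i ∉ S ∧ j ∈ S then (d i * d j).negOnePow else 1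

/-- The operator `T` has operator-order `n`: for all homogeneous `x₁, …, xₙ₊₁`,
`∑ (-1)^(n+1-r+κ) T(x_{i₁} • ⋯ • x_{iᵣ}) • x_{iᵣ₊₁} • ⋯ • x_{iₙ₊₁} = 0`, where the sum is over the
nonempty subsets `S = {i₁ < ⋯ < iᵣ}` with complement `{iᵣ₊₁ < ⋯ < iₙ₊₁}`. -/
def HasOperatorOrder (𝒳 : ℤ → Submodule R X) (mul : X →ₗ[R] X →ₗ[R] X) (one : X)
    (T : X →ₗ[R] X) (n : ℕ) : Prop :=
  ∀ (d : Fin (n + 1) → ℤ) (x : Fin (n + 1) → X), (∀ i, x i ∈ 𝒳 (d i)) →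
    ∑ S : Finset (Fin (n + 1)) with S.Nonempty,
      ((-1 : ℤˣ) ^ (n + 1 - S.card) * subsetSign d S) •
        mul (T (listProd mul one (S.sort.map x))) (listProd mul one (Sᶜ.sort.map x)) = 0

/-- Kravchenko's commutative BV∞ algebras.  The operator `Δ k`, for `k ≥ 1`, is the operator
usually written `Δ_{3-2k}`; the value `Δ 0` plays no role.  As the indices are
`1, -1, -3, …`, the relation `∑_{j+k=n} Δ_j Δ_k = 0` is stated with
`j = 3-2(p+1)`, `k = 3-2(q+1)`, that is `n = 2 - 2(p+q)`, for every value of `p + q`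
(for the other `n` the sum is empty). -/
structure IsCommBVInfinityAlgebra (𝒳 : ℤ → Submodule R X) (mul : X →ₗ[R] X →ₗ[R] X) (one : X)
    (Δ : ℕ → X →ₗ[R] X) : Prop where
  /-- `(X, Δ₁, •)` is a differential graded commutative associative algebra. -/
  isDGCommAlgebra : IsDGCommAlgebra 𝒳 mul one (Δ 1)
  degree : ∀ k : ℕ, 1 ≤ k → HasDegree 𝒳 (Δ k) (3 - 2 * (k : ℤ))
  order : ∀ k : ℕ, 1 ≤ k → HasOperatorOrder 𝒳 mul one (Δ k) k
  relation : ∀ m : ℕ, ∑ pq ∈ Finset.HasAntidiagonal.antidiagonal m, Δ (pq.1 + 1) ∘ₗ Δ (pq.2 + 1) = 0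

end General

/-! ### A∞ algebras -/

section AInfinity

variable {R A : Type*} [CommRing R] [AddCommGroup A] [Module R A]

/-- An A∞ algebra structure on the graded module `A = ⨁ 𝒜 i`: multilinear operations
`μ k : A^{⊗k} → A` of degree `2 - k`, for `k ≥ 1` (there is no `μ 0`, so it is put to zero),
with the Stasheff relations
`∑_{r+s+t=n} (-1)^(r+st) μ_{r+1+t} (id^{⊗r} ⊗ μ_s ⊗ id^{⊗t}) = 0`, `n ≥ 1`.
They are evaluated on homogeneous elements `a₀, …, aₙ₋₁` of degrees `d₀, …, dₙ₋₁` with the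
Koszul sign rule, which gives the extra sign `(-1)^(s (d₀ + ⋯ + dᵣ₋₁))`.  (The elements are written
as the beginning of an infinite sequence, whose other members play no role.) -/
structure AInfinityAlgebra (𝒜 : ℤ → Submodule R A) where
  μ : (k : ℕ) → MultilinearMap R (fun _ : Fin k => A) A
  μ_zero : μ 0 = 0
  degree : ∀ (k : ℕ) (d : Fin k → ℤ) (a : Fin k → A), (∀ i, a i ∈ 𝒜 (d i)) →
    μ k a ∈ 𝒜 ((∑ i, d i) + (2 - (k : ℤ)))
  stasheff : ∀ (n : ℕ) (d : ℕ → ℤ) (a : ℕ → A), (∀ i, a i ∈ 𝒜 (d i)) →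
    ∑ r ∈ Finset.range (n + 1), ∑ st ∈ Finset.HasAntidiagonal.antidiagonal (n - r),
      ((r : ℤ) + st.1 * st.2 + st.1 * ∑ i ∈ Finset.range r, d i).negOnePow •
        μ (r + 1 + st.2) (fun j =>
          if (j : ℕ) < r then a j
          else if (j : ℕ) = r then μ st.1 (fun i => a (r + i))
          else a (j + st.1 - 1)) = 0

end AInfinity

/-! ### Multilinear maps with signs, and linear maps out of `TA` -/

section Signs

variable {R A M : Type*} [CommRing R] [AddCommGroup A] [Module R A] [AddCommGroup M] [Module R M]
variable (𝒜 : ℤ → Submodule R A) [DirectSum.Decomposition 𝒜]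

/-- The projection of `A` onto the sum of the `𝒜 i` with `i` of parity `p`. -/
def parityProj (p : ZMod 2) : A →ₗ[R] A :=
  DirectSum.toModule R ℤ A (fun i => if (i : ZMod 2) = p then (𝒜 i).subtype else 0) ∘ₗ
    (DirectSum.decomposeLinearEquiv 𝒜).toLinearMap

theorem parityProj_of_mem (p : ZMod 2) {i : ℤ} {a : A} (ha : a ∈ 𝒜 i) :
    parityProj 𝒜 p a = if (i : ZMod 2) = p then a else 0 := by
  simp only [parityProj, LinearMap.comp_apply, LinearEquiv.coe_coe,
    DirectSum.decomposeLinearEquiv_apply]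
  rw [DirectSum.decompose_of_mem 𝒜 ha]
  rw [← DirectSum.lof_eq_of R, DirectSum.toModule_lof]
  split_ifs <;> simp

/-- The multilinear map `a ↦ s(|a₁|, …, |aₙ|) • f(a₁, …, aₙ)` for a sign `s` that depends on the
parities of the degrees of the homogeneous elements `a₁, …, aₙ` (see `signed_apply`). -/
def signed {n : ℕ} (s : (Fin n → ZMod 2) → ℤˣ) (f : MultilinearMap R (fun _ : Fin n => A) M) :
    MultilinearMap R (fun _ : Fin n => A) M :=
  ∑ p : Fin n → ZMod 2, (s p : ℤ) • f.compLinearMap (fun i => parityProj 𝒜 (p i))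

theorem signed_apply {n : ℕ} (s : (Fin n → ZMod 2) → ℤˣ)
    (f : MultilinearMap R (fun _ : Fin n => A) M) (d : Fin n → ℤ) (a : Fin n → A)
    (ha : ∀ i, a i ∈ 𝒜 (d i)) :
    signed 𝒜 s f a = s (fun i => (d i : ZMod 2)) • f a := by
  classical
  rw [signed, sum_apply, Finset.sum_eq_single (fun i => (d i : ZMod 2))]
  · simp [parityProj_of_mem 𝒜 _ (ha _), Units.smul_def]
  · intro p _ hp
    obtain ⟨i, hi⟩ := Function.ne_iff.mp hp
    rw [smul_apply, MultilinearMap.compLinearMap_apply,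
      f.map_coord_zero i (by rw [parityProj_of_mem 𝒜 _ (ha i), if_neg (Ne.symm hi)]), smul_zero]
  · simp

variable (R A) in
/-- The space `TA = ⨁ₙ A^{⊗n}` underlying the tensor algebra; the monomial `a₁ ⊗ ⋯ ⊗ aₙ` is
`TensorAlgebra.tprod R A n a`. -/
abbrev TA : Type _ := TensorAlgebra R A

/-- The linear map on `TA = ⨁ₙ A^{⊗n}` that is given on `A^{⊗n}` by the multilinear map `f n`. -/
def ofMultilinear (f : (n : ℕ) → MultilinearMap R (fun _ : Fin n => A) M) : TA R A →ₗ[R] M :=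
  DirectSum.toModule R ℕ M (fun n => PiTensorProduct.lift (f n)) ∘ₗ
    (TensorAlgebra.equivDirectSum (R := R) (M := A)).toLinearMap

theorem ofMultilinear_tprod (f : (n : ℕ) → MultilinearMap R (fun _ : Fin n => A) M) (n : ℕ)
    (a : Fin n → A) : ofMultilinear f (TensorAlgebra.tprod R A n a) = f n a := by
  rw [ofMultilinear, LinearMap.comp_apply, AlgEquiv.toLinearMap_apply,
    TensorAlgebra.equivDirectSum_apply, TensorAlgebra.toDirectSum_tensorPower_tprod,
    ← DirectSum.lof_eq_of R, DirectSum.toModule_lof, PiTensorProduct.lift.tprod]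

theorem TA_hom_ext {f g : TA R A →ₗ[R] M}
    (h : ∀ (n : ℕ) (a : Fin n → A),
      f (TensorAlgebra.tprod R A n a) = g (TensorAlgebra.tprod R A n a)) : f = g := by
  have key : f ∘ₗ (TensorAlgebra.equivDirectSum (R := R) (M := A)).symm.toLinearMap
      = g ∘ₗ (TensorAlgebra.equivDirectSum (R := R) (M := A)).symm.toLinearMap := by
    refine DirectSum.linearMap_ext R fun n => PiTensorProduct.ext ?_
    ext a
    have e : (TensorAlgebra.equivDirectSum (R := R) (M := A)).symm
        (DirectSum.lof R ℕ (fun n => ⨂[R]^n A) n (PiTensorProduct.tprod R a))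
          = TensorAlgebra.tprod R A n a := by
      rw [TensorAlgebra.equivDirectSum_symm_apply, DirectSum.lof_eq_of,
        TensorAlgebra.ofDirectSum_of_tprod]
    simpa [e, -TensorAlgebra.tprod_apply] using h n a
  ext1 x
  simpa using LinearMap.congr_fun key (TensorAlgebra.equivDirectSum x)

variable (R A) in
/-- The degree `N` part of `TA`, where `|a₁ ⊗ ⋯ ⊗ aₙ| = |a₁| + ⋯ + |aₙ| + n`. -/
def grading (N : ℤ) : Submodule R (TA R A) :=
  Submodule.span R {x | ∃ (n : ℕ) (d : Fin n → ℤ) (a : Fin n → A),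
    (∀ i, a i ∈ 𝒜 (d i)) ∧ (∑ i, d i) + (n : ℤ) = N ∧ x = TensorAlgebra.tprod R A n a}

end Signs

/-! ### The shuffle product -/

section Shuffle

variable {R A : Type*} [CommRing R] [AddCommGroup A] [Module R A]
variable (𝒜 : ℤ → Submodule R A) [DirectSum.Decomposition 𝒜]

/-- `σ ∈ S(n,m)`: `σ(1) < ⋯ < σ(n)` and `σ(n+1) < ⋯ < σ(n+m)`. -/
def IsShuffle (n m : ℕ) (σ : Equiv.Perm (Fin (n + m))) : Prop :=
  StrictMono (fun i : Fin n => σ (Fin.castAdd m i)) ∧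
    StrictMono (fun j : Fin m => σ (Fin.natAdd n j))

/-- The Koszul sign: a factor `(-1)^((|aᵢ|+1)(|aⱼ|+1))` whenever `aᵢ` and `aⱼ`, `i < j`, move past
one another. -/
def shuffleSign {N : ℕ} (σ : Equiv.Perm (Fin N)) (p : Fin N → ZMod 2) : ℤˣ :=
  ∏ i : Fin N, ∏ j : Fin N,
    if i < j ∧ σ j < σ i then (-1 : ℤˣ) ^ ((p i + 1) * (p j + 1)) else 1

open Classical in
/-- `(a₁, …, aₙ₊ₘ) ↦ ∑_{σ ∈ S(n,m)} (-1)^κ a_{σ⁻¹(1)} ⊗ ⋯ ⊗ a_{σ⁻¹(n+m)}`. -/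
def shuffleSum (n m : ℕ) : MultilinearMap R (fun _ : Fin (n + m) => A) (TA R A) :=
  ∑ σ : Equiv.Perm (Fin (n + m)) with IsShuffle n m σ,
    signed 𝒜 (shuffleSign σ)
      (MultilinearMap.domDomCongr σ.symm (TensorAlgebra.tprod R A (n + m)))

/-- `shuffleSum`, as a function of `(a₁, …, aₙ)` and `(aₙ₊₁, …, aₙ₊ₘ)` separately. -/
def shuffleCurried (n m : ℕ) : MultilinearMap R (fun _ : Fin n => A)
    (MultilinearMap R (fun _ : Fin m => A) (TA R A)) :=
  MultilinearMap.currySum (MultilinearMap.domDomCongr finSumFinEquiv.symm (shuffleSum 𝒜 n m))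

/-- The shuffle product with `a₁ ⊗ ⋯ ⊗ aₙ` on the left, as a linear map of the right factor. -/
def shuffleLeft (n : ℕ) : MultilinearMap R (fun _ : Fin n => A) (TA R A →ₗ[R] TA R A) where
  toFun a := ofMultilinear (fun m => shuffleCurried 𝒜 n m a)
  map_update_add' a i x y := by
    refine TA_hom_ext fun m b => ?_
    simp only [LinearMap.add_apply, ofMultilinear_tprod, MultilinearMap.map_update_add,
      add_apply]
  map_update_smul' a i c x := by
    refine TA_hom_ext fun m b => ?_
    simp only [LinearMap.smul_apply, ofMultilinear_tprod, MultilinearMap.map_update_smul,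
      smul_apply]

/-- The shuffle product `• : TA ⊗ TA → TA`. -/
def shuffle : TA R A →ₗ[R] TA R A →ₗ[R] TA R A :=
  ofMultilinear (shuffleLeft 𝒜)

theorem shuffle_tprod (n m : ℕ) (a : Fin n → A) (b : Fin m → A) :
    shuffle 𝒜 (TensorAlgebra.tprod R A n a) (TensorAlgebra.tprod R A m b) =
      shuffleSum 𝒜 n m (Fin.append a b) := by
  rw [shuffle, ofMultilinear_tprod]
  change ofMultilinear (fun m => shuffleCurried 𝒜 n m a) _ = _
  rw [ofMultilinear_tprod, shuffleCurried, MultilinearMap.currySum_apply',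
    MultilinearMap.domDomCongr_apply]
  congr 1
  funext i
  refine Fin.addCases (fun i => ?_) (fun i => ?_) i <;> simp

end Shuffle

/-! ### The tensor coproduct, coderivations and lifts -/

section Coderivations

variable {R A M : Type*} [CommRing R] [AddCommGroup A] [Module R A] [AddCommGroup M] [Module R M]
variable (𝒜 : ℤ → Submodule R A) [DirectSum.Decomposition 𝒜]

/-- The segment of length `l` of `a₀, …, aₙ₋₁` that starts with `aₛ`. -/
def seg {A : Type*} {n : ℕ} (a : Fin n → A) (s l : ℕ) (h : s + l ≤ n) : Fin l → A :=
  fun i => a ⟨s + i, by omega⟩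

theorem seg_update_in {A : Type*} {n : ℕ} [DecidableEq (Fin n)] (a : Fin n → A) (s l : ℕ) (h : s + l ≤ n)
    (i : Fin n) (x : A) (h1 : s ≤ i) (h2 : (i : ℕ) < s + l) :
    seg (Function.update a i x) s l h =
      Function.update (seg a s l h) ⟨i - s, by omega⟩ x := by
  funext j
  by_cases hj : j = ⟨i - s, by omega⟩
  · subst hj
    have : (⟨s + (i - s), by omega⟩ : Fin n) = i := Fin.ext (by simp; omega)
    simp [seg, this]
  · have : (⟨s + j, by omega⟩ : Fin n) ≠ i := by
      intro e
      have e' := congrArg Fin.val e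
      simp only at e'
      exact hj (Fin.ext (by simp only; omega))
    simp [seg, Function.update_of_ne hj, Function.update_of_ne this]

theorem seg_update_out {A : Type*} {n : ℕ} [DecidableEq (Fin n)] (a : Fin n → A) (s l : ℕ) (h : s + l ≤ n)
    (i : Fin n) (x : A) (h1 : ¬ (s ≤ i ∧ (i : ℕ) < s + l)) :
    seg (Function.update a i x) s l h = seg a s l h := by
  funext j
  have : (⟨s + j, by omega⟩ : Fin n) ≠ i := by
    rintro rfl
    exact h1 ⟨by simp, by simp⟩
  simp [seg, Function.update_of_ne this]

/-- `(a₁, …, aₙ) ↦ (a₁ ⊗ ⋯ ⊗ aᵣ) ⊗ (aᵣ₊₁ ⊗ ⋯ ⊗ aₙ) ∈ TA ⊗ TA`. -/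
def cut (n r : ℕ) (h : r ≤ n) :
    MultilinearMap R (fun _ : Fin n => A) (TA R A ⊗[R] TA R A) where
  toFun a := TensorAlgebra.tprod R A r (seg a 0 r (by omega)) ⊗ₜ[R]
    TensorAlgebra.tprod R A (n - r) (seg a r (n - r) (by omega))
  map_update_add' a i x y := by
    by_cases hi : (i : ℕ) < r
    · simp only [seg_update_in a 0 r _ i _ (by omega) (by omega),
        seg_update_out a r (n - r) _ i _ (by omega), MultilinearMap.map_update_add,
        TensorProduct.add_tmul]
    · simp only [seg_update_out a 0 r _ i _ (by omega),
        seg_update_in a r (n - r) _ i _ (by omega) (by omega), MultilinearMap.map_update_add,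
        TensorProduct.tmul_add]
  map_update_smul' a i c x := by
    by_cases hi : (i : ℕ) < r
    · simp only [seg_update_in a 0 r _ i _ (by omega) (by omega),
        seg_update_out a r (n - r) _ i _ (by omega), MultilinearMap.map_update_smul,
        TensorProduct.smul_tmul']
    · simp only [seg_update_out a 0 r _ i _ (by omega),
        seg_update_in a r (n - r) _ i _ (by omega) (by omega), MultilinearMap.map_update_smul,
        TensorProduct.tmul_smul]

variable (R A) in
/-- The tensor coproduct
`a₁ ⊗ ⋯ ⊗ aₙ ↦ ∑_{r=0}^{n} (a₁ ⊗ ⋯ ⊗ aᵣ) ⊗ (aᵣ₊₁ ⊗ ⋯ ⊗ aₙ)`. -/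
def coproduct : TA R A →ₗ[R] TA R A ⊗[R] TA R A :=
  ofMultilinear fun n => ∑ r : Fin (n + 1), cut n r (by omega)

/-- The projection `TA → A^{⊗1} = A`. -/
def projOne : TA R A →ₗ[R] A :=
  ofMultilinear fun n =>
    if h : n = 1 then
      MultilinearMap.domDomCongr (finCongr h.symm)
        (MultilinearMap.ofSubsingleton R A A (0 : Fin 1) LinearMap.id)
    else 0

/-- `x ↦ (-1)^|x| x` on `TA`. -/
def degreeSign : TA R A →ₗ[R] TA R A :=
  ofMultilinear fun n =>
    signed 𝒜 (fun p => (-1 : ℤˣ) ^ (∑ i, (p i + 1))) (TensorAlgebra.tprod R A n)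

/-- `T : TA → TA` is a coderivation of odd degree of the tensor coproduct, that is
`Δ T = (T ⊗ id + id ⊗ T) Δ`, with the Koszul sign `(id ⊗ T)(x ⊗ y) = (-1)^|x| x ⊗ T y`. -/
def IsOddCoderivation (T : TA R A →ₗ[R] TA R A) : Prop :=
  coproduct R A ∘ₗ T =
    (TensorProduct.map T LinearMap.id + TensorProduct.map (degreeSign 𝒜) T) ∘ₗ coproduct R A

/-- The operation `f : A^{⊗k} → A`, seen as an operation on `A` with all degrees shifted by one:
`f` with the sign `(-1)^((k-1)|a₁| + (k-2)|a₂| + ⋯ + |aₖ₋₁|)`. -/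
def shifted {k : ℕ} (f : MultilinearMap R (fun _ : Fin k => A) A) :
    MultilinearMap R (fun _ : Fin k => A) A :=
  signed 𝒜 (fun p => (-1 : ℤˣ) ^ (∑ j : Fin k, ((k - 1 - j : ℕ) : ZMod 2) * p j)) f

/-- `(a₁, …, aₙ) ↦ a₁ ⊗ ⋯ ⊗ aᵣ ⊗ f(aᵣ₊₁, …, aᵣ₊ₖ) ⊗ aᵣ₊ₖ₊₁ ⊗ ⋯ ⊗ aₙ`, without any sign. -/
def insertAt {k : ℕ} (f : MultilinearMap R (fun _ : Fin k => A) A) (n r : ℕ) (h : r + k ≤ n) :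
    MultilinearMap R (fun _ : Fin n => A) (TA R A) where
  toFun a := TensorAlgebra.tprod R A r (seg a 0 r (by omega)) *
    TensorAlgebra.ι R (f (seg a r k h)) *
    TensorAlgebra.tprod R A (n - (r + k)) (seg a (r + k) (n - (r + k)) (by omega))
  map_update_add' a i x y := by
    by_cases hi : (i : ℕ) < r
    · simp only [seg_update_in a 0 r _ i _ (by omega) (by omega),
        seg_update_out a r k _ i _ (by omega),
        seg_update_out a (r + k) (n - (r + k)) _ i _ (by omega),
        MultilinearMap.map_update_add, add_mul]
    · by_cases hi' : (i : ℕ) < r + k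
      · simp only [seg_update_out a 0 r _ i _ (by omega),
          seg_update_in a r k _ i _ (by omega) (by omega),
          seg_update_out a (r + k) (n - (r + k)) _ i _ (by omega),
          MultilinearMap.map_update_add, map_add, add_mul, mul_add]
      · simp only [seg_update_out a 0 r _ i _ (by omega),
          seg_update_out a r k _ i _ (by omega),
          seg_update_in a (r + k) (n - (r + k)) _ i _ (by omega) (by omega),
          MultilinearMap.map_update_add, mul_add]
  map_update_smul' a i c x := by
    by_cases hi : (i : ℕ) < r
    · simp only [seg_update_in a 0 r _ i _ (by omega) (by omega),
        seg_update_out a r k _ i _ (by omega),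
        seg_update_out a (r + k) (n - (r + k)) _ i _ (by omega),
        MultilinearMap.map_update_smul, smul_mul_assoc]
    · by_cases hi' : (i : ℕ) < r + k
      · simp only [seg_update_out a 0 r _ i _ (by omega),
          seg_update_in a r k _ i _ (by omega) (by omega),
          seg_update_out a (r + k) (n - (r + k)) _ i _ (by omega),
          MultilinearMap.map_update_smul, map_smul, smul_mul_assoc, mul_smul_comm]
      · simp only [seg_update_out a 0 r _ i _ (by omega),
          seg_update_out a r k _ i _ (by omega),
          seg_update_in a (r + k) (n - (r + k)) _ i _ (by omega) (by omega),
          MultilinearMap.map_update_smul, mul_smul_comm]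

/-- The lift of `f : A^{⊗k} → A` (an operation of degree `2 - k`) to a coderivation of `TA`:
`a₁ ⊗ ⋯ ⊗ aₙ ↦ ∑_{r=0}^{n-k} ± a₁ ⊗ ⋯ ⊗ aᵣ ⊗ f(aᵣ₊₁, …, aᵣ₊ₖ) ⊗ aᵣ₊ₖ₊₁ ⊗ ⋯ ⊗ aₙ` with the sign
`(-1)^(|a₁| + ⋯ + |aᵣ| + r + (k-1)|aᵣ₊₁| + (k-2)|aᵣ₊₂| + ⋯ + |aᵣ₊ₖ₋₁|)`.
For `k = 1` the sign is `(-1)^(|a₁| + ⋯ + |aᵣ| + r)`, and for `k = 2` it is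
`(-1)^(|a₁| + ⋯ + |aᵣ₊₁| + r)`. -/
def lift {k : ℕ} (f : MultilinearMap R (fun _ : Fin k => A) A) : TA R A →ₗ[R] TA R A :=
  ofMultilinear fun n => ∑ r : Fin (n + 1),
    if h : (r : ℕ) + k ≤ n then
      signed 𝒜
        (fun p => (-1 : ℤˣ) ^ (∑ i : Fin n, if (i : ℕ) < r then p i + 1 else 0))
        (insertAt (shifted 𝒜 f) n r h)
    else 0

theorem lift_tprod {k : ℕ} (f : MultilinearMap R (fun _ : Fin k => A) A) (n : ℕ)
    (d : Fin n → ℤ) (a : Fin n → A) (ha : ∀ i, a i ∈ 𝒜 (d i)) :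
    lift 𝒜 f (TensorAlgebra.tprod R A n a) = ∑ r : Fin (n + 1),
      if h : (r : ℕ) + k ≤ n then
        ((-1 : ℤˣ) ^ (∑ i : Fin n, if (i : ℕ) < r then (d i : ZMod 2) + 1 else 0) *
          (-1 : ℤˣ) ^ (∑ j : Fin k, ((k - 1 - j : ℕ) : ZMod 2) * (d ⟨r + j, by omega⟩ : ℤ))) •
        (TensorAlgebra.tprod R A r (seg a 0 r (by omega)) *
          TensorAlgebra.ι R (f (seg a r k h)) *
          TensorAlgebra.tprod R A (n - (r + k)) (seg a (r + k) (n - (r + k)) (by omega)))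
      else 0 := by
  rw [lift, ofMultilinear_tprod, sum_apply]
  refine Finset.sum_congr rfl fun r _ => ?_
  split_ifs with h
  · rw [signed_apply 𝒜 _ _ d a ha, mul_smul]
    congr 1
    change TensorAlgebra.tprod R A r (seg a 0 r _) *
      TensorAlgebra.ι R (shifted 𝒜 f (seg a r k h)) * _ = _
    rw [shifted, signed_apply 𝒜 _ _ (fun j : Fin k => d ⟨r + j, by omega⟩) (seg a r k h)
      (fun j => ha _)]
    simp only [Units.smul_def, map_zsmul, smul_mul_assoc, mul_smul_comm]
  · rfl

/-- `T` is the lift of the operation `f : A^{⊗k} → A` (of degree `2 - k`) to a coderivation of the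
tensor coproduct: it is a coderivation, and its component `A^{⊗n} → A` is `f`, on `A` with all
degrees shifted by one, for `n = k`, and zero for `n ≠ k`. -/
structure IsCoderivationLift {k : ℕ} (f : MultilinearMap R (fun _ : Fin k => A) A)
    (T : TA R A →ₗ[R] TA R A) : Prop where
  coderivation : IsOddCoderivation 𝒜 T
  proj_eq : ∀ a : Fin k → A, projOne (T (TensorAlgebra.tprod R A k a)) = shifted 𝒜 f a
  proj_ne : ∀ (n : ℕ) (a : Fin n → A), n ≠ k → projOne (T (TensorAlgebra.tprod R A n a)) = 0

end Coderivations

end HomotopyBV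

end

/-! Every identity is linear, so it suffices to check it on words in homogeneous letters, which span
`TA`. Signs are carried by the operators `ssign p : x ↦ (-1)^(p|x|) x`, so most formulas need no
homogeneity hypothesis.

Two structures on words do the work. Splitting shuffles by their first letter gives the recursion
`shuffle_ι_mul`, hence commutativity and associativity, and the fact that deconcatenation is
multiplicative for the shuffle product (`coproduct_shuffle`). Splitting the lift of an operation by
its first letter (`lift_ι_mul`) shows that it is the odd coderivation `T(x) = ∑ (-1)^|x₁| x₁ F(x₂)
x₃`, where the corestriction `F` is supported on words of length `k`.

Operator-order: consider more generally `T(y) = ∑ α(y₁) G(y₂) γ(y₃)`, where `G` vanishes on words of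
length at least `k + 1`, with compatible signs (`IsOrderTriple`). By multiplicativity of the
coproduct, `T(x • y)` is a sum over `x = x₁x₂x₃` of terms in which the pieces are shuffled into the
three arguments. The terms with `x₂` empty add up to `± T(y) • x`, because a shuffle of `x` with a
word containing a marked letter cuts `x` at that letter. In the other terms `G(x₂ • -)` already
vanishes from length `k` on. So each graded commutator with a multiplication lowers the bound by one
(`shuffleComm_mem`), and `k + 1` of them kill the lift of a `k`-ary operation. The alternating sum
over subsets is this iterated commutator evaluated at `1` (`sum_subsets_eq_zero`). The case `k = 1`
gives the Leibniz rule.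

Quadratic relations: in `∑ Δ_p Δ_q` the mixed terms of the coproduct cancel in pairs, so the sum is
a coderivation of even degree. Its corestriction is the Stasheff sum up to one overall sign
(`sum_corestriction_lift`), hence zero, and a coderivation with zero corestriction and no constant
terms vanishes (`eq_zero_of_projOne`). -/

open scoped TensorProduct DirectSum

noncomputable section

namespace HomotopyBV

/-! ### Signs as scalars with exponents in `ZMod 2` -/

section SignScalars

variable (R : Type*) [CommRing R]

/-- The sign `(-1)^e` as a scalar of `R`. -/
def sg (e : ZMod 2) : R := if e = 0 then 1 else -1

@[simp] theorem sg_zero : sg R 0 = 1 := rfl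

@[simp] theorem sg_one : sg R 1 = -1 := rfl

theorem zmod_two_cases (e : ZMod 2) : e = 0 ∨ e = 1 := by revert e; decide

theorem sg_add (e f : ZMod 2) : sg R (e + f) = sg R e * sg R f := by
  rcases zmod_two_cases e with rfl | rfl <;> rcases zmod_two_cases f with rfl | rfl <;>
    simp [CharTwo.add_self_eq_zero]

theorem sg_mul_self (e : ZMod 2) : sg R e * sg R e = 1 := by
  rw [← sg_add, CharTwo.add_self_eq_zero, sg_zero]

variable {R} {M : Type*} [AddCommGroup M] [Module R M]

-- Signs become scalars of `R`, so that `map_smul` carries them through linear maps and `sg_add`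
-- reduces sign identities to identities in `ZMod 2`.
variable (R) in
theorem uzpow_smul (e : ZMod 2) (x : M) : ((-1 : ℤˣ) ^ e) • x = sg R e • x := by
  rcases zmod_two_cases e with rfl | rfl <;> simp [Units.smul_def]

variable (R) in
theorem negOnePow_smul (n : ℤ) (x : M) : n.negOnePow • x = sg R (n : ZMod 2) • x := by
  rw [← uzpow_smul, Int.negOnePow_def, uzpow_intCast]

end SignScalars

/-! ### Words in homogeneous letters and the sign operators -/

section Words

variable {R A M : Type*} [CommRing R] [AddCommGroup A] [Module R A] [AddCommGroup M] [Module R M]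
variable {𝒜 : ℤ → Submodule R A}

/-- The monomial of a word in homogeneous letters. -/
def mon : List (Σ i, 𝒜 i) → TA R A
  | [] => 1
  | l :: w => TensorAlgebra.ι R (l.2 : A) * mon w

/-- The degree of a monomial. -/
def wdeg : List (Σ i, 𝒜 i) → ℤ
  | [] => 0
  | l :: w => (l.1 + 1) + wdeg w

/-- The parity of the degree of a monomial. -/
def par : List (Σ i, 𝒜 i) → ZMod 2
  | [] => 0
  | l :: w => (l.1 + 1) + par w

@[simp] theorem mon_nil : mon ([] : List (Σ i, 𝒜 i)) = 1 := rfl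
@[simp] theorem mon_cons (l : Σ i, 𝒜 i) (w : List (Σ i, 𝒜 i)) :
    mon (l :: w) = TensorAlgebra.ι R (l.2 : A) * mon w := rfl
@[simp] theorem par_nil : par ([] : List (Σ i, 𝒜 i)) = 0 := rfl
@[simp] theorem par_cons (l : Σ i, 𝒜 i) (w : List (Σ i, 𝒜 i)) :
    par (l :: w) = (l.1 + 1) + par w := rfl
@[simp] theorem wdeg_nil : wdeg ([] : List (Σ i, 𝒜 i)) = 0 := rfl
@[simp] theorem wdeg_cons (l : Σ i, 𝒜 i) (w : List (Σ i, 𝒜 i)) :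
    wdeg (l :: w) = (l.1 + 1) + wdeg w := rfl

theorem par_eq_wdeg (w : List (Σ i, 𝒜 i)) : par w = (wdeg w : ZMod 2) := by
  induction w with
  | nil => simp
  | cons l w ih => simp [ih]

theorem mon_append (u v : List (Σ i, 𝒜 i)) : mon (u ++ v) = mon u * mon v := by
  induction u with
  | nil => simp
  | cons l u ih => simp [ih, mul_assoc]

theorem par_append (u v : List (Σ i, 𝒜 i)) : par (u ++ v) = par u + par v := by
  induction u with
  | nil => simp
  | cons l u ih => simp [ih, add_assoc]

theorem tprod_zero (a : Fin 0 → A) : TensorAlgebra.tprod R A 0 a = 1 := by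
  simp [TensorAlgebra.tprod_apply]

theorem tprod_succ (n : ℕ) (a : Fin (n + 1) → A) :
    TensorAlgebra.tprod R A (n + 1) a =
      TensorAlgebra.ι R (a 0) * TensorAlgebra.tprod R A n (fun i => a i.succ) := by
  simp [TensorAlgebra.tprod_apply, List.ofFn_succ]

theorem tprod_cons (n : ℕ) (x : A) (a : Fin n → A) :
    TensorAlgebra.ι R x * TensorAlgebra.tprod R A n a =
      TensorAlgebra.tprod R A (n + 1) (Fin.cons x a) := by
  rw [tprod_succ]; simp

theorem mon_ofFn {n : ℕ} (d : Fin n → ℤ) (a : Fin n → A) (ha : ∀ i, a i ∈ 𝒜 (d i)) :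
    mon (List.ofFn fun i => (⟨d i, a i, ha i⟩ : Σ i, 𝒜 i)) = TensorAlgebra.tprod R A n a := by
  induction n with
  | zero => simp
  | succ n ih =>
    rw [List.ofFn_succ, mon_cons, tprod_succ]
    exact congrArg _ (ih (fun i => d i.succ) (fun i => a i.succ) fun i => ha i.succ)

theorem exists_tprod_eq_mon (w : List (Σ i, 𝒜 i)) : ∃ (n : ℕ) (d : Fin n → ℤ) (a : Fin n → A),
    (∀ i, a i ∈ 𝒜 (d i)) ∧ wdeg w = (∑ i, d i) + n ∧ w.length = n ∧
      mon w = TensorAlgebra.tprod R A n a := by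
  induction w with
  | nil => exact ⟨0, 0, 0, by simp, by simp, rfl, by simp⟩
  | cons l w ih =>
    obtain ⟨n, d, a, ha, hd, hn, hw⟩ := ih
    refine ⟨n + 1, Fin.cons l.1 d, Fin.cons l.2 a, ?_, ?_, by simp [hn], ?_⟩
    · exact Fin.cases l.2.2 ha
    · simp [Fin.sum_univ_succ, hd]; ring
    · rw [mon_cons, hw, tprod_cons]

variable [DirectSum.Decomposition 𝒜]

theorem ι_mul_mem_span_mon (a : A) {x : TA R A}
    (hx : x ∈ Submodule.span R (Set.range (mon (𝒜 := 𝒜)))) :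
    TensorAlgebra.ι R a * x ∈ Submodule.span R (Set.range (mon (𝒜 := 𝒜))) := by
  induction hx using Submodule.span_induction with
  | zero => simp
  | add x y _ _ hx hy => rw [mul_add]; exact add_mem hx hy
  | smul c x _ hx => rw [mul_smul_comm]; exact Submodule.smul_mem _ _ hx
  | mem x hx =>
    obtain ⟨w, rfl⟩ := hx
    induction a using DirectSum.Decomposition.inductionOn 𝒜 with
    | zero => simp
    | homogeneous a => exact Submodule.subset_span ⟨⟨_, a⟩ :: w, rfl⟩
    | add a b ha hb => rw [map_add, add_mul]; exact add_mem ha hb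

-- Decomposing each letter into homogeneous components expands a tensor into words. All later
-- reductions to words rest on this.
variable (𝒜) in
theorem mem_span_mon (x : TA R A) : x ∈ Submodule.span R (Set.range (mon (𝒜 := 𝒜))) := by
  have h : ∀ (n : ℕ) (a : Fin n → A), TensorAlgebra.tprod R A n a ∈
      Submodule.span R (Set.range (mon (𝒜 := 𝒜))) := by
    intro n
    induction n with
    | zero => intro a; rw [tprod_zero]; exact Submodule.subset_span ⟨[], rfl⟩
    | succ n ih => intro a; rw [tprod_succ]; exact ι_mul_mem_span_mon _ (ih _)
  have := TA_hom_ext (f := (Submodule.span R (Set.range (mon (𝒜 := 𝒜)))).mkQ) (g := 0)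
    fun n a => by simpa using h n a
  simpa using LinearMap.congr_fun this x

variable (𝒜) in
theorem hom_ext_mon {f g : TA R A →ₗ[R] M}
    (h : ∀ w : List (Σ i, 𝒜 i), f (mon w) = g (mon w)) : f = g :=
  LinearMap.ext_on_range (Submodule.eq_top_iff'.2 (mem_span_mon 𝒜)) h

variable (𝒜) in
theorem TA_induction {P : TA R A → Prop} (x : TA R A) (h0 : P 0)
    (hadd : ∀ x y, P x → P y → P (x + y)) (hsmul : ∀ (c : R) x, P x → P (c • x))
    (hmon : ∀ w : List (Σ i, 𝒜 i), P (mon w)) : P x := by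
  induction mem_span_mon 𝒜 x using Submodule.span_induction with
  | zero => exact h0
  | add x y _ _ hx hy => exact hadd _ _ hx hy
  | smul c x _ hx => exact hsmul _ _ hx
  | mem x hx => obtain ⟨w, rfl⟩ := hx; exact hmon w

/-! ### The sign operators -/

variable (𝒜) in
/-- `x ↦ (-1)^(p|x|) x` on `TA`. -/
def ssign (p : ZMod 2) : TA R A →ₗ[R] TA R A :=
  ofMultilinear fun n =>
    signed 𝒜 (fun q => (-1 : ℤˣ) ^ (p * ∑ i, (q i + 1))) (TensorAlgebra.tprod R A n)

theorem degreeSign_eq_ssign : degreeSign 𝒜 = ssign 𝒜 1 := by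
  simp [degreeSign, ssign]

theorem ssign_mon (p : ZMod 2) (w : List (Σ i, 𝒜 i)) :
    ssign 𝒜 p (mon w) = sg R (p * par w) • mon w := by
  obtain ⟨n, d, a, ha, hd, hn, hw⟩ := exists_tprod_eq_mon w
  rw [hw, ssign, ofMultilinear_tprod, signed_apply 𝒜 _ _ d a ha, uzpow_smul R, par_eq_wdeg, hd]
  simp [Finset.sum_add_distrib]

@[simp] theorem ssign_one (p : ZMod 2) : ssign 𝒜 p 1 = 1 := by
  have := ssign_mon (𝒜 := 𝒜) p []
  simpa using this

theorem ssign_mul_mon (p : ZMod 2) (w : List (Σ i, 𝒜 i)) (x : TA R A) :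
    ssign 𝒜 p (mon w * x) = sg R (p * par w) • (mon w * ssign 𝒜 p x) := by
  have : ssign 𝒜 p ∘ₗ LinearMap.mulLeft R (mon w) =
      sg R (p * par w) • LinearMap.mulLeft R (mon w) ∘ₗ ssign 𝒜 p :=
    hom_ext_mon 𝒜 fun v => by
      simp [← mon_append, ssign_mon, par_append, smul_smul, mul_add, sg_add]
  exact LinearMap.congr_fun this x

theorem ssign_ι_mul (p : ZMod 2) {i : ℤ} {a : A} (ha : a ∈ 𝒜 i) (x : TA R A) :
    ssign 𝒜 p (TensorAlgebra.ι R a * x) =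
      sg R (p * (i + 1)) • (TensorAlgebra.ι R a * ssign 𝒜 p x) := by
  simpa using ssign_mul_mon (𝒜 := 𝒜) p [⟨i, a, ha⟩] x

theorem ssign_ssign (p q : ZMod 2) (x : TA R A) :
    ssign 𝒜 p (ssign 𝒜 q x) = ssign 𝒜 (p + q) x := by
  induction x using TA_induction 𝒜 with
  | h0 => simp
  | hadd x x' hx hx' => simp [hx, hx']
  | hsmul c x hx => simp [hx]
  | hmon w => simp [ssign_mon, smul_smul, add_mul, sg_add, mul_comm (sg R (q * _))]

@[simp] theorem ssign_zero (x : TA R A) : ssign 𝒜 0 x = x := by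
  induction x using TA_induction 𝒜 with
  | h0 => simp
  | hadd x x' hx hx' => simp [hx, hx']
  | hsmul c x hx => simp [hx]
  | hmon w => simp [ssign_mon]

theorem ssign_comm (p q : ZMod 2) (x : TA R A) :
    ssign 𝒜 p (ssign 𝒜 q x) = ssign 𝒜 q (ssign 𝒜 p x) := by
  rw [ssign_ssign, ssign_ssign, add_comm]

theorem ssign_self (p : ZMod 2) (x : TA R A) : ssign 𝒜 p (ssign 𝒜 p x) = x := by
  rw [ssign_ssign, CharTwo.add_self_eq_zero, ssign_zero]

end Words

/-! ### The coproduct and convolution -/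

section Coproduct

variable {R A M : Type*} [CommRing R] [AddCommGroup A] [Module R A] [AddCommGroup M] [Module R M]

theorem tprod_seg_congr {n s s' l l' : ℕ} (a : Fin n → A) (h : s + l ≤ n) (h' : s' + l' ≤ n)
    (hs : s = s') (hl : l = l') :
    TensorAlgebra.tprod R A l (seg a s l h) = TensorAlgebra.tprod R A l' (seg a s' l' h') := by
  subst hs hl; rfl

theorem seg_zero_self {B : Type*} {n : ℕ} (a : Fin n → B) : seg a 0 n (by omega) = a := by
  funext i; simp [seg]

theorem tprod_seg_succ {n s l : ℕ} (a : Fin (n + 1) → A) (h : s + 1 + l ≤ n + 1) :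
    TensorAlgebra.tprod R A l (seg a (s + 1) l h) =
      TensorAlgebra.tprod R A l (seg (fun i => a i.succ) s l (by omega)) := by
  congr 1; funext i; simp [seg]; congr 1; ext; simp; omega

theorem tprod_seg_zero_succ {n l : ℕ} (a : Fin (n + 1) → A) (h : 0 + (l + 1) ≤ n + 1) :
    TensorAlgebra.tprod R A (l + 1) (seg a 0 (l + 1) h) =
      TensorAlgebra.ι R (a 0) *
        TensorAlgebra.tprod R A l (seg (fun i => a i.succ) 0 l (by omega)) := by
  rw [tprod_succ]
  congr 2

theorem coproduct_tprod (n : ℕ) (a : Fin n → A) :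
    coproduct R A (TensorAlgebra.tprod R A n a) = ∑ r : Fin (n + 1),
      TensorAlgebra.tprod R A r (seg a 0 r (by omega)) ⊗ₜ[R]
        TensorAlgebra.tprod R A (n - r) (seg a r (n - r) (by omega)) := by
  rw [coproduct, ofMultilinear_tprod, sum_apply]
  rfl

@[simp] theorem coproduct_one : coproduct R A 1 = 1 ⊗ₜ 1 := by
  rw [← tprod_zero (R := R) (A := A) 0, coproduct_tprod]
  simp

/-- The cut in front of the new letter gives the first term; any other cut is a cut of `x`, with the
letter attached to the left piece. -/
theorem coproduct_ι_mul (a : A) (x : TA R A) :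
    coproduct R A (TensorAlgebra.ι R a * x) = 1 ⊗ₜ (TensorAlgebra.ι R a * x) +
      TensorProduct.map (LinearMap.mulLeft R (TensorAlgebra.ι R a)) LinearMap.id
        (coproduct R A x) := by
  have : coproduct R A ∘ₗ LinearMap.mulLeft R (TensorAlgebra.ι R a) =
      TensorProduct.mk R _ _ 1 ∘ₗ LinearMap.mulLeft R (TensorAlgebra.ι R a) +
      TensorProduct.map (LinearMap.mulLeft R (TensorAlgebra.ι R a)) LinearMap.id ∘ₗ
        coproduct R A := by
    refine TA_hom_ext fun n b => ?_
    simp only [LinearMap.comp_apply, LinearMap.mulLeft_apply, LinearMap.add_apply, tprod_cons,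
      TensorProduct.mk_apply]
    rw [coproduct_tprod, Fin.sum_univ_succ, coproduct_tprod, map_sum]
    congr 1
    · simp only [Fin.val_zero]
      congr 1
      exact congrArg _ (seg_zero_self _)
    · refine Finset.sum_congr rfl fun r _ => ?_
      simp only [Fin.val_succ, TensorProduct.map_tmul, LinearMap.mulLeft_apply, LinearMap.id_apply]
      congr 1
      · rw [tprod_seg_zero_succ]; simp
      · rw [tprod_seg_succ]
        simp only [Fin.cons_succ]
        exact tprod_seg_congr _ _ _ rfl (by omega)
  exact LinearMap.congr_fun this x

/-- The convolution of two endomorphisms of `TA`. -/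
def conv (α β : TA R A →ₗ[R] TA R A) : TA R A →ₗ[R] TA R A :=
  LinearMap.mul' R (TA R A) ∘ₗ TensorProduct.map α β ∘ₗ coproduct R A

@[simp] theorem conv_one (α β : TA R A →ₗ[R] TA R A) : conv α β 1 = α 1 * β 1 := by
  simp [conv]

theorem conv_ι_mul (α β : TA R A →ₗ[R] TA R A) (a : A) (x : TA R A) :
    conv α β (TensorAlgebra.ι R a * x) = α 1 * β (TensorAlgebra.ι R a * x) +
      conv (α ∘ₗ LinearMap.mulLeft R (TensorAlgebra.ι R a)) β x := by
  simp only [conv, LinearMap.comp_apply, coproduct_ι_mul, map_add, TensorProduct.map_tmul,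
    LinearMap.mul'_apply]
  congr 2
  rw [← LinearMap.comp_apply, ← TensorProduct.map_comp, LinearMap.comp_id]

end Coproduct

/-! ### The recursion of the shuffle product -/

section InsertPerm

/-- The permutation of `Fin (N + 1)` that moves `i` to the front and permutes the other elements
by `τ`. -/
def insertPerm {N : ℕ} (i : Fin (N + 1)) (τ : Equiv.Perm (Fin N)) : Equiv.Perm (Fin (N + 1)) :=
  (finSuccEquiv' i).trans ((Equiv.optionCongr τ).trans (finSuccEquiv' 0).symm)

variable {N : ℕ} (i : Fin (N + 1)) (τ : Equiv.Perm (Fin N))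

@[simp] theorem insertPerm_self : insertPerm i τ i = 0 := by
  simp [insertPerm]

@[simp] theorem insertPerm_succAbove (j : Fin N) :
    insertPerm i τ (i.succAbove j) = (τ j).succ := by
  simp [insertPerm]

@[simp] theorem insertPerm_symm_zero : (insertPerm i τ).symm 0 = i := by
  simp [Equiv.symm_apply_eq]

@[simp] theorem insertPerm_symm_succ (j : Fin N) :
    (insertPerm i τ).symm j.succ = i.succAbove (τ.symm j) := by
  simp [Equiv.symm_apply_eq]

/-- The index is recovered as the preimage of `0`, and `τ` from the remaining values; surjectivity
follows by counting, since `(N + 1) · N! = (N + 1)!`. -/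
theorem insertPerm_bijective : Function.Bijective
    (fun x : Fin (N + 1) × Equiv.Perm (Fin N) => insertPerm x.1 x.2) := by
  rw [Fintype.bijective_iff_injective_and_card]
  refine ⟨?_, by simp [Fintype.card_perm, Nat.factorial_succ]⟩
  rintro ⟨i, τ⟩ ⟨j, υ⟩ h
  have hij : i = j := by
    have := congrArg (fun σ : Equiv.Perm (Fin (N + 1)) => σ.symm 0) h
    simpa using this
  subst hij
  have : τ = υ := by
    ext k
    have := congrArg (fun σ : Equiv.Perm (Fin (N + 1)) => σ (i.succAbove k)) h
    simpa [Fin.ext_iff] using this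
  rw [this]

theorem sum_perm_succ {M : Type*} [AddCommMonoid M] (f : Equiv.Perm (Fin (N + 1)) → M) :
    ∑ σ, f σ = ∑ i, ∑ τ : Equiv.Perm (Fin N), f (insertPerm i τ) := by
  rw [← Fintype.sum_prod_type']
  exact (Fintype.sum_bijective _ insertPerm_bijective _ _ fun _ => rfl).symm

/-- The inversions involving `i` are exactly the pairs with an earlier index, since `i` is sent to
the front; the other inversions are those of `τ`. -/
theorem shuffleSign_insertPerm (p : Fin (N + 1) → ZMod 2) :
    shuffleSign (insertPerm i τ) p =
      (-1 : ℤˣ) ^ ((p i + 1) * ∑ j : Fin N,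
        if i.succAbove j < i then p (i.succAbove j) + 1 else 0) *
      shuffleSign τ (fun j => p (i.succAbove j)) := by
  unfold shuffleSign
  rw [Fin.prod_univ_succAbove _ i]
  simp only [Fin.prod_univ_succAbove _ i, insertPerm_self, insertPerm_succAbove, Fin.succ_lt_succ_iff,
    Fin.not_lt_zero, and_false, if_false, Finset.prod_const_one, one_mul, Fin.succ_pos, and_true,
    Finset.prod_mul_distrib, Fin.succAbove_lt_succAbove_iff]
  congr 1
  have : ∀ s : Finset (Fin N), (-1 : ℤˣ) ^ ((p i + 1) * ∑ j ∈ s,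
      if i.succAbove j < i then p (i.succAbove j) + 1 else 0) = ∏ j ∈ s,
      if i.succAbove j < i then (-1 : ℤˣ) ^ ((p (i.succAbove j) + 1) * (p i + 1)) else 1 := by
    intro s
    induction s using Finset.induction_on with
    | empty => simp
    | insert j s hj ih =>
      rw [Finset.sum_insert hj, Finset.prod_insert hj, mul_add, uzpow_add, ih]
      congr 1
      split_ifs
      · rw [mul_comm]
      · simp
  rw [this]

/-- `σ` is increasing on the first `n` elements and on the others. -/
def IsIncreasingOnParts (n : ℕ) (σ : Equiv.Perm (Fin N)) : Prop :=
  ∀ i j : Fin N, i < j → ((j : ℕ) < n ∨ n ≤ i) → σ i < σ j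

theorem isShuffle_iff {n m : ℕ} (σ : Equiv.Perm (Fin (n + m))) :
    IsShuffle n m σ ↔ IsIncreasingOnParts n σ := by
  constructor
  · rintro ⟨h1, h2⟩ i j hij (h | h)
    · exact @h1 ⟨i, by omega⟩ ⟨j, h⟩ hij
    · have := @h2 ⟨i - n, by omega⟩ ⟨j - n, by omega⟩ (by rw [Fin.lt_def] at hij ⊢; simp only; omega)
      simp only [Fin.natAdd_mk] at this
      have ei : (⟨n + (i - n), by omega⟩ : Fin (n + m)) = i := Fin.ext (by simp only; omega)
      have ej : (⟨n + (j - n), by omega⟩ : Fin (n + m)) = j := Fin.ext (by simp only; omega)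
      rwa [ei, ej] at this
  · intro h
    refine ⟨fun i j hij => h _ _ ?_ (by simp), fun i j hij => h _ _ ?_ (by simp)⟩ <;>
      · rw [Fin.lt_def] at hij ⊢
        simpa using hij

@[simp] theorem insertPerm_zero_succ (j : Fin N) : insertPerm 0 τ j.succ = (τ j).succ := by
  have := insertPerm_succAbove 0 τ j
  rwa [Fin.succAbove_zero] at this

theorem isIncreasingOnParts_insertPerm_zero (n : ℕ) :
    IsIncreasingOnParts (n + 1) (insertPerm 0 τ) ↔ IsIncreasingOnParts n τ := by
  constructor
  · intro h i j hij hn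
    have := h i.succ j.succ (by simpa using hij) (by simpa using hn)
    simpa using this
  · intro h i j hij hn
    induction j using Fin.cases with
    | zero => simp at hij
    | succ j =>
      induction i using Fin.cases with
      | zero => simp
      | succ i =>
        have := h i j (by simpa using hij) (by simpa using hn)
        simpa using this

theorem isIncreasingOnParts_insertPerm_self {n : ℕ} (hi : (i : ℕ) = n) :
    IsIncreasingOnParts n (insertPerm i τ) ↔ IsIncreasingOnParts n τ := by
  have h1 : ∀ j : Fin N, (i.succAbove j : ℕ) < n ↔ (j : ℕ) < n := by
    intro j
    rcases lt_or_ge j.castSucc i with h | h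
    · rw [Fin.succAbove_of_castSucc_lt _ _ h]; simp
    · rw [Fin.succAbove_of_le_castSucc _ _ h]
      simp [Fin.le_def] at h ⊢; omega
  constructor
  · intro h j k hjk hn
    have := h (i.succAbove j) (i.succAbove k) (by simpa using hjk) (by
      rw [h1, ← not_lt, h1]; simpa using hn)
    simpa using this
  · intro h j k hjk hn
    rcases Fin.eq_self_or_eq_succAbove i k with rfl | ⟨k, rfl⟩
    · rw [Fin.lt_def] at hjk; omega
    rcases Fin.eq_self_or_eq_succAbove i j with rfl | ⟨j, rfl⟩
    · simp
    rw [h1, ← not_lt, h1] at hn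
    have := h j k (by simpa using hjk) (by simpa using hn)
    simpa using this

/-- The first letter of a shuffle must be the first letter of one of the two blocks: otherwise the
start of its own block would have to be sent below `0`. -/
theorem not_isIncreasingOnParts_insertPerm {n : ℕ} (h0 : i ≠ 0) (hi : (i : ℕ) ≠ n) :
    ¬ IsIncreasingOnParts n (insertPerm i τ) := by
  intro h
  have hpos : 0 < (i : ℕ) := Nat.pos_of_ne_zero fun e => h0 (Fin.ext e)
  rcases lt_or_gt_of_ne hi with hlt | hgt
  · have := h 0 i (by rw [Fin.lt_def]; exact hpos) (Or.inl hlt)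
    simp at this
  · have := h ⟨n, by omega⟩ i (by rw [Fin.lt_def]; exact hgt) (Or.inr le_rfl)
    simp at this

theorem isIncreasingOnParts_one (n : ℕ) : IsIncreasingOnParts n (1 : Equiv.Perm (Fin N)) :=
  fun _ _ h _ => h

theorem eq_one_of_strictMono (σ : Equiv.Perm (Fin N)) (h : StrictMono σ) : σ = 1 := by
  ext i
  have := (StrictMono.range_inj h strictMono_id).1 (by simp)
  simp [this]

theorem shuffleSign_one (p : Fin N → ZMod 2) : shuffleSign 1 p = 1 := by
  refine Finset.prod_eq_one fun i _ => Finset.prod_eq_one fun j _ => if_neg ?_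
  rintro ⟨h, h'⟩
  exact lt_asymm h h'

end InsertPerm

/-! ### Shuffles of sequences, split by their first letter -/

section ShuffleRecursion

variable {R A : Type*} [CommRing R] [AddCommGroup A] [Module R A]

open Classical in
/-- The signed sum of the shuffles of `a₀, …, aₙ₋₁` with `aₙ, …, a_{N-1}`. -/
def shuffleSeq (n N : ℕ) (p : ℕ → ZMod 2) (a : ℕ → A) : TA R A :=
  ∑ σ : Equiv.Perm (Fin N), if IsIncreasingOnParts n σ then
    shuffleSign σ (fun i => p i) • TensorAlgebra.tprod R A N (fun j => a (σ.symm j)) else 0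

theorem shuffleSeq_zero_left (N : ℕ) (p : ℕ → ZMod 2) (a : ℕ → A) :
    shuffleSeq 0 N p a = TensorAlgebra.tprod R A N (fun j => a j) := by
  classical
  rw [shuffleSeq, Finset.sum_eq_single 1]
  · rw [if_pos (isIncreasingOnParts_one _), shuffleSign_one, one_smul]; rfl
  · intro σ _ hσ
    refine if_neg fun h => hσ (eq_one_of_strictMono _ fun i j hij => h i j hij (Or.inr (by simp)))
  · simp

theorem shuffleSeq_self (N : ℕ) (p : ℕ → ZMod 2) (a : ℕ → A) :
    shuffleSeq N N p a = TensorAlgebra.tprod R A N (fun j => a j) := by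
  classical
  rw [shuffleSeq, Finset.sum_eq_single 1]
  · rw [if_pos (isIncreasingOnParts_one _), shuffleSign_one, one_smul]; rfl
  · intro σ _ hσ
    refine if_neg fun h => hσ (eq_one_of_strictMono _ fun i j hij => h i j hij (Or.inl (by simp)))
  · simp

theorem val_succAbove {N : ℕ} (i : Fin (N + 1)) (j : Fin N) :
    (i.succAbove j : ℕ) = if (j : ℕ) < i then (j : ℕ) else j + 1 := by
  split_ifs with h
  · rw [Fin.succAbove_of_castSucc_lt _ _ (by simpa [Fin.lt_def] using h)]; simp
  · rw [Fin.succAbove_of_le_castSucc _ _ (by simpa [Fin.le_def] using h)]; simp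

/-- Collects the shuffles whose first letter is `a i`: the rest is a shuffle of the sequence with
index `i` skipped, and the sign is that of moving `a i` past its predecessors. -/
theorem sum_insertPerm {N : ℕ} (i : Fin (N + 1)) (n n' : ℕ) (p : ℕ → ZMod 2) (a : ℕ → A)
    (h : ∀ τ : Equiv.Perm (Fin N),
      IsIncreasingOnParts n (insertPerm i τ) ↔ IsIncreasingOnParts n' τ) [DecidablePred
        (fun σ : Equiv.Perm (Fin (N + 1)) => IsIncreasingOnParts n σ)] :
    (∑ τ : Equiv.Perm (Fin N), if IsIncreasingOnParts n (insertPerm i τ) then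
      shuffleSign (insertPerm i τ) (fun i => p i) •
        TensorAlgebra.tprod R A (N + 1) (fun j => a ((insertPerm i τ).symm j)) else 0) =
    sg R ((p i + 1) * ∑ j ∈ Finset.range i, (p j + 1)) • (TensorAlgebra.ι R (a i) *
      shuffleSeq n' N (fun j => p (if j < (i : ℕ) then j else j + 1))
        (fun j => a (if j < (i : ℕ) then j else j + 1))) := by
  classical
  rw [shuffleSeq, Finset.mul_sum (s := Finset.univ), Finset.smul_sum]
  refine Finset.sum_congr rfl fun τ _ => ?_
  by_cases hτ : IsIncreasingOnParts n' τ
  · rw [if_pos hτ, if_pos ((h τ).2 hτ), shuffleSign_insertPerm, mul_smul, uzpow_smul R,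
      mul_smul_comm, tprod_succ]
    simp only [insertPerm_symm_zero, insertPerm_symm_succ, val_succAbove]
    congr 3
    rw [← Finset.sum_filter]
    refine Finset.sum_bij' (fun j _ => (i.succAbove j : ℕ))
      (fun j hj => ⟨j, by have := Finset.mem_range.1 hj; omega⟩) ?_ ?_ ?_ ?_ ?_
    · intro j hj
      have := (Finset.mem_filter.1 hj).2
      rw [Fin.lt_def] at this
      exact Finset.mem_range.2 this
    · intro j hj
      have := Finset.mem_range.1 hj
      refine Finset.mem_filter.2 ⟨Finset.mem_univ _, ?_⟩
      rw [Fin.lt_def, val_succAbove, if_pos this]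
      exact this
    · intro j hj
      have := (Finset.mem_filter.1 hj).2
      rw [Fin.lt_def, val_succAbove] at this
      ext
      simp only [val_succAbove]
      split_ifs at this ⊢ <;> omega
    · intro j hj
      have := Finset.mem_range.1 hj
      simp [val_succAbove, this]
    · intro j hj
      simp [val_succAbove]
  · rw [if_neg hτ, if_neg (mt (h τ).1 hτ), mul_zero, smul_zero]

/-- Only the indices `0` and `n + 1`, the starts of the two blocks, can come first. The bound `n + 1
≤ N` makes the second block nonempty. -/
theorem shuffleSeq_succ (n N : ℕ) (h : n + 1 ≤ N) (p : ℕ → ZMod 2) (a : ℕ → A) :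
    shuffleSeq (R := R) (n + 1) (N + 1) p a =
      TensorAlgebra.ι R (a 0) * shuffleSeq n N (fun j => p (j + 1)) (fun j => a (j + 1)) +
      sg R ((p (n + 1) + 1) * ∑ j ∈ Finset.range (n + 1), (p j + 1)) •
        (TensorAlgebra.ι R (a (n + 1)) *
          shuffleSeq (n + 1) N (fun j => p (if j < n + 1 then j else j + 1))
            (fun j => a (if j < n + 1 then j else j + 1))) := by
  classical
  rw [shuffleSeq, sum_perm_succ, Fintype.sum_eq_add (0 : Fin (N + 1)) ⟨n + 1, by omega⟩
    (by simp [Fin.ext_iff])]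
  · rw [sum_insertPerm (R := R) 0 (n + 1) n p a
      (fun τ => isIncreasingOnParts_insertPerm_zero τ n),
      sum_insertPerm (R := R) ⟨n + 1, by omega⟩ (n + 1) (n + 1) p a
      (fun τ => isIncreasingOnParts_insertPerm_self _ τ rfl)]
    simp
  · rintro i ⟨h0, h1⟩
    refine Finset.sum_eq_zero fun τ _ => if_neg (not_isIncreasingOnParts_insertPerm i τ h0 ?_)
    intro e
    exact h1 (Fin.ext e)

/-- The sequence that starts with the first `n` members of `u` and goes on with `v`. -/
def glue {B : Type*} (n : ℕ) (u v : ℕ → B) (i : ℕ) : B := if i < n then u i else v (i - n)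

/-- The sequence `x, a₀, a₁, …`. -/
def consSeq {B : Type*} (x : B) (a : ℕ → B) : ℕ → B
  | 0 => x
  | k + 1 => a k

@[simp] theorem consSeq_zero {B : Type*} (x : B) (a : ℕ → B) : consSeq x a 0 = x := rfl
@[simp] theorem consSeq_succ {B : Type*} (x : B) (a : ℕ → B) (k : ℕ) :
    consSeq x a (k + 1) = a k := rfl

theorem glue_consSeq_skip {B : Type*} (n : ℕ) (s t : ℕ → B) (b : B) :
    (fun k => glue n s (consSeq b t) (if k < n then k else k + 1)) = glue n s t := by
  funext k
  by_cases hk : k < n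
  · simp [glue, hk]
  · have : k + 1 - n = (k - n) + 1 := by omega
    have h' : ¬ (k + 1 < n) := by omega
    simp only [glue, hk, if_false, h', this, consSeq_succ]

variable {𝒜 : ℤ → Submodule R A}

theorem exists_seq_eq_mon (w : List (Σ i, 𝒜 i)) : ∃ (n : ℕ) (d : ℕ → ℤ) (a : ℕ → A),
    (∀ i, a i ∈ 𝒜 (d i)) ∧ wdeg w = (∑ i : Fin n, d i) + n ∧ w.length = n ∧
      mon w = TensorAlgebra.tprod R A n (fun i => a i) := by
  obtain ⟨n, d, a, ha, hd, hn, hw⟩ := exists_tprod_eq_mon w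
  -- Past the end of the word the letters are `0`, which lies in every `𝒜 i`, so homogeneity holds
  -- along the whole sequence.
  refine ⟨n, fun i => if h : i < n then d ⟨i, h⟩ else 0, fun i => if h : i < n then a ⟨i, h⟩ else 0,
    ?_, ?_, hn, ?_⟩
  · intro i; dsimp only; split_ifs with h
    · exact ha _
    · exact zero_mem _
  · simp [hd]
  · simp [hw]

variable [DirectSum.Decomposition 𝒜]

/-- With sequences indexed by `ℕ`, deleting a letter is a reindexing and requires no casts between
the types `Fin (n + m)`. -/
theorem shuffle_seq (n m : ℕ) (d e : ℕ → ℤ) (u v : ℕ → A) (hu : ∀ i, u i ∈ 𝒜 (d i))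
    (hv : ∀ i, v i ∈ 𝒜 (e i)) :
    shuffle 𝒜 (TensorAlgebra.tprod R A n (fun i => u i))
      (TensorAlgebra.tprod R A m (fun i => v i)) =
    shuffleSeq n (n + m) (fun i => ((glue n d e i : ℤ) : ZMod 2)) (glue n u v) := by
  classical
  have hg : ∀ i : ℕ, glue n u v i ∈ 𝒜 (glue n d e i) := by
    intro i; unfold glue; split_ifs
    · exact hu _
    · exact hv _
  have happ : Fin.append (fun i : Fin n => u i) (fun i : Fin m => v i) =
      fun i : Fin (n + m) => glue n u v i := by
    funext i
    refine Fin.addCases (fun i => ?_) (fun i => ?_) i <;> simp [glue]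
  rw [shuffle_tprod, shuffleSum, sum_apply, shuffleSeq, Finset.sum_filter, happ]
  refine Finset.sum_congr rfl fun σ _ => ?_
  simp only [isShuffle_iff]
  split_ifs with h
  · rw [signed_apply 𝒜 _ _ (fun i : Fin (n + m) => glue n d e i) _ (fun i => hg i)]
    rfl
  · rfl

theorem ssign_seq (p : ZMod 2) (n : ℕ) (d : ℕ → ℤ) (a : ℕ → A) (ha : ∀ i, a i ∈ 𝒜 (d i)) :
    ssign 𝒜 p (TensorAlgebra.tprod R A n (fun i => a i)) =
      sg R (p * ∑ i ∈ Finset.range n, ((d i : ZMod 2) + 1)) •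
        TensorAlgebra.tprod R A n (fun i => a i) := by
  rw [ssign, ofMultilinear_tprod, signed_apply 𝒜 _ _ (fun i : Fin n => d i) _ (fun i => ha i),
    uzpow_smul R, Finset.sum_range]

@[simp] theorem shuffle_one_left (x : TA R A) : shuffle 𝒜 1 x = x := by
  induction x using TA_induction 𝒜 with
  | h0 => simp
  | hadd x x' hx hx' => simp [hx, hx']
  | hsmul c x hx => simp [hx]
  | hmon w =>
    obtain ⟨n, d, a, ha, -, -, hw⟩ := exists_seq_eq_mon w
    rw [hw, ← tprod_zero (R := R) (fun i => a i), shuffle_seq 0 n d d a a ha ha,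
      shuffleSeq_zero_left]
    have : ∀ N, N = n → TensorAlgebra.tprod R A N (fun j => glue 0 a a j) =
        TensorAlgebra.tprod R A n (fun j => a j) := by
      rintro N rfl; simp [glue]
    exact this _ (zero_add n)

@[simp] theorem shuffle_one_right (x : TA R A) : shuffle 𝒜 x 1 = x := by
  induction x using TA_induction 𝒜 with
  | h0 => simp
  | hadd x x' hx hx' => simp [hx, hx']
  | hsmul c x hx => simp [hx]
  | hmon w =>
    obtain ⟨n, d, a, ha, -, -, hw⟩ := exists_seq_eq_mon w
    rw [hw, ← tprod_zero (R := R) (fun i => a i), shuffle_seq n 0 d d a a ha ha,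
      add_zero, shuffleSeq_self]
    simp [glue]

theorem ι_mul_seq (n : ℕ) (x : A) (a : ℕ → A) :
    TensorAlgebra.ι R x * TensorAlgebra.tprod R A n (fun i => a i) =
      TensorAlgebra.tprod R A (n + 1) (fun i => consSeq x a i) := by
  rw [tprod_succ]; rfl

/-- If `b` comes first it has jumped over the whole left factor; `ssign 𝒜 (j + 1)` on that factor is
the resulting sign. -/
theorem shuffle_mon_ι_mul {i j : ℤ} {a b : A} (ha : a ∈ 𝒜 i) (hb : b ∈ 𝒜 j)
    (x y : List (Σ i, 𝒜 i)) :
    shuffle 𝒜 (TensorAlgebra.ι R a * mon x) (TensorAlgebra.ι R b * mon y) =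
      TensorAlgebra.ι R a * shuffle 𝒜 (mon x) (TensorAlgebra.ι R b * mon y) +
      TensorAlgebra.ι R b *
        shuffle 𝒜 (ssign 𝒜 (j + 1) (TensorAlgebra.ι R a * mon x)) (mon y) := by
  obtain ⟨n, d, u, hu, -, -, hx⟩ := exists_seq_eq_mon x
  obtain ⟨m, e, v, hv, -, -, hy⟩ := exists_seq_eq_mon y
  have hu' : ∀ k, consSeq a u k ∈ 𝒜 (consSeq i d k) := by
    rintro (_ | k)
    · exact ha
    · exact hu k
  have hv' : ∀ k, consSeq b v k ∈ 𝒜 (consSeq j e k) := by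
    rintro (_ | k)
    · exact hb
    · exact hv k
  rw [hx, hy, ι_mul_seq, ι_mul_seq, ssign_seq _ _ _ _ hu', map_smul, LinearMap.smul_apply,
    shuffle_seq _ _ _ _ _ _ hu' hv', shuffle_seq _ _ _ _ _ _ hu hv',
    shuffle_seq _ _ _ _ _ _ hu' hv, mul_smul_comm]
  have h1 : n + 1 + (m + 1) = (n + 1 + m) + 1 := rfl
  rw [h1, shuffleSeq_succ _ _ (by omega)]
  congr 1
  · rw [show n + (m + 1) = n + 1 + m by omega]
    congr 2
    · funext k
      simp only [glue, Nat.add_lt_add_iff_right, Nat.add_sub_add_right, consSeq_succ]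
    · funext k
      simp only [glue, Nat.add_lt_add_iff_right, Nat.add_sub_add_right, consSeq_succ]
  · congr 1
    · congr 2
      · simp [glue]
      · refine Finset.sum_congr rfl fun k hk => ?_
        simp [glue, Finset.mem_range.1 hk]
    · refine congrArg₂ (· * ·) (by simp [glue]) ?_
      have h2 := glue_consSeq_skip (n + 1) (consSeq i d) e j
      have h3 := glue_consSeq_skip (n + 1) (consSeq a u) v b
      rw [← h3, ← h2]

theorem shuffle_ι_mul {i j : ℤ} {a b : A} (ha : a ∈ 𝒜 i) (hb : b ∈ 𝒜 j) (x y : TA R A) :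
    shuffle 𝒜 (TensorAlgebra.ι R a * x) (TensorAlgebra.ι R b * y) =
      TensorAlgebra.ι R a * shuffle 𝒜 x (TensorAlgebra.ι R b * y) +
      TensorAlgebra.ι R b * shuffle 𝒜 (ssign 𝒜 (j + 1) (TensorAlgebra.ι R a * x)) y := by
  induction x using TA_induction 𝒜 with
  | h0 => simp
  | hadd x x' hx hx' => simp only [mul_add, map_add, LinearMap.add_apply, hx, hx']; abel
  | hsmul c x hx =>
    simp only [mul_smul_comm, map_smul, LinearMap.smul_apply, hx, smul_add]
  | hmon w =>
    induction y using TA_induction 𝒜 with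
    | h0 => simp
    | hadd x x' hx hx' => simp only [mul_add, map_add, hx, hx']; abel
    | hsmul c x hx => simp only [mul_smul_comm, map_smul, hx, smul_add]
    | hmon v => exact shuffle_mon_ι_mul ha hb w v

end ShuffleRecursion

/-! ### Sums over the deconcatenations of a word -/

section CutSum

variable {L M M' : Type*} [AddCommGroup M] [AddCommGroup M']

/-- `∑ f u v` over the deconcatenations `w = u ++ v`. -/
def cutSum : (List L → List L → M) → List L → M
  | f, [] => f [] []
  | f, l :: w => f [] (l :: w) + cutSum (fun u v => f (l :: u) v) w

@[simp] theorem cutSum_nil (f : List L → List L → M) : cutSum f [] = f [] [] := rfl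

theorem cutSum_cons (f : List L → List L → M) (l : L) (w : List L) :
    cutSum f (l :: w) = f [] (l :: w) + cutSum (fun u v => f (l :: u) v) w := rfl

theorem cutSum_congr {f g : List L → List L → M} {w : List L}
    (h : ∀ u v, u ++ v = w → f u v = g u v) : cutSum f w = cutSum g w := by
  induction w generalizing f g with
  | nil => exact h _ _ rfl
  | cons l w ih =>
    rw [cutSum_cons, cutSum_cons, h [] (l :: w) rfl, ih fun u v e => h (l :: u) v (by simp [e])]

theorem cutSum_add (f g : List L → List L → M) (w : List L) :
    cutSum (fun u v => f u v + g u v) w = cutSum f w + cutSum g w := by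
  induction w generalizing f g with
  | nil => rfl
  | cons l w ih => simp only [cutSum_cons, ih]; abel

theorem map_cutSum {F : Type*} [FunLike F M M'] [AddMonoidHomClass F M M'] (φ : F)
    (f : List L → List L → M) (w : List L) :
    φ (cutSum f w) = cutSum (fun u v => φ (f u v)) w := by
  induction w generalizing f with
  | nil => rfl
  | cons l w ih => simp only [cutSum_cons, map_add, ih]

theorem cutSum_zero (w : List L) : cutSum (fun _ _ => (0 : M)) w = 0 := by
  induction w with
  | nil => rfl
  | cons l w ih => simp only [cutSum_cons, ih, add_zero]

theorem cutSum_eq_zero {f : List L → List L → M} {w : List L}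
    (h : ∀ u v, u ++ v = w → f u v = 0) : cutSum f w = 0 :=
  (cutSum_congr h).trans (cutSum_zero w)

theorem cutSum_smul {R : Type*} [CommRing R] [Module R M] (c : R) (f : List L → List L → M)
    (w : List L) : cutSum (fun u v => c • f u v) w = c • cutSum f w :=
  (map_cutSum (LinearMap.lsmul R M c) f w).symm

theorem cutSum_mem {R : Type*} [CommRing R] [Module R M] (S : Submodule R M)
    {f : List L → List L → M} {w : List L} (h : ∀ u v, u ++ v = w → f u v ∈ S) :
    cutSum f w ∈ S := by
  induction w generalizing f with
  | nil => exact h _ _ rfl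
  | cons l w ih => exact add_mem (h [] _ rfl) (ih fun u v e => h (l :: u) v (by simp [e]))

theorem cutSum_apply {R : Type*} [CommRing R] [Module R M] [Module R M']
    (f : List L → List L → M →ₗ[R] M') (w : List L) (x : M) :
    cutSum f w x = cutSum (fun u v => f u v x) w :=
  map_cutSum (LinearMap.applyₗ (R := R) (M₂ := M') x) f w

/-- Coassociativity of deconcatenation: both sides sum over the cuts of `w` into three pieces. -/
theorem cutSum_assoc (f : List L → List L → List L → M) (w : List L) :
    cutSum (fun u v => cutSum (fun v₁ v₂ => f u v₁ v₂) v) w =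
      cutSum (fun u v => cutSum (fun u₁ u₂ => f u₁ u₂ v) u) w := by
  induction w generalizing f with
  | nil => rfl
  | cons l w ih =>
    simp only [cutSum_cons, cutSum_nil, ih fun u => f (l :: u), cutSum_add]
    abel

end CutSum

/-! ### Coproduct and convolution evaluated on words -/

section CutCoproduct

variable {R A M : Type*} [CommRing R] [AddCommGroup A] [Module R A] [AddCommGroup M] [Module R M]
variable {𝒜 : ℤ → Submodule R A}

theorem smul_cutSum {L : Type*} (c : R) (f : List L → List L → TA R A) (w : List L) :
    c • cutSum f w = cutSum (fun u v => c • f u v) w :=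
  (cutSum_smul (R := R) (M := TA R A) _ _ _).symm

theorem coproduct_mon (w : List (Σ i, 𝒜 i)) :
    coproduct R A (mon w) = cutSum (fun u v => mon u ⊗ₜ[R] mon v) w := by
  induction w with
  | nil => simp
  | cons l w ih =>
    rw [mon_cons, coproduct_ι_mul, ih, map_cutSum, cutSum_cons]
    rfl

theorem conv_mon (α β : TA R A →ₗ[R] TA R A) (w : List (Σ i, 𝒜 i)) :
    conv α β (mon w) = cutSum (fun u v => α (mon u) * β (mon v)) w := by
  rw [conv, LinearMap.comp_apply, LinearMap.comp_apply, coproduct_mon, map_cutSum, map_cutSum]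
  rfl

/-- `x ↦ ∑ F(x₁) x₂`, the sum being over the deconcatenations of `x`. -/
def headOp (F : TA R A →ₗ[R] A) : TA R A →ₗ[R] TA R A :=
  conv (TensorAlgebra.ι R ∘ₗ F) LinearMap.id

theorem headOp_mon (F : TA R A →ₗ[R] A) (w : List (Σ i, 𝒜 i)) :
    headOp F (mon w) = cutSum (fun u v => TensorAlgebra.ι R (F (mon u)) * mon v) w :=
  conv_mon _ _ w

theorem headOp_one (F : TA R A →ₗ[R] A) (hF : F 1 = 0) : headOp F 1 = 0 := by
  simp [headOp, hF]

/-- A cut of `F(u) v` falls either in front of the letter `F(u)`, or after it and hence inside `v`;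
coassociativity regroups the latter cuts as `headOp F` on the left piece. -/
theorem coproduct_headOp (F : TA R A →ₗ[R] A) (w : List (Σ i, 𝒜 i)) :
    coproduct R A (headOp F (mon w)) = 1 ⊗ₜ headOp F (mon w) +
      cutSum (fun u v => headOp F (mon u) ⊗ₜ[R] mon v) w := by
  simp only [headOp_mon, map_cutSum, coproduct_ι_mul, coproduct_mon, cutSum_add]
  congr 1
  · exact (map_cutSum (TensorProduct.mk R (TA R A) (TA R A) 1) _ w).symm
  · simp only [TensorProduct.map_tmul, LinearMap.mulLeft_apply, LinearMap.id_apply]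
    rw [cutSum_assoc (fun u v₁ v₂ => (TensorAlgebra.ι R (F (mon u)) * mon v₁) ⊗ₜ[R] mon v₂)]
    exact cutSum_congr fun u v _ =>
      (map_cutSum ((TensorProduct.mk R (TA R A) (TA R A)).flip (mon v)) _ u).symm

/-! ### Counit and projection to letters -/

theorem projOne_tprod_one (a : Fin 1 → A) : projOne (TensorAlgebra.tprod R A 1 a) = a 0 := by
  rw [projOne, ofMultilinear_tprod]; simp

theorem projOne_tprod_ne {n : ℕ} (hn : n ≠ 1) (a : Fin n → A) :
    projOne (TensorAlgebra.tprod R A n a) = 0 := by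
  rw [projOne, ofMultilinear_tprod]; simp [hn]

@[simp] theorem projOne_one : projOne (1 : TA R A) = 0 := by
  rw [← tprod_zero (R := R) (A := A) 0, projOne_tprod_ne (by simp)]

theorem projOne_ι_mul (a : A) (x : TA R A) :
    projOne (TensorAlgebra.ι R a * x) = TensorAlgebra.algebraMapInv x • a := by
  have : projOne ∘ₗ LinearMap.mulLeft R (TensorAlgebra.ι R a) =
      (LinearMap.toSpanSingleton R A a) ∘ₗ
        (TensorAlgebra.algebraMapInv (R := R) (M := A)).toLinearMap := by
    refine TA_hom_ext fun n b => ?_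
    simp only [LinearMap.comp_apply, LinearMap.mulLeft_apply, tprod_cons]
    rcases n with _ | n
    · rw [projOne_tprod_one]; simp
    · rw [projOne_tprod_ne (by omega), tprod_succ]; simp [TensorAlgebra.algebraMapInv]
  exact LinearMap.congr_fun this x

theorem algebraMapInv_ι_mul (a : A) (x : TA R A) :
    TensorAlgebra.algebraMapInv (TensorAlgebra.ι R a * x) = 0 := by
  simp [TensorAlgebra.algebraMapInv]

/-- The counit kills nonempty words, so only the cut at the end survives. -/
theorem cutSum_counit (f : TA R A →ₗ[R] M) (w : List (Σ i, 𝒜 i)) :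
    cutSum (fun u v => TensorAlgebra.algebraMapInv (mon v) • f (mon u)) w = f (mon w) := by
  induction w generalizing f with
  | nil => simp
  | cons l w ih =>
    rw [cutSum_cons, mon_cons, algebraMapInv_ι_mul, zero_smul, zero_add]
    exact ih (f ∘ₗ LinearMap.mulLeft R (TensorAlgebra.ι R (l.2 : A)))

theorem cutSum_counit_left (f : TA R A →ₗ[R] M) (w : List (Σ i, 𝒜 i)) :
    cutSum (fun u v => TensorAlgebra.algebraMapInv (mon u) • f (mon v)) w = f (mon w) := by
  cases w with
  | nil => simp
  | cons l w =>
    rw [cutSum_cons, cutSum_eq_zero fun u v _ => by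
      rw [mon_cons, algebraMapInv_ι_mul, zero_smul]]
    simp

theorem projOne_headOp (F : TA R A →ₗ[R] A) (w : List (Σ i, 𝒜 i)) :
    projOne (headOp F (mon w)) = F (mon w) := by
  rw [headOp_mon, map_cutSum]
  simp only [projOne_ι_mul]
  exact cutSum_counit F w

theorem algebraMapInv_headOp (F : TA R A →ₗ[R] A) (w : List (Σ i, 𝒜 i)) :
    TensorAlgebra.algebraMapInv (headOp F (mon w)) = 0 := by
  rw [headOp_mon, map_cutSum]
  exact cutSum_eq_zero fun u v _ => algebraMapInv_ι_mul _ _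

end CutCoproduct

/-! ### Odd coderivations from their corestriction -/

section OddCoderivation

variable {R A M : Type*} [CommRing R] [AddCommGroup A] [Module R A] [AddCommGroup M] [Module R M]
variable (𝒜 : ℤ → Submodule R A)

/-- `T(x) = ∑ (-1)^|x₁| x₁ F(x₂) x₃`, in recursive form. -/
structure IsOddExtension (F : TA R A →ₗ[R] A) (T : TA R A →ₗ[R] TA R A) : Prop where
  corestriction_one : F 1 = 0
  map_one : T 1 = 0
  map_ι_mul : ∀ (i : ℤ) (a : A), a ∈ 𝒜 i → ∀ x, T (TensorAlgebra.ι R a * x) =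
    headOp F (TensorAlgebra.ι R a * x) + sg R (i + 1) • (TensorAlgebra.ι R a * T x)

variable {𝒜}

theorem IsOddExtension.algebraMapInv_mon {F : TA R A →ₗ[R] A} {T : TA R A →ₗ[R] TA R A}
    (h : IsOddExtension 𝒜 F T) (w : List (Σ i, 𝒜 i)) :
    TensorAlgebra.algebraMapInv (T (mon w)) = 0 := by
  cases w with
  | nil => simp [h.map_one]
  | cons l w =>
    rw [mon_cons, h.map_ι_mul _ _ l.2.2, map_add, map_smul, algebraMapInv_ι_mul, ← mon_cons,
      algebraMapInv_headOp, smul_zero, add_zero]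

theorem IsOddExtension.projOne_mon {F : TA R A →ₗ[R] A} {T : TA R A →ₗ[R] TA R A}
    (h : IsOddExtension 𝒜 F T) (w : List (Σ i, 𝒜 i)) : projOne (T (mon w)) = F (mon w) := by
  cases w with
  | nil => simp [h.map_one, h.corestriction_one]
  | cons l w =>
    rw [mon_cons, h.map_ι_mul _ _ l.2.2, map_add, map_smul, projOne_ι_mul, h.algebraMapInv_mon,
      ← mon_cons, projOne_headOp, zero_smul, smul_zero, add_zero]

variable [DirectSum.Decomposition 𝒜]

theorem IsOddExtension.projOne_apply {F : TA R A →ₗ[R] A} {T : TA R A →ₗ[R] TA R A}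
    (h : IsOddExtension 𝒜 F T) (x : TA R A) : projOne (T x) = F x :=
  LinearMap.congr_fun (hom_ext_mon 𝒜 (f := projOne ∘ₗ T) (g := F) h.projOne_mon) x

/-- The coderivation identity on words, by induction on the word: `coproduct_headOp` accounts for
the part of the recursion that consumes the first letter, the induction hypothesis for the part that
keeps it. -/
theorem IsOddExtension.coproduct_mon {F : TA R A →ₗ[R] A} {T : TA R A →ₗ[R] TA R A}
    (h : IsOddExtension 𝒜 F T) (w : List (Σ i, 𝒜 i)) :
    coproduct R A (T (mon w)) =
      cutSum (fun u v => T (mon u) ⊗ₜ[R] mon v + ssign 𝒜 1 (mon u) ⊗ₜ[R] T (mon v)) w := by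
  induction w with
  | nil => simp [h.map_one]
  | cons l w ih =>
    have e : ∀ x, ssign 𝒜 1 (TensorAlgebra.ι R (l.2 : A) * x) =
        sg R (l.1 + 1) • (TensorAlgebra.ι R (l.2 : A) * ssign 𝒜 1 x) := fun x => by
      rw [ssign_ι_mul _ l.2.2, one_mul]
    rw [mon_cons, h.map_ι_mul _ _ l.2.2, map_add, map_smul, coproduct_ι_mul, ih, ← mon_cons,
      coproduct_headOp, cutSum_cons, cutSum_cons, map_cutSum]
    simp only [mon_cons, mon_nil, h.map_ι_mul _ _ l.2.2, headOp_one F h.corestriction_one,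
      h.map_one, e, ssign_one, TensorProduct.zero_tmul, zero_add, map_add, TensorProduct.map_tmul,
      LinearMap.mulLeft_apply, LinearMap.id_apply, TensorProduct.add_tmul, TensorProduct.tmul_add,
      ← TensorProduct.smul_tmul', TensorProduct.tmul_smul, cutSum_add, cutSum_smul, smul_add]
    abel

theorem IsOddExtension.isOddCoderivation {F : TA R A →ₗ[R] A} {T : TA R A →ₗ[R] TA R A}
    (h : IsOddExtension 𝒜 F T) : IsOddCoderivation 𝒜 T := by
  refine hom_ext_mon 𝒜 fun w => ?_
  rw [LinearMap.comp_apply, h.coproduct_mon, LinearMap.comp_apply, HomotopyBV.coproduct_mon,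
    map_cutSum, degreeSign_eq_ssign]
  rfl

/-- Unrolling the recursion gives `∑ (-1)^|x₁| x₁ F(x₂) x₃`. This closed form is the one to which
the commutator argument applies. -/
theorem IsOddExtension.eq_conv {F : TA R A →ₗ[R] A} {T : TA R A →ₗ[R] TA R A}
    (h : IsOddExtension 𝒜 F T) : T = conv (ssign 𝒜 1) (headOp F) := by
  refine hom_ext_mon 𝒜 fun w => ?_
  induction w with
  | nil => simp [h.map_one, headOp_one F h.corestriction_one]
  | cons l w ih =>
    rw [mon_cons, h.map_ι_mul _ _ l.2.2, ih, conv_ι_mul, ssign_one, one_mul, conv_mon,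
      conv_mon, ← LinearMap.mulLeft_apply (R := R) _ (cutSum _ w), map_cutSum, smul_cutSum]
    congr 1
    refine cutSum_congr fun u v _ => ?_
    simp [ssign_ι_mul _ l.2.2, mul_assoc]

/-- A coderivation of degree zero whose corestriction to the letters vanishes is zero. -/
theorem eq_zero_of_projOne {Q : TA R A →ₗ[R] TA R A} (h1 : Q 1 = 0)
    (hQ : coproduct R A ∘ₗ Q = (TensorProduct.map Q LinearMap.id +
      TensorProduct.map LinearMap.id Q) ∘ₗ coproduct R A)
    (hε : ∀ w : List (Σ i, 𝒜 i), TensorAlgebra.algebraMapInv (Q (mon w)) = 0)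
    (hp : ∀ w : List (Σ i, 𝒜 i), projOne (Q (mon w)) = 0) : Q = 0 := by
  -- A nonempty word is its first letter times the rest, and the empty word is seen by the counit.
  have key : ∀ x : TA R A, headOp projOne x + algebraMap R _ (TensorAlgebra.algebraMapInv x) = x := by
    intro x
    have : headOp projOne + (Algebra.linearMap R (TA R A)) ∘ₗ
        (TensorAlgebra.algebraMapInv (R := R) (M := A)).toLinearMap = LinearMap.id := by
      refine hom_ext_mon 𝒜 fun w => ?_
      cases w with
      | nil => simp [headOp_one]
      | cons l w =>
        rw [LinearMap.add_apply, headOp_mon, cutSum_cons]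
        simp only [mon_cons, projOne_ι_mul, mon_nil, projOne_one, map_zero, zero_mul, zero_add,
          LinearMap.comp_apply, AlgHom.toLinearMap_apply, algebraMapInv_ι_mul, add_zero,
          LinearMap.id_apply, map_smul, smul_mul_assoc]
        exact cutSum_counit_left (LinearMap.mulLeft R (TensorAlgebra.ι R (l.2 : A))) w
    exact LinearMap.congr_fun this x
  have hp' : ∀ x, projOne (Q x) = 0 :=
    LinearMap.congr_fun (hom_ext_mon 𝒜 (f := projOne ∘ₗ Q) (g := 0) hp)
  refine hom_ext_mon 𝒜 fun w => ?_
  rw [LinearMap.zero_apply]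
  induction w with
  | nil => exact h1
  | cons l w ih =>
    -- Reading off the first letter of `Q(l w)` through the coderivation rule leaves terms `projOne
    -- (Q u) · v`, which vanish, and `projOne u · Q v`, where `u` must be the single letter `l`; so
    -- `Q(l w) = l Q(w) = 0`.
    rw [← key (Q (mon (l :: w))), hε, map_zero, add_zero, headOp, conv, LinearMap.comp_apply,
      LinearMap.comp_apply, ← LinearMap.comp_apply (coproduct R A) Q, hQ, LinearMap.comp_apply,
      coproduct_mon, map_cutSum, map_cutSum, map_cutSum, cutSum_cons]
    simp only [LinearMap.add_apply, TensorProduct.map_tmul, map_add, LinearMap.comp_apply, hp',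
      map_zero, TensorProduct.zero_tmul, LinearMap.mul'_apply, zero_add, mon_nil,
      projOne_one, mon_cons, LinearMap.id_apply, projOne_ι_mul, map_smul, smul_mul_assoc]
    refine (cutSum_counit_left (LinearMap.mulLeft R (TensorAlgebra.ι R (l.2 : A)) ∘ₗ Q) w).trans ?_
    rw [LinearMap.comp_apply, ih, map_zero]
end OddCoderivation

/-! ### The lift of an operation is an odd extension of its corestriction -/

section LiftRecursion

variable {R A M : Type*} [CommRing R] [AddCommGroup A] [Module R A] [AddCommGroup M] [Module R M]
variable (𝒜 : ℤ → Submodule R A) [DirectSum.Decomposition 𝒜]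

/-- The corestriction `TA → A` of the lift of `f`. -/
def corestriction {k : ℕ} (f : MultilinearMap R (fun _ : Fin k => A) A) : TA R A →ₗ[R] A :=
  ofMultilinear fun n =>
    if h : k = n then MultilinearMap.domDomCongr (finCongr h) (shifted 𝒜 f) else 0

theorem corestriction_tprod {k : ℕ} (f : MultilinearMap R (fun _ : Fin k => A) A) (a : Fin k → A) :
    corestriction 𝒜 f (TensorAlgebra.tprod R A k a) = shifted 𝒜 f a := by
  rw [corestriction, ofMultilinear_tprod]; simp

theorem corestriction_tprod_ne {k n : ℕ} (h : n ≠ k) (f : MultilinearMap R (fun _ : Fin k => A) A)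
    (a : Fin n → A) : corestriction 𝒜 f (TensorAlgebra.tprod R A n a) = 0 := by
  rw [corestriction, ofMultilinear_tprod]; simp [h.symm]

theorem corestriction_one {k : ℕ} (hk : 1 ≤ k) (f : MultilinearMap R (fun _ : Fin k => A) A) :
    corestriction 𝒜 f 1 = 0 := by
  rw [← tprod_zero (R := R) (A := A) 0, corestriction_tprod_ne _ (by omega)]

theorem headOp_corestriction_tprod {k n : ℕ} (f : MultilinearMap R (fun _ : Fin k => A) A)
    (a : Fin n → A) : headOp (corestriction 𝒜 f) (TensorAlgebra.tprod R A n a) =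
      if h : k ≤ n then TensorAlgebra.ι R (shifted 𝒜 f (seg a 0 k (by omega))) *
        TensorAlgebra.tprod R A (n - k) (seg a k (n - k) (by omega)) else 0 := by
  rw [headOp, conv, LinearMap.comp_apply, LinearMap.comp_apply, coproduct_tprod, map_sum, map_sum]
  simp only [TensorProduct.map_tmul, LinearMap.mul'_apply, LinearMap.comp_apply,
    LinearMap.id_apply]
  split_ifs with h
  · rw [Finset.sum_eq_single ⟨k, by omega⟩]
    · simp only [corestriction_tprod]
    · intro r _ hr
      rw [corestriction_tprod_ne _ (fun e => hr (Fin.ext e)), map_zero, zero_mul]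
    · simp
  · refine Finset.sum_eq_zero fun r _ => ?_
    rw [corestriction_tprod_ne _ (by omega), map_zero, zero_mul]

theorem lift_tprod_shifted {k : ℕ} (f : MultilinearMap R (fun _ : Fin k => A) A) (n : ℕ)
    (d : Fin n → ℤ) (a : Fin n → A) (ha : ∀ i, a i ∈ 𝒜 (d i)) :
    lift 𝒜 f (TensorAlgebra.tprod R A n a) = ∑ r : Fin (n + 1),
      if h : (r : ℕ) + k ≤ n then
        sg R (∑ i : Fin n, if (i : ℕ) < r then (d i : ZMod 2) + 1 else 0) •
        (TensorAlgebra.tprod R A r (seg a 0 r (by omega)) *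
          TensorAlgebra.ι R (shifted 𝒜 f (seg a r k h)) *
          TensorAlgebra.tprod R A (n - (r + k)) (seg a (r + k) (n - (r + k)) (by omega)))
      else 0 := by
  rw [lift, ofMultilinear_tprod, sum_apply]
  refine Finset.sum_congr rfl fun r _ => ?_
  split_ifs with h
  · rw [signed_apply 𝒜 _ _ d a ha, uzpow_smul R]
    rfl
  · rfl

theorem lift_one {k : ℕ} (hk : 1 ≤ k) (f : MultilinearMap R (fun _ : Fin k => A) A) :
    lift 𝒜 f 1 = 0 := by
  rw [← tprod_zero (R := R) (A := A) 0, lift_tprod_shifted 𝒜 f 0 0 0 (by simp)]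
  refine Finset.sum_eq_zero fun r _ => ?_
  rw [dif_neg (by omega)]

theorem seg_succ {B : Type*} {n s l : ℕ} (a : Fin (n + 1) → B) (h : s + 1 + l ≤ n + 1) :
    seg a (s + 1) l h = seg (fun i => a i.succ) s l (by omega) := by
  funext i; simp [seg]; congr 1; ext; simp; omega

/-- The summand `r = 0` feeds the first letter to `f` and is the `headOp` term. The summands with `r
≥ 1` keep `a` in front and contribute its sign `(-1)^(i + 1)`. -/
theorem lift_ι_mul {k : ℕ} (f : MultilinearMap R (fun _ : Fin k => A) A) {i : ℤ} {a : A}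
    (ha : a ∈ 𝒜 i) (x : TA R A) :
    lift 𝒜 f (TensorAlgebra.ι R a * x) =
      headOp (corestriction 𝒜 f) (TensorAlgebra.ι R a * x) +
        sg R (i + 1) • (TensorAlgebra.ι R a * lift 𝒜 f x) := by
  induction x using TA_induction 𝒜 with
  | h0 => simp
  | hadd x x' hx hx' => simp only [mul_add, map_add, hx, hx', smul_add]; abel
  | hsmul c x hx => simp only [mul_smul_comm, map_smul, hx, smul_add, smul_comm c]
  | hmon w =>
    obtain ⟨n, d, b, hb, -, -, hw⟩ := exists_tprod_eq_mon w
    rw [hw, tprod_cons, lift_tprod_shifted 𝒜 f (n + 1) (Fin.cons i d) (Fin.cons a b)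
      (Fin.cases ha hb), Fin.sum_univ_succ, headOp_corestriction_tprod,
      lift_tprod_shifted 𝒜 f n d b hb, Finset.mul_sum (s := Finset.univ), Finset.smul_sum]
    congr 1
    · simp only [Fin.val_zero, zero_add, Nat.not_lt_zero, if_false,
        Finset.sum_const_zero, sg_zero, one_smul]
      split_ifs with h
      · exact congrArg₂ (· * ·) ((congrArg (· * _) (tprod_zero _)).trans (one_mul _))
          (tprod_seg_congr _ _ _ (zero_add k) (by omega))
      · rfl
    · refine Finset.sum_congr rfl fun r _ => ?_
      by_cases h : (r : ℕ) + k ≤ n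
      · rw [dif_pos h, dif_pos (by rw [Fin.val_succ]; omega), mul_smul_comm, smul_smul, ← sg_add]
        congr 1
        · simp only [Fin.sum_univ_succ, Fin.val_zero, Fin.val_succ, Fin.cons_zero, Fin.cons_succ,
            Nat.succ_pos, if_true, add_lt_add_iff_right]
        · simp only [Fin.val_succ]
          rw [tprod_seg_zero_succ, seg_succ, ← mul_assoc, ← mul_assoc]
          congr 1
          rw [tprod_seg_congr (s' := r + k + 1) (l' := n - (r + k)) _ _ (by omega) (by omega)
            (by omega), tprod_seg_succ]
          simp
      · rw [dif_neg h, dif_neg (by rw [Fin.val_succ]; omega), mul_zero, smul_zero]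

theorem isOddExtension_lift {k : ℕ} (hk : 1 ≤ k) (f : MultilinearMap R (fun _ : Fin k => A) A) :
    IsOddExtension 𝒜 (corestriction 𝒜 f) (lift 𝒜 f) where
  corestriction_one := corestriction_one 𝒜 hk f
  map_one := lift_one 𝒜 hk f
  map_ι_mul _ _ ha x := lift_ι_mul 𝒜 f ha x

theorem isCoderivationLift_lift {k : ℕ} (hk : 1 ≤ k)
    (f : MultilinearMap R (fun _ : Fin k => A) A) : IsCoderivationLift 𝒜 f (lift 𝒜 f) where
  coderivation := (isOddExtension_lift 𝒜 hk f).isOddCoderivation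
  proj_eq a := by rw [(isOddExtension_lift 𝒜 hk f).projOne_apply, corestriction_tprod]
  proj_ne n a h := by rw [(isOddExtension_lift 𝒜 hk f).projOne_apply, corestriction_tprod_ne _ h]

end LiftRecursion

/-! ### Commutativity and associativity of the shuffle product -/

section ShuffleAlgebra

variable {R A M : Type*} [CommRing R] [AddCommGroup A] [Module R A] [AddCommGroup M] [Module R M]
variable {𝒜 : ℤ → Submodule R A} [DirectSum.Decomposition 𝒜]

theorem shuffle_mon_cons (l m : Σ i, 𝒜 i) (x y : List (Σ i, 𝒜 i)) :
    shuffle 𝒜 (mon (l :: x)) (mon (m :: y)) =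
      TensorAlgebra.ι R (l.2 : A) * shuffle 𝒜 (mon x) (mon (m :: y)) +
      sg R ((m.1 + 1) * ((l.1 + 1) + par x)) •
        (TensorAlgebra.ι R (m.2 : A) * shuffle 𝒜 (mon (l :: x)) (mon y)) := by
  rw [mon_cons, mon_cons, shuffle_ι_mul l.2.2 m.2.2, ← mon_cons, ← mon_cons, ssign_mon,
    map_smul, LinearMap.smul_apply, mul_smul_comm, par_cons]

theorem ssign_shuffle_mon (p : ZMod 2) (x y : List (Σ i, 𝒜 i)) :
    ssign 𝒜 p (shuffle 𝒜 (mon x) (mon y)) =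
      sg R (p * (par x + par y)) • shuffle 𝒜 (mon x) (mon y) := by
  induction x generalizing y with
  | nil => simp [ssign_mon]
  | cons l x ihx =>
    induction y with
    | nil => simp [ssign_mon, -mon_cons]
    | cons m y ihy =>
      simp only [shuffle_mon_cons, map_add, map_smul, ssign_ι_mul _ l.2.2, ssign_ι_mul _ m.2.2,
        ihx, ihy, smul_add, mul_smul_comm, smul_smul, ← sg_add, par_cons]
      congr 3 <;> ring

theorem ssign_shuffle (p : ZMod 2) (x y : TA R A) :
    ssign 𝒜 p (shuffle 𝒜 x y) = shuffle 𝒜 (ssign 𝒜 p x) (ssign 𝒜 p y) := by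
  induction x using TA_induction 𝒜 with
  | h0 => simp
  | hadd x x' hx hx' => simp [hx, hx']
  | hsmul c x hx => simp [hx]
  | hmon w =>
    induction y using TA_induction 𝒜 with
    | h0 => simp
    | hadd x x' hx hx' => simp [hx, hx']
    | hsmul c x hx => simp [hx]
    | hmon v =>
      rw [ssign_shuffle_mon, ssign_mon, ssign_mon, map_smul, map_smul, LinearMap.smul_apply,
        smul_smul, ← sg_add]
      congr 2; ring

/-- The two terms of the first-letter recursion trade places when the factors are swapped; the
remaining sign identities are finite checks in `ZMod 2`. -/
theorem shuffle_mon_comm (x y : List (Σ i, 𝒜 i)) :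
    shuffle 𝒜 (mon x) (mon y) = sg R (par x * par y) • shuffle 𝒜 (mon y) (mon x) := by
  induction x generalizing y with
  | nil => simp
  | cons l x ihx =>
    induction y with
    | nil => simp
    | cons m y ihy =>
      rw [shuffle_mon_cons, shuffle_mon_cons, ihx, ihy]
      simp only [smul_add, mul_smul_comm, smul_smul, ← sg_add, par_cons]
      rw [add_comm]
      generalize (l.1 : ZMod 2) = a, (m.1 : ZMod 2) = b, par x = p, par y = q
      congr 3
      · revert a b p q; decide
      · revert a b p q; decide

theorem shuffle_comm_mon (x : List (Σ i, 𝒜 i)) (y : TA R A) :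
    shuffle 𝒜 (mon x) y = shuffle 𝒜 (ssign 𝒜 (par x) y) (mon x) := by
  induction y using TA_induction 𝒜 with
  | h0 => simp
  | hadd x x' hx hx' => simp [hx, hx']
  | hsmul c x hx => simp [hx]
  | hmon v => rw [shuffle_mon_comm, ssign_mon, map_smul, LinearMap.smul_apply]

/-- Both sides are sorted by their first letter `l`, `m` or `n`. On the left the terms starting with
`n` reassemble into the full product of the first two words, on the right those starting with `l`
into the full product of the last two, so the three induction hypotheses apply. -/
theorem shuffle_mon_assoc (x y z : List (Σ i, 𝒜 i)) :
    shuffle 𝒜 (shuffle 𝒜 (mon x) (mon y)) (mon z) =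
      shuffle 𝒜 (mon x) (shuffle 𝒜 (mon y) (mon z)) := by
  induction x generalizing y z with
  | nil => simp
  | cons l x ihx =>
    induction y generalizing z with
    | nil => simp
    | cons m y ihy =>
      induction z with
      | nil => simp
      | cons n z ihz =>
        have hL : shuffle 𝒜 (shuffle 𝒜 (mon (l :: x)) (mon (m :: y))) (mon (n :: z)) =
            TensorAlgebra.ι R (l.2 : A) *
              shuffle 𝒜 (shuffle 𝒜 (mon x) (mon (m :: y))) (mon (n :: z)) +
            sg R ((m.1 + 1) * ((l.1 + 1) + par x)) • (TensorAlgebra.ι R (m.2 : A) *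
              shuffle 𝒜 (shuffle 𝒜 (mon (l :: x)) (mon y)) (mon (n :: z))) +
            TensorAlgebra.ι R (n.2 : A) * shuffle 𝒜 (ssign 𝒜 (n.1 + 1)
              (shuffle 𝒜 (mon (l :: x)) (mon (m :: y)))) (mon z) := by
          rw [shuffle_mon_cons l m]
          simp only [map_add, LinearMap.add_apply, map_smul, LinearMap.smul_apply, mon_cons n,
            shuffle_ι_mul l.2.2 n.2.2, shuffle_ι_mul m.2.2 n.2.2, mul_add, smul_add,
            mul_smul_comm]
          abel
        have hR : shuffle 𝒜 (mon (l :: x)) (shuffle 𝒜 (mon (m :: y)) (mon (n :: z))) =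
            TensorAlgebra.ι R (l.2 : A) *
              shuffle 𝒜 (mon x) (shuffle 𝒜 (mon (m :: y)) (mon (n :: z))) +
            TensorAlgebra.ι R (m.2 : A) * shuffle 𝒜 (ssign 𝒜 (m.1 + 1) (mon (l :: x)))
              (shuffle 𝒜 (mon y) (mon (n :: z))) +
            sg R ((n.1 + 1) * ((m.1 + 1) + par y)) • (TensorAlgebra.ι R (n.2 : A) *
              shuffle 𝒜 (ssign 𝒜 (n.1 + 1) (mon (l :: x)))
                (shuffle 𝒜 (mon (m :: y)) (mon z))) := by
          rw [shuffle_mon_cons m n]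
          simp only [map_add, map_smul, mon_cons l,
            shuffle_ι_mul l.2.2 n.2.2, shuffle_ι_mul l.2.2 m.2.2, mul_add, smul_add,
            mul_smul_comm]
          abel
        rw [hL, hR, ihx, ihy, ssign_shuffle_mon, map_smul, LinearMap.smul_apply, ihz, ssign_mon,
          ssign_mon]
        simp only [map_smul, LinearMap.smul_apply, mul_smul_comm, smul_smul, ← sg_add, par_cons]
        congr 3
        ring

theorem shuffle_assoc (x y z : TA R A) :
    shuffle 𝒜 (shuffle 𝒜 x y) z = shuffle 𝒜 x (shuffle 𝒜 y z) := by
  induction x using TA_induction 𝒜 with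
  | h0 => simp
  | hadd x x' hx hx' => simp [hx, hx']
  | hsmul c x hx => simp [hx]
  | hmon u =>
    induction y using TA_induction 𝒜 with
    | h0 => simp
    | hadd x x' hx hx' => simp [hx, hx']
    | hsmul c x hx => simp [hx]
    | hmon v =>
      induction z using TA_induction 𝒜 with
      | h0 => simp
      | hadd x x' hx hx' => simp [hx, hx']
      | hsmul c x hx => simp [hx]
      | hmon w => exact shuffle_mon_assoc u v w

/-! ### Shuffles and deconcatenation -/

/-- The first-letter recursion inside the left tensor factor. A general tensor `t` stands for the
coproduct of the rest of the second word. -/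
theorem map_shuffle_map_mulLeft (l m : Σ i, 𝒜 i) (x₁ x₂ : List (Σ i, 𝒜 i))
    (t : TA R A ⊗[R] TA R A) :
    TensorProduct.map (shuffle 𝒜 (mon (l :: x₁)) ∘ₗ ssign 𝒜 (par x₂)) (shuffle 𝒜 (mon x₂))
      (TensorProduct.map (LinearMap.mulLeft R (TensorAlgebra.ι R (m.2 : A))) LinearMap.id t) =
    TensorProduct.map (LinearMap.mulLeft R (TensorAlgebra.ι R (l.2 : A))) LinearMap.id
      (TensorProduct.map (shuffle 𝒜 (mon x₁) ∘ₗ ssign 𝒜 (par x₂)) (shuffle 𝒜 (mon x₂))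
        (TensorProduct.map (LinearMap.mulLeft R (TensorAlgebra.ι R (m.2 : A))) LinearMap.id t)) +
    sg R ((m.1 + 1) * ((l.1 + 1) + (par x₁ + par x₂))) •
      TensorProduct.map (LinearMap.mulLeft R (TensorAlgebra.ι R (m.2 : A))) LinearMap.id
        (TensorProduct.map (shuffle 𝒜 (mon (l :: x₁)) ∘ₗ ssign 𝒜 (par x₂)) (shuffle 𝒜 (mon x₂))
          t) := by
  induction t using TensorProduct.induction_on with
  | zero => simp
  | add s t hs ht => simp only [map_add, hs, ht, smul_add]; abel
  | tmul u v =>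
    simp only [TensorProduct.map_tmul, LinearMap.comp_apply, LinearMap.mulLeft_apply,
      LinearMap.id_apply, ssign_ι_mul _ m.2.2, map_smul, mon_cons l, shuffle_ι_mul l.2.2 m.2.2,
      smul_add, TensorProduct.add_tmul, ← TensorProduct.smul_tmul']
    congr 1
    rw [← mon_cons, ssign_mon, map_smul, LinearMap.smul_apply, mul_smul_comm,
      ← TensorProduct.smul_tmul', smul_smul, ← sg_add, par_cons]
    congr 2; ring

theorem map_ssign_map_mulLeft (m : Σ i, 𝒜 i) (p : ZMod 2) (g : TA R A →ₗ[R] TA R A)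
    (t : TA R A ⊗[R] TA R A) :
    TensorProduct.map (shuffle 𝒜 1 ∘ₗ ssign 𝒜 p) g
      (TensorProduct.map (LinearMap.mulLeft R (TensorAlgebra.ι R (m.2 : A))) LinearMap.id t) =
    sg R ((m.1 + 1) * p) •
      TensorProduct.map (LinearMap.mulLeft R (TensorAlgebra.ι R (m.2 : A))) LinearMap.id
        (TensorProduct.map (shuffle 𝒜 1 ∘ₗ ssign 𝒜 p) g t) := by
  induction t using TensorProduct.induction_on with
  | zero => simp
  | add s t hs ht => simp only [map_add, hs, ht, smul_add]
  | tmul u v =>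
    simp only [TensorProduct.map_tmul, LinearMap.comp_apply, LinearMap.mulLeft_apply,
      LinearMap.id_apply, ssign_ι_mul _ m.2.2, shuffle_one_left, ← TensorProduct.smul_tmul',
      mul_comm]

/-- Cutting a shuffle of `x` and `y` cuts both words and shuffles the pieces separately. The
operator `ssign 𝒜 (par x₂)` is the sign of moving `x₂` past the left piece of `y`. -/
theorem coproduct_shuffle_mon (x y : List (Σ i, 𝒜 i)) :
    coproduct R A (shuffle 𝒜 (mon x) (mon y)) = cutSum (fun x₁ x₂ =>
      TensorProduct.map (shuffle 𝒜 (mon x₁) ∘ₗ ssign 𝒜 (par x₂)) (shuffle 𝒜 (mon x₂))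
        (coproduct R A (mon y))) x := by
  induction x generalizing y with
  | nil =>
    have h1 : shuffle 𝒜 1 = LinearMap.id := LinearMap.ext shuffle_one_left
    have h2 : ssign 𝒜 0 = LinearMap.id := LinearMap.ext ssign_zero
    simp [h1, h2]
  | cons l x ihx =>
    induction y with
    | nil => simp [coproduct_mon, -mon_cons]
    | cons m y ihy =>
      have e : cutSum (fun x₁ x₂ => sg R ((m.1 + 1) * ((l.1 + 1) + (par x₁ + par x₂))) •
          TensorProduct.map (LinearMap.mulLeft R (TensorAlgebra.ι R (m.2 : A))) LinearMap.id
            (TensorProduct.map (shuffle 𝒜 (mon (l :: x₁)) ∘ₗ ssign 𝒜 (par x₂))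
              (shuffle 𝒜 (mon x₂)) (coproduct R A (mon y)))) x =
          sg R ((m.1 + 1) * ((l.1 + 1) + par x)) •
          TensorProduct.map (LinearMap.mulLeft R (TensorAlgebra.ι R (m.2 : A))) LinearMap.id
            (cutSum (fun x₁ x₂ => TensorProduct.map (shuffle 𝒜 (mon (l :: x₁)) ∘ₗ
              ssign 𝒜 (par x₂)) (shuffle 𝒜 (mon x₂)) (coproduct R A (mon y))) x) := by
        rw [map_cutSum, ← cutSum_smul]
        exact cutSum_congr fun u v h => by rw [← h, par_append]
      rw [shuffle_mon_cons, map_add, map_smul, coproduct_ι_mul, coproduct_ι_mul, ihx, ihy,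
        cutSum_cons, cutSum_cons, mon_cons m y, coproduct_ι_mul]
      simp only [map_add (TensorProduct.map (shuffle 𝒜 _ ∘ₗ ssign 𝒜 _) (shuffle 𝒜 _)),
        map_shuffle_map_mulLeft, cutSum_add, e, mon_nil, map_ssign_map_mulLeft,
        TensorProduct.map_tmul, LinearMap.comp_apply, ssign_one,
        shuffle_one_right, map_add, map_cutSum, LinearMap.mulLeft_apply, LinearMap.id_apply,
        ← mon_cons, shuffle_mon_cons l m, TensorProduct.tmul_add, TensorProduct.tmul_smul,
        smul_add, par_cons]
      abel

theorem coproduct_shuffle (x : List (Σ i, 𝒜 i)) (y : TA R A) :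
    coproduct R A (shuffle 𝒜 (mon x) y) = cutSum (fun x₁ x₂ =>
      TensorProduct.map (shuffle 𝒜 (mon x₁) ∘ₗ ssign 𝒜 (par x₂)) (shuffle 𝒜 (mon x₂))
        (coproduct R A y)) x := by
  induction y using TA_induction 𝒜 with
  | h0 => simp [cutSum_zero]
  | hadd y y' hy hy' => simp [hy, hy', cutSum_add]
  | hsmul c y hy => simp [hy, cutSum_smul]
  | hmon v => exact coproduct_shuffle_mon x v

/-- Sorts the shuffles by the position of the marked letter `c`: `x₁` consists of the letters of `x`
in front of it, which have moved past both `c` and `z`. -/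
theorem shuffle_concat_nil {i : ℤ} {c : A} (hc : c ∈ 𝒜 i) (z : TA R A) (x : List (Σ i, 𝒜 i)) :
    shuffle 𝒜 (TensorAlgebra.ι R c * z) (mon x) = cutSum (fun x₁ x₂ =>
      sg R (par x₁ * (i + 1)) • (mon x₁ * (TensorAlgebra.ι R c *
        shuffle 𝒜 (ssign 𝒜 (par x₁) z) (mon x₂)))) x := by
  induction x generalizing z with
  | nil => simp
  | cons b x ih =>
    rw [mon_cons, shuffle_ι_mul hc b.2.2, cutSum_cons, ssign_ι_mul _ hc, map_smul,
      LinearMap.smul_apply, ih, mul_smul_comm, ← LinearMap.mulLeft_apply (R := R) _ (cutSum _ x),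
      map_cutSum]
    congr 1
    · simp
    · rw [smul_cutSum]
      refine cutSum_congr fun u v _ => ?_
      rw [LinearMap.mulLeft_apply, mul_smul_comm, smul_smul, ← sg_add, ssign_ssign, par_cons,
        mon_cons, mul_assoc, add_comm (par u)]
      congr 2
      ring

theorem shuffle_concat_mon {i : ℤ} {c : A} (hc : c ∈ 𝒜 i) (z : TA R A)
    (u x : List (Σ i, 𝒜 i)) :
    shuffle 𝒜 (mon u * (TensorAlgebra.ι R c * z)) (mon x) = cutSum (fun x₁ x₂ =>
      sg R (par x₁ * (i + 1)) • (shuffle 𝒜 (mon u) (mon x₁) * (TensorAlgebra.ι R c *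
        shuffle 𝒜 (ssign 𝒜 (par x₁) z) (mon x₂)))) x := by
  induction u generalizing z x with
  | nil => simpa using shuffle_concat_nil hc z x
  | cons a u ihu =>
    induction x generalizing z with
    | nil => simp
    | cons b x ihx =>
      have e : ssign 𝒜 (b.1 + 1) (mon (a :: u) * (TensorAlgebra.ι R c * z)) =
          sg R ((b.1 + 1) * ((a.1 + 1) + par u) + (b.1 + 1) * (i + 1)) •
            (mon (a :: u) * (TensorAlgebra.ι R c * ssign 𝒜 (b.1 + 1) z)) := by
        rw [ssign_mul_mon, ssign_ι_mul _ hc, mul_smul_comm, smul_smul, ← sg_add, par_cons]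
      have h : mon (a :: u) * (TensorAlgebra.ι R c * z) =
          TensorAlgebra.ι R (a.2 : A) * (mon u * (TensorAlgebra.ι R c * z)) := by
        rw [mon_cons, mul_assoc]
      rw [h, mon_cons b, shuffle_ι_mul a.2.2 b.2.2, ← mon_cons, ← h, e, map_smul, LinearMap.smul_apply, ihx, ihu, cutSum_cons, cutSum_cons,
        mul_add, mul_smul_comm _ (TensorAlgebra.ι R (b.2 : A)) (cutSum _ x), add_assoc]
      congr 1
      · simp [mul_assoc]
      · simp only [← LinearMap.mulLeft_apply (R := R) _ (cutSum _ x), map_cutSum]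
        rw [smul_cutSum, ← cutSum_add]
        refine cutSum_congr fun v w _ => ?_
        simp only [LinearMap.mulLeft_apply, mul_smul_comm, smul_smul, ← sg_add, ssign_ssign,
          par_cons, shuffle_mon_cons, add_mul, smul_add, smul_mul_assoc, mul_assoc,
          add_comm (par v)]
        congr 3
        ring

theorem shuffle_concat {i : ℤ} {c : A} (hc : c ∈ 𝒜 i) (u z : TA R A) (x : List (Σ i, 𝒜 i)) :
    shuffle 𝒜 (u * (TensorAlgebra.ι R c * z)) (mon x) = cutSum (fun x₁ x₂ =>
      sg R (par x₁ * (i + 1)) • (shuffle 𝒜 u (mon x₁) * (TensorAlgebra.ι R c *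
        shuffle 𝒜 (ssign 𝒜 (par x₁) z) (mon x₂)))) x := by
  induction u using TA_induction 𝒜 with
  | h0 => simp [cutSum_zero]
  | hadd y y' hy hy' => simp [hy, hy', add_mul, cutSum_add]
  | hsmul k y hy =>
    simp only [smul_mul_assoc, map_smul, LinearMap.smul_apply, hy, smul_comm _ k]
    rw [smul_cutSum]
  | hmon v => exact shuffle_concat_mon hc z v x

end ShuffleAlgebra

theorem cutSum_comm {L L' M : Type*} [AddCommGroup M] (f : List L → List L → List L' → List L' → M)
    (w : List L) (x : List L') :
    cutSum (fun u v => cutSum (fun y z => f u v y z) x) w =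
      cutSum (fun y z => cutSum (fun u v => f u v y z) w) x := by
  induction w generalizing f with
  | nil => rfl
  | cons l w ih => simp only [cutSum_cons, ih fun u v => f (l :: u) v, cutSum_add]

theorem cutSum_sub {L M : Type*} [AddCommGroup M] (f g : List L → List L → M) (w : List L) :
    cutSum (fun u v => f u v - g u v) w = cutSum f w - cutSum g w := by
  rw [eq_sub_iff_add_eq, ← cutSum_add]
  simp

/-! ### Homogeneous elements as combinations of words -/

section Grading

variable {R A : Type*} [CommRing R] [AddCommGroup A] [Module R A] {𝒜 : ℤ → Submodule R A}

theorem grading_le (N : ℤ) : grading R A 𝒜 N ≤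
    Submodule.span R (mon '' {w : List (Σ i, 𝒜 i) | wdeg w = N}) := by
  rw [grading, Submodule.span_le]
  rintro _ ⟨n, d, a, ha, hN, rfl⟩
  refine Submodule.subset_span ⟨_, ?_, mon_ofFn d a ha⟩
  rw [Set.mem_ofPred_eq, ← hN]
  clear hN
  induction n with
  | zero => simp
  | succ n ih =>
    rw [List.ofFn_succ, wdeg_cons, Fin.sum_univ_succ]
    have := ih (fun i => d i.succ) (fun i => a i.succ) fun i => ha i.succ
    rw [this]
    push_cast; ring

theorem mon_mem_grading (w : List (Σ i, 𝒜 i)) : mon w ∈ grading R A 𝒜 (wdeg w) := by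
  obtain ⟨n, d, a, ha, hd, -, hw⟩ := exists_tprod_eq_mon w
  exact Submodule.subset_span ⟨n, d, a, ha, hd.symm, hw⟩

theorem grading_induction {N : ℤ} {P : TA R A → Prop} (h0 : P 0)
    (hadd : ∀ x y, P x → P y → P (x + y)) (hsmul : ∀ (c : R) x, P x → P (c • x))
    (hmon : ∀ w : List (Σ i, 𝒜 i), wdeg w = N → P (mon w)) {x : TA R A}
    (hx : x ∈ grading R A 𝒜 N) : P x := by
  refine Submodule.span_induction (p := fun x _ => P x) ?_ h0 (fun x y _ _ => hadd x y)
    (fun c x _ => hsmul c x) (grading_le N hx)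
  rintro _ ⟨w, hw, rfl⟩
  exact hmon w hw

end Grading

/-! ### Graded commutators with shuffle multiplications -/

section Order

variable {R A M : Type*} [CommRing R] [AddCommGroup A] [Module R A] [AddCommGroup M] [Module R M]
variable {𝒜 : ℤ → Submodule R A} [DirectSum.Decomposition 𝒜]

theorem ssign_ι (p : ZMod 2) {i : ℤ} {a : A} (ha : a ∈ 𝒜 i) :
    ssign 𝒜 p (TensorAlgebra.ι R a) = sg R (p * (i + 1)) • TensorAlgebra.ι R a := by
  simpa using ssign_ι_mul p ha 1

/-- Writing the sign as `ssign` applied to the letter removes the homogeneity hypothesis, so `c` may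
be a value `G(y₂)`. -/
theorem shuffle_concat_letter (c : A) (u z : TA R A) (x : List (Σ i, 𝒜 i)) :
    shuffle 𝒜 (u * (TensorAlgebra.ι R c * z)) (mon x) = cutSum (fun x₁ x₂ =>
      shuffle 𝒜 u (mon x₁) * (ssign 𝒜 (par x₁) (TensorAlgebra.ι R c) *
        shuffle 𝒜 (ssign 𝒜 (par x₁) z) (mon x₂))) x := by
  induction c using DirectSum.Decomposition.inductionOn 𝒜 with
  | zero => simp [cutSum_zero]
  | add a b ha hb => simp only [map_add, add_mul, mul_add, LinearMap.add_apply, ha, hb, cutSum_add]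
  | homogeneous c =>
    rw [shuffle_concat c.2]
    exact cutSum_congr fun _ _ _ => by rw [ssign_ι _ c.2, smul_mul_assoc, mul_smul_comm]

theorem conv_shuffle (α β : TA R A →ₗ[R] TA R A) (x : List (Σ i, 𝒜 i)) (y : TA R A) :
    conv α β (shuffle 𝒜 (mon x) y) = cutSum (fun x₁ x₂ =>
      conv (α ∘ₗ shuffle 𝒜 (mon x₁) ∘ₗ ssign 𝒜 (par x₂)) (β ∘ₗ shuffle 𝒜 (mon x₂)) y) x := by
  simp only [conv, LinearMap.comp_apply, coproduct_shuffle, map_cutSum]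
  refine cutSum_congr fun u v _ => ?_
  rw [← LinearMap.comp_apply (TensorProduct.map α β), ← TensorProduct.map_comp]

theorem conv_ssign (α β : TA R A →ₗ[R] TA R A) (p : ZMod 2) (y : TA R A) :
    conv α β (ssign 𝒜 p y) = conv (α ∘ₗ ssign 𝒜 p) (β ∘ₗ ssign 𝒜 p) y := by
  induction y using TA_induction 𝒜 with
  | h0 => simp
  | hadd y y' hy hy' => simp [hy, hy']
  | hsmul c y hy => simp [hy]
  | hmon w =>
    rw [ssign_mon, map_smul, conv_mon, conv_mon, smul_cutSum]
    refine cutSum_congr fun u v h => ?_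
    simp only [LinearMap.comp_apply, ssign_mon, map_smul, smul_mul_assoc, mul_smul_comm,
      smul_smul, ← sg_add, ← h, par_append]
    congr 2
    ring

theorem conv_smul_left (c : R) (α β : TA R A →ₗ[R] TA R A) :
    conv (c • α) β = c • conv α β := by
  ext1 x; simp [conv, TensorProduct.map_smul_left]

theorem conv_smul_right (c : R) (α β : TA R A →ₗ[R] TA R A) :
    conv α (c • β) = c • conv α β := by
  ext1 x; simp [conv, TensorProduct.map_smul_right]

theorem conv_zero_left (β : TA R A →ₗ[R] TA R A) : conv 0 β = 0 := by
  ext1 x; simp [conv, TensorProduct.map_zero_left]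

theorem conv_zero_right (α : TA R A →ₗ[R] TA R A) : conv α 0 = 0 := by
  ext1 x; simp [conv, TensorProduct.map_zero_right]

/-- The letter `G(y₂)` serves as the marked letter at which `x` is cut. -/
theorem shuffle_conv_conv (α γ : TA R A →ₗ[R] TA R A) (G : TA R A →ₗ[R] A) (y : TA R A)
    (x : List (Σ i, 𝒜 i)) :
    shuffle 𝒜 (conv α (conv (TensorAlgebra.ι R ∘ₗ G) γ) y) (mon x) = cutSum (fun x₁ x₂ =>
      conv ((shuffle 𝒜).flip (mon x₁) ∘ₗ α)
        (conv (ssign 𝒜 (par x₁) ∘ₗ TensorAlgebra.ι R ∘ₗ G)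
          ((shuffle 𝒜).flip (mon x₂) ∘ₗ ssign 𝒜 (par x₁) ∘ₗ γ)) y) x := by
  induction y using TA_induction 𝒜 with
  | h0 => simp [cutSum_zero]
  | hadd y y' hy hy' => simp only [map_add, LinearMap.add_apply, hy, hy', cutSum_add]
  | hsmul c y hy => simp only [map_smul, LinearMap.smul_apply, hy, smul_cutSum]
  | hmon w =>
    have h : ∀ (a : TA R A) (f : List (Σ i, 𝒜 i) → List (Σ i, 𝒜 i) → TA R A)
        (v : List (Σ i, 𝒜 i)), a * cutSum f v = cutSum (fun s t => a * f s t) v :=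
      fun a f v => map_cutSum (LinearMap.mulLeft R a) f v
    have h' : ∀ (f : List (Σ i, 𝒜 i) → List (Σ i, 𝒜 i) → TA R A) (v : List (Σ i, 𝒜 i)),
        shuffle 𝒜 (cutSum f v) (mon x) = cutSum (fun s t => shuffle 𝒜 (f s t) (mon x)) v :=
      fun f v => map_cutSum ((shuffle 𝒜).flip (mon x)) f v
    simp only [conv_mon, h, h', LinearMap.flip_apply, LinearMap.comp_apply, shuffle_concat_letter]
    simp only [cutSum_comm _ _ x]

variable (𝒜) in
/-- The graded commutator of `T` with the multiplication by `x`, an element of parity `p`. -/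
def shuffleComm (p : ZMod 2) (x : TA R A) (T : TA R A →ₗ[R] TA R A) : TA R A →ₗ[R] TA R A :=
  T ∘ₗ shuffle 𝒜 x - (shuffle 𝒜).flip x ∘ₗ T ∘ₗ ssign 𝒜 p

/-- With `x` multiplied from the right, the sign involves only `|x||y|` and not the degree of `T`;
the commutator is therefore linear in an arbitrary, possibly inhomogeneous, `T`. -/
theorem shuffleComm_apply (p : ZMod 2) (x : TA R A) (T : TA R A →ₗ[R] TA R A) (y : TA R A) :
    shuffleComm 𝒜 p x T y = T (shuffle 𝒜 x y) - shuffle 𝒜 (T (ssign 𝒜 p y)) x := rfl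

variable (𝒜) in
/-- Conditions on `α`, `G`, `γ` that make `x ↦ ∑ α(x₁) G(x₂) γ(x₃)` an operator whose
`k`-fold commutators with multiplications vanish. -/
structure IsOrderTriple (k : ℕ) (g c : ZMod 2) (α : TA R A →ₗ[R] TA R A) (G : TA R A →ₗ[R] A)
    (γ : TA R A →ₗ[R] TA R A) : Prop where
  left_mul : ∀ (x : List (Σ i, 𝒜 i)) (y : TA R A), α (shuffle 𝒜 (mon x) y) =
    sg R ((g + c) * par x) • shuffle 𝒜 (α (ssign 𝒜 (par x) y)) (mon x)
  right_mul : ∀ (x : List (Σ i, 𝒜 i)) (y : TA R A), γ (shuffle 𝒜 (mon x) y) =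
    shuffle 𝒜 (γ (ssign 𝒜 (par x) y)) (mon x)
  right_parity : ∀ (p : ZMod 2) (y : TA R A), ssign 𝒜 p (γ y) = sg R (p * c) • γ (ssign 𝒜 p y)
  parity : ∀ (p : ZMod 2) (y : TA R A), ssign 𝒜 p (TensorAlgebra.ι R (G y)) =
    sg R (p * g) • TensorAlgebra.ι R (G (ssign 𝒜 p y))
  vanish : ∀ w : List (Σ i, 𝒜 i), k ≤ w.length → G (mon w) = 0

/-- Shuffling adds lengths; this is what lowers the vanishing bound in `IsOrderTriple.mul`. -/
theorem shuffle_mon_mem (x y : List (Σ i, 𝒜 i)) : shuffle 𝒜 (mon x) (mon y) ∈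
    Submodule.span R (mon '' {w : List (Σ i, 𝒜 i) | w.length = x.length + y.length}) := by
  have hι : ∀ (l : Σ i, 𝒜 i) (n m : ℕ) (z : TA R A), n + 1 = m →
      z ∈ Submodule.span R (mon '' {w : List (Σ i, 𝒜 i) | w.length = n}) →
      TensorAlgebra.ι R (l.2 : A) * z ∈
        Submodule.span R (mon '' {w : List (Σ i, 𝒜 i) | w.length = m}) := by
    rintro l n m z rfl hz
    rw [← LinearMap.mulLeft_apply (R := R), ← Submodule.mem_comap]
    refine Submodule.span_le.2 ?_ hz
    rintro _ ⟨w, hw, rfl⟩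
    exact Submodule.subset_span ⟨l :: w, by simpa using hw, rfl⟩
  induction x generalizing y with
  | nil =>
    rw [mon_nil, shuffle_one_left]
    exact Submodule.subset_span ⟨y, by simp, rfl⟩
  | cons l x ihx =>
    induction y with
    | nil =>
      rw [mon_nil, shuffle_one_right]
      exact Submodule.subset_span ⟨l :: x, by simp, rfl⟩
    | cons m y ihy =>
      rw [shuffle_mon_cons]
      refine add_mem (hι _ _ _ _ ?_ (ihx _)) (Submodule.smul_mem _ _ (hι _ _ _ _ ?_ ihy)) <;>
        simp <;> omega

theorem shuffle_mon_swap (x y : List (Σ i, 𝒜 i)) (z : TA R A) :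
    shuffle 𝒜 (mon x) (shuffle 𝒜 (mon y) z) =
      sg R (par x * par y) • shuffle 𝒜 (mon y) (shuffle 𝒜 (mon x) z) := by
  rw [← shuffle_assoc, shuffle_mon_comm, map_smul, LinearMap.smul_apply, shuffle_assoc]

theorem ssign_mon_shuffle (p : ZMod 2) (x : List (Σ i, 𝒜 i)) (y : TA R A) :
    ssign 𝒜 p (shuffle 𝒜 (mon x) y) = sg R (p * par x) • shuffle 𝒜 (mon x) (ssign 𝒜 p y) := by
  rw [ssign_shuffle, ssign_mon, map_smul, LinearMap.smul_apply]

/-- The three maps absorb the pieces of `x`, whose parities are added to `g` and `c`. As `x₂` is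
nonempty, shuffling with it lengthens every word by at least one, so the new middle map vanishes
from length `k` on. -/
theorem IsOrderTriple.mul {k : ℕ} {g c : ZMod 2} {α γ : TA R A →ₗ[R] TA R A}
    {G : TA R A →ₗ[R] A} (h : IsOrderTriple 𝒜 (k + 1) g c α G γ) (x₁ x₂ x₃ : List (Σ i, 𝒜 i))
    (hx : x₂ ≠ []) :
    IsOrderTriple 𝒜 k (g + par x₂) (c + par x₃)
      (α ∘ₗ shuffle 𝒜 (mon x₁) ∘ₗ ssign 𝒜 (par x₂ + par x₃))
      (G ∘ₗ shuffle 𝒜 (mon x₂) ∘ₗ ssign 𝒜 (par x₃)) (γ ∘ₗ shuffle 𝒜 (mon x₃)) where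
  left_mul x y := by
    simp only [LinearMap.comp_apply, ssign_mon_shuffle, map_smul, shuffle_mon_swap x₁ x,
      h.left_mul x, smul_smul, ← sg_add, LinearMap.smul_apply, ssign_comm (par x)]
    congr 2
    generalize par x = a, par x₁ = b, par x₂ = d, par x₃ = e
    clear h
    revert a b c d e g; decide
  right_mul x y := by
    simp only [LinearMap.comp_apply, ssign_mon_shuffle, map_smul, shuffle_mon_swap x₃ x,
      h.right_mul x, smul_smul, ← sg_add, LinearMap.smul_apply]
    rw [mul_comm, CharTwo.add_self_eq_zero, sg_zero, one_smul]
  right_parity p y := by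
    simp only [LinearMap.comp_apply, h.right_parity, ssign_mon_shuffle, map_smul, smul_smul,
      ← sg_add, mul_add]
  parity p y := by
    simp only [LinearMap.comp_apply, h.parity, ssign_mon_shuffle, map_smul, smul_smul,
      ← sg_add, mul_add, ssign_comm p]
  vanish w hw := by
    have hlen : k + 1 ≤ x₂.length + w.length := by
      have := List.length_pos_iff.2 hx
      omega
    have : Submodule.span R (mon '' {v : List (Σ i, 𝒜 i) | v.length = x₂.length + w.length}) ≤
        LinearMap.ker G := by
      rw [Submodule.span_le]
      rintro _ ⟨v, hv, rfl⟩
      exact h.vanish v (by rw [hv]; exact hlen)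
    rw [LinearMap.comp_apply, LinearMap.comp_apply, ssign_mon, map_smul, map_smul,
      this (shuffle_mon_mem x₂ w), smul_zero]

variable (𝒜) in
/-- The operators spanned by `x ↦ ∑ α(x₁) G(x₂) γ(x₃)` with `IsOrderTriple 𝒜 k g c α G γ`. -/
def orderSpan (k : ℕ) : Submodule R (TA R A →ₗ[R] TA R A) :=
  Submodule.span R {T | ∃ g c α G γ, IsOrderTriple 𝒜 k g c α G γ ∧
    T = conv α (conv (TensorAlgebra.ι R ∘ₗ G) γ)}

/-- For `k = 0` the middle map vanishes on every word. -/
theorem orderSpan_zero {T : TA R A →ₗ[R] TA R A} (hT : T ∈ orderSpan 𝒜 0) : T = 0 := by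
  have : orderSpan 𝒜 0 ≤ (⊥ : Submodule R (TA R A →ₗ[R] TA R A)) := by
    rw [orderSpan, Submodule.span_le]
    rintro _ ⟨g, c, α, G, γ, h, rfl⟩
    have hG : G = 0 := hom_ext_mon 𝒜 fun w => h.vanish w (by omega)
    simp [hG, conv_zero_left, conv_zero_right]
  simpa using this hT

theorem IsOrderTriple.shuffleComm_mem {k : ℕ} {g c : ZMod 2} {α γ : TA R A →ₗ[R] TA R A}
    {G : TA R A →ₗ[R] A} (h : IsOrderTriple 𝒜 (k + 1) g c α G γ) (x : List (Σ i, 𝒜 i)) :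
    shuffleComm 𝒜 (par x) (mon x) (conv α (conv (TensorAlgebra.ι R ∘ₗ G) γ)) ∈ orderSpan 𝒜 k := by
  have key : shuffleComm 𝒜 (par x) (mon x) (conv α (conv (TensorAlgebra.ι R ∘ₗ G) γ)) =
      cutSum (fun x₁ x' =>
        cutSum (fun x₂ x₃ => conv (α ∘ₗ shuffle 𝒜 (mon x₁) ∘ₗ ssign 𝒜 (par x'))
          (conv (TensorAlgebra.ι R ∘ₗ (G ∘ₗ shuffle 𝒜 (mon x₂) ∘ₗ ssign 𝒜 (par x₃)))
            (γ ∘ₗ shuffle 𝒜 (mon x₃)))) x' -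
        conv (α ∘ₗ shuffle 𝒜 (mon x₁) ∘ₗ ssign 𝒜 (par x'))
          (conv (TensorAlgebra.ι R ∘ₗ (G ∘ₗ shuffle 𝒜 1 ∘ₗ ssign 𝒜 (par x')))
            (γ ∘ₗ shuffle 𝒜 (mon x')))) x := by
    ext1 y
    rw [shuffleComm_apply, conv_shuffle, shuffle_conv_conv, cutSum_apply, ← cutSum_sub]
    refine cutSum_congr fun x₁ x' hx => ?_
    rw [LinearMap.sub_apply]
    congr 1
    · have : conv (TensorAlgebra.ι R ∘ₗ G) γ ∘ₗ shuffle 𝒜 (mon x') = cutSum (fun x₂ x₃ =>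
          conv (TensorAlgebra.ι R ∘ₗ (G ∘ₗ shuffle 𝒜 (mon x₂) ∘ₗ ssign 𝒜 (par x₃)))
            (γ ∘ₗ shuffle 𝒜 (mon x₃))) x' := by
        ext1 z
        rw [LinearMap.comp_apply, conv_shuffle, cutSum_apply]
        rfl
      rw [this]
      let Ψ : (TA R A →ₗ[R] TA R A) →+ (TA R A →ₗ[R] TA R A) :=
        { toFun := fun β => conv (α ∘ₗ shuffle 𝒜 (mon x₁) ∘ₗ ssign 𝒜 (par x')) β
          map_zero' := conv_zero_right _
          map_add' := fun β β' => by
            ext1 z; simp [conv, TensorProduct.map_add_right] }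
      exact LinearMap.congr_fun (map_cutSum Ψ _ x') y
    · rw [conv_ssign]
      -- The sign `(-1)^((g + c)|x₁|)` occurs twice, once in `α` and once from `x₁` passing `G` and
      -- `γ`, and so cancels.
      have h1 : ((shuffle 𝒜).flip (mon x₁) ∘ₗ α) ∘ₗ ssign 𝒜 (par x) =
          sg R ((g + c) * par x₁) • (α ∘ₗ shuffle 𝒜 (mon x₁) ∘ₗ ssign 𝒜 (par x')) := by
        ext1 z
        simp only [LinearMap.comp_apply, LinearMap.smul_apply, h.left_mul, smul_smul,
          sg_mul_self, one_smul, ← hx, par_append, LinearMap.flip_apply, ssign_ssign]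
      have h2 : conv (ssign 𝒜 (par x₁) ∘ₗ TensorAlgebra.ι R ∘ₗ G)
          ((shuffle 𝒜).flip (mon x') ∘ₗ ssign 𝒜 (par x₁) ∘ₗ γ) ∘ₗ ssign 𝒜 (par x) =
          sg R ((g + c) * par x₁) •
          conv (TensorAlgebra.ι R ∘ₗ (G ∘ₗ shuffle 𝒜 1 ∘ₗ ssign 𝒜 (par x')))
            (γ ∘ₗ shuffle 𝒜 (mon x')) := by
        have e1 : (ssign 𝒜 (par x₁) ∘ₗ TensorAlgebra.ι R ∘ₗ G) ∘ₗ ssign 𝒜 (par x) =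
            sg R (par x₁ * g) •
              (TensorAlgebra.ι R ∘ₗ (G ∘ₗ shuffle 𝒜 1 ∘ₗ ssign 𝒜 (par x'))) := by
          ext1 z
          simp only [LinearMap.comp_apply, LinearMap.smul_apply, h.parity, ← hx, par_append,
            shuffle_one_left, ← ssign_ssign, ssign_self]
        have e2 : ((shuffle 𝒜).flip (mon x') ∘ₗ ssign 𝒜 (par x₁) ∘ₗ γ) ∘ₗ ssign 𝒜 (par x) =
            sg R (par x₁ * c) • (γ ∘ₗ shuffle 𝒜 (mon x')) := by
          ext1 z
          simp only [LinearMap.comp_apply, LinearMap.smul_apply, h.right_parity, ← hx, par_append,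
            h.right_mul, ← ssign_ssign, ssign_self, map_smul, LinearMap.flip_apply]
        ext1 z
        rw [LinearMap.comp_apply, conv_ssign, e1, e2, conv_smul_left, conv_smul_right, smul_smul,
          ← sg_add]
        congr 3
        ring
      rw [h1, h2, conv_smul_left, conv_smul_right, smul_smul, sg_mul_self, one_smul]
  rw [key]
  refine cutSum_mem _ fun x₁ x' _ => ?_
  -- For each `x₁` the subtracted term is the one with `x₂` empty. It is the only term if `x'` is
  -- empty, and otherwise the remaining `x₂` start with the first letter of `x'`.
  cases x' with
  | nil => simp
  | cons a l =>
    rw [cutSum_cons, mon_nil, add_sub_cancel_left]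
    refine cutSum_mem _ fun x₂ x₃ e => Submodule.subset_span
      ⟨_, _, _, _, _, h.mul x₁ (a :: x₂) x₃ (by simp), ?_⟩
    rw [← par_append, List.cons_append, e]

theorem shuffleComm_mem {k : ℕ} {T : TA R A →ₗ[R] TA R A} (hT : T ∈ orderSpan 𝒜 (k + 1))
    (x : List (Σ i, 𝒜 i)) : shuffleComm 𝒜 (par x) (mon x) T ∈ orderSpan 𝒜 k := by
  induction hT using Submodule.span_induction with
  | zero => simp [shuffleComm]
  | add S T _ _ hS hT =>
    convert add_mem hS hT using 1
    ext1 y; simp [shuffleComm_apply]; abel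
  | smul r T _ hT =>
    convert Submodule.smul_mem _ r hT using 1
    ext1 y; simp [shuffleComm_apply, smul_sub]
  | mem T hT =>
    obtain ⟨g, c, α, G, γ, h, rfl⟩ := hT
    exact h.shuffleComm_mem x

theorem shuffleComm_mem_of_mem_grading {k : ℕ} {T : TA R A →ₗ[R] TA R A}
    (hT : T ∈ orderSpan 𝒜 (k + 1)) {N : ℤ} {x : TA R A} (hx : x ∈ grading R A 𝒜 N) :
    shuffleComm 𝒜 N x T ∈ orderSpan 𝒜 k := by
  refine grading_induction (P := fun x => shuffleComm 𝒜 N x T ∈ orderSpan 𝒜 k)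
    (by simp [shuffleComm]) (fun x y hx hy => ?_) (fun r x hx => ?_) (fun w hw => ?_) hx
  · convert add_mem hx hy using 1
    ext1 z; simp [shuffleComm_apply]; abel
  · convert Submodule.smul_mem _ r hx using 1
    ext1 y; simp [shuffleComm_apply, smul_sub]
  · rw [← hw, ← par_eq_wdeg]
    exact shuffleComm_mem hT w

theorem ssign_of_mem_grading (p : ZMod 2) {N : ℤ} {x : TA R A} (hx : x ∈ grading R A 𝒜 N) :
    ssign 𝒜 p x = sg R (p * N) • x := by
  refine grading_induction (P := fun x => ssign 𝒜 p x = sg R (p * N) • x) (by simp)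
    (fun x y hx hy => by simp [hx, hy]) (fun r x hx => by simp [hx, smul_comm r])
    (fun w hw => by rw [ssign_mon, par_eq_wdeg, hw]) hx

/-- In the shifted grading the corestriction has degree `3 - 2k`, which is odd for every `k`. -/
theorem ssign_corestriction {k : ℕ} {f : MultilinearMap R (fun _ : Fin k => A) A}
    (hf : ∀ (d : Fin k → ℤ) (a : Fin k → A), (∀ i, a i ∈ 𝒜 (d i)) →
      f a ∈ 𝒜 ((∑ i, d i) + (2 - (k : ℤ)))) (p : ZMod 2) (y : TA R A) :
    ssign 𝒜 p (TensorAlgebra.ι R (corestriction 𝒜 f y)) =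
      sg R (p * 1) • TensorAlgebra.ι R (corestriction 𝒜 f (ssign 𝒜 p y)) := by
  induction y using TA_induction 𝒜 with
  | h0 => simp
  | hadd y y' hy hy' => simp only [map_add, smul_add, hy, hy']
  | hsmul c y hy => simp only [map_smul, hy, smul_comm c]
  | hmon w =>
    obtain ⟨n, d, a, ha, hd, hn, hw⟩ := exists_tprod_eq_mon w
    rw [ssign_mon, hw]
    by_cases h : n = k
    · subst h
      rw [map_smul, map_smul, corestriction_tprod, shifted, signed_apply 𝒜 _ _ d a ha,
        uzpow_smul R, map_smul, map_smul, ssign_ι p (hf d a ha), par_eq_wdeg, hd, smul_comm,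
        smul_smul, smul_smul, smul_smul, ← sg_add, ← sg_add, ← sg_add]
      congr 2
      push_cast
      generalize (∑ i, (d i : ZMod 2)) = s, (n : ZMod 2) = m,
        (∑ j : Fin n, ((n - 1 - j : ℕ) : ZMod 2) * (d j : ZMod 2)) = q
      revert p s m q; decide
    · rw [map_smul, corestriction_tprod_ne _ h]; simp

/-- The triple is `α = ssign 𝒜 1`, the corestriction and the identity. The corestriction lives on
words of length exactly `k`, so it vanishes from length `k + 1` on. -/
theorem lift_mem_orderSpan {k : ℕ} (hk : 1 ≤ k) {f : MultilinearMap R (fun _ : Fin k => A) A}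
    (hf : ∀ (d : Fin k → ℤ) (a : Fin k → A), (∀ i, a i ∈ 𝒜 (d i)) →
      f a ∈ 𝒜 ((∑ i, d i) + (2 - (k : ℤ)))) : lift 𝒜 f ∈ orderSpan 𝒜 (k + 1) := by
  refine Submodule.subset_span ⟨1, 0, ssign 𝒜 1, corestriction 𝒜 f, LinearMap.id, ?_,
    (isOddExtension_lift 𝒜 hk f).eq_conv⟩
  refine ⟨fun x y => ?_, fun x y => shuffle_comm_mon x y, by simp,
    ssign_corestriction hf, fun w hw => ?_⟩
  · rw [ssign_mon_shuffle, shuffle_comm_mon, add_zero, ssign_comm]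
  · obtain ⟨n, d, a, ha, hd, hn, hw'⟩ := exists_tprod_eq_mon w
    rw [hw', corestriction_tprod_ne _ (by omega)]

end Order

/-! ### The operator order of the lifts -/

section SubsetSums

theorem sum_finset_fin_succ {M : Type*} [AddCommMonoid M] {m : ℕ}
    (f : Finset (Fin (m + 1)) → M) :
    ∑ S, f S = ∑ S : Finset (Fin m),
      (f (S.map (Fin.succEmb m)) + f (Finset.cons 0 (S.map (Fin.succEmb m)) (by simp))) := by
  classical
  have h0 : (0 : Fin (m + 1)) ∉ (Finset.univ : Finset (Fin m)).image Fin.succ := by simp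
  have hu : (Finset.univ : Finset (Fin (m + 1))) =
      insert 0 ((Finset.univ : Finset (Fin m)).image Fin.succ) := by
    ext i
    refine Fin.cases ?_ (fun i => ?_) i <;> simp
  rw [← Finset.powerset_univ, hu, Finset.sum_powerset_insert h0, Finset.powerset_image,
    Finset.sum_image (Finset.image_injective (Fin.succ_injective m)).injOn,
    Finset.sum_image (Finset.image_injective (Fin.succ_injective m)).injOn, Finset.powerset_univ,
    ← Finset.sum_add_distrib]
  refine Finset.sum_congr rfl fun S _ => ?_
  rw [Finset.cons_eq_insert, Finset.map_eq_image]
  rfl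

variable {m : ℕ} (S : Finset (Fin m))

theorem sort_map_succ : (S.map (Fin.succEmb m)).sort = S.sort.map Fin.succ :=
  (Finset.map_sort (Fin.succEmb m) S _ _ fun a _ b _ => by simp).symm

theorem sort_cons_zero_map_succ :
    (Finset.cons 0 (S.map (Fin.succEmb m)) (by simp)).sort = 0 :: S.sort.map Fin.succ := by
  rw [Finset.sort_cons _ (fun b _ => Fin.zero_le b), sort_map_succ]

theorem compl_map_succ : (S.map (Fin.succEmb m))ᶜ =
    Finset.cons 0 (Sᶜ.map (Fin.succEmb m)) (by simp) := by
  ext i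
  refine Fin.cases ?_ (fun i => ?_) i <;> simp

theorem compl_cons_zero_map_succ : (Finset.cons 0 (S.map (Fin.succEmb m)) (by simp))ᶜ =
    Sᶜ.map (Fin.succEmb m) := by
  ext i
  refine Fin.cases ?_ (fun i => ?_) i <;> simp

/-- When `0` is not in the subset, every selected element has to pass `x₀`; when it is, `x₀` is
passed by nothing. -/
theorem subsetSign_map_succ (d : Fin (m + 1) → ℤ) :
    subsetSign d (S.map (Fin.succEmb m)) =
      (d 0 * ∑ j ∈ S, d j.succ).negOnePow * subsetSign (fun i => d i.succ) S := by
  have : ∀ S' : Finset (Fin m), (d 0 * ∑ j ∈ S', d j.succ).negOnePow =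
      ∏ j ∈ S', (d 0 * d j.succ).negOnePow := by
    intro S'
    induction S' using Finset.induction_on with
    | empty => simp
    | insert j S' hj ih =>
      rw [Finset.sum_insert hj, Finset.prod_insert hj, mul_add, Int.negOnePow_add, ih]
  unfold subsetSign
  rw [Fin.prod_univ_succ]
  simp only [Fin.prod_univ_succ]
  congr 1
  · simp [this, Finset.prod_ite_mem]
  · simp

theorem subsetSign_cons_zero_map_succ (d : Fin (m + 1) → ℤ) :
    subsetSign d (Finset.cons 0 (S.map (Fin.succEmb m)) (by simp)) =
      subsetSign (fun i => d i.succ) S := by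
  unfold subsetSign
  rw [Fin.prod_univ_succ]
  simp only [Fin.prod_univ_succ]
  simp

end SubsetSums

section OperatorOrder

variable {R A : Type*} [CommRing R] [AddCommGroup A] [Module R A]
variable {𝒜 : ℤ → Submodule R A} [DirectSum.Decomposition 𝒜]

theorem ssign_listProd (p : ZMod 2) {m : ℕ} (d : Fin m → ℤ) (x : Fin m → TA R A)
    (hx : ∀ i, x i ∈ grading R A 𝒜 (d i)) (l : List (Fin m)) :
    ssign 𝒜 p (listProd (shuffle 𝒜) 1 (l.map x)) =
      sg R (p * ((l.map d).sum : ℤ)) • listProd (shuffle 𝒜) 1 (l.map x) := by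
  induction l with
  | nil => simp [listProd]
  | cons i l ih =>
    change ssign 𝒜 p (shuffle 𝒜 (x i) (listProd (shuffle 𝒜) 1 (l.map x))) =
      _ • shuffle 𝒜 (x i) (listProd (shuffle 𝒜) 1 (l.map x))
    rw [ssign_shuffle, ih, ssign_of_mem_grading p (hx i), map_smul, map_smul,
      LinearMap.smul_apply, smul_smul, ← sg_add]
    rw [List.map_cons, List.sum_cons, Int.cast_add, mul_add, add_comm (p * _)]

/-- Pairing each subset without `0` with the same subset enlarged by `0` turns the sum for `T` into
the sum for the commutator of `T` with `x₀` on the remaining elements. After `m` commutators the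
operator is zero. -/
theorem sum_subsets_eq_zero {m : ℕ} {T : TA R A →ₗ[R] TA R A} (hT : T ∈ orderSpan 𝒜 m)
    (d : Fin m → ℤ) (x : Fin m → TA R A) (hx : ∀ i, x i ∈ grading R A 𝒜 (d i)) :
    ∑ S : Finset (Fin m), ((-1 : ℤˣ) ^ (m - S.card) * subsetSign d S) •
      shuffle 𝒜 (T (listProd (shuffle 𝒜) 1 (S.sort.map x)))
        (listProd (shuffle 𝒜) 1 (Sᶜ.sort.map x)) = 0 := by
  induction m generalizing T with
  | zero =>
    rw [orderSpan_zero hT]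
    simp
  | succ m ih =>
    have := ih (shuffleComm_mem_of_mem_grading hT (hx 0)) (fun i => d i.succ) (fun i => x i.succ)
      fun i => hx i.succ
    rw [sum_finset_fin_succ, ← this]
    refine Finset.sum_congr rfl fun S _ => ?_
    have hc : S.card ≤ m := by simpa using S.card_le_univ
    have e : m + 1 - S.card = (m - S.card) + 1 := by omega
    have hs : ((S.sort.map fun i => d i.succ).sum) = ∑ j ∈ S, d j.succ := by
      rw [← Finset.sum_map_toList]
      exact ((S.sort_perm_toList (· ≤ ·)).map _).sum_eq
    rw [compl_map_succ, compl_cons_zero_map_succ, subsetSign_map_succ,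
      subsetSign_cons_zero_map_succ, sort_map_succ, sort_cons_zero_map_succ,
      sort_cons_zero_map_succ, sort_map_succ, Finset.card_cons, Finset.card_map,
      Nat.add_sub_add_right, e]
    simp only [List.map_cons, List.map_map, Function.comp_def]
    change _ • shuffle 𝒜 _ (shuffle 𝒜 (x 0) _) + _ • shuffle 𝒜 (T (shuffle 𝒜 (x 0) _)) _ = _
    rw [shuffleComm_apply, ssign_listProd _ (fun i => d i.succ) (fun i => x i.succ)
      (fun i => hx i.succ), hs, map_sub, LinearMap.sub_apply, smul_sub, sub_eq_neg_add,
      shuffle_assoc]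
    congr 1
    rw [pow_succ, mul_neg_one, mul_left_comm, mul_smul, negOnePow_smul R, neg_mul]
    simp only [map_smul, LinearMap.smul_apply, Units.smul_def]
    rw [smul_comm]
    push_cast
    rw [neg_smul]
    rfl

theorem hasOperatorOrder_of_mem {k : ℕ} {T : TA R A →ₗ[R] TA R A} (hT : T ∈ orderSpan 𝒜 (k + 1))
    (h1 : T 1 = 0) : HasOperatorOrder (grading R A 𝒜) (shuffle 𝒜) 1 T k := by
  intro d x hx
  -- The sum over all subsets may be used, since the empty one contributes a multiple of `T 1 = 0`.
  rw [Finset.sum_filter_of_ne, sum_subsets_eq_zero hT d x hx]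
  intro S _ hS
  by_contra h
  rw [Finset.not_nonempty_iff_eq_empty] at h
  subst h
  refine hS ?_
  rw [Finset.sort_empty, List.map_nil]
  change _ • shuffle 𝒜 (T 1) _ = 0
  simp [h1]

end OperatorOrder

/-! ### The grading -/

section GradedAlgebra

variable {R A : Type*} [CommRing R] [AddCommGroup A] [Module R A]
variable {𝒜 : ℤ → Submodule R A}

theorem wdeg_append (u v : List (Σ i, 𝒜 i)) : wdeg (u ++ v) = wdeg u + wdeg v := by
  induction u with
  | nil => simp
  | cons l u ih => simp [ih, add_assoc]

theorem mul_mem_grading {i j : ℤ} {x y : TA R A} (hx : x ∈ grading R A 𝒜 i)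
    (hy : y ∈ grading R A 𝒜 j) : x * y ∈ grading R A 𝒜 (i + j) := by
  refine grading_induction (P := fun x => x * y ∈ grading R A 𝒜 (i + j)) (by simp)
    (fun x x' hx hx' => by rw [add_mul]; exact add_mem hx hx')
    (fun c x hx => by rw [smul_mul_assoc]; exact Submodule.smul_mem _ _ hx)
    (fun u hu => ?_) hx
  refine grading_induction (P := fun y => mon u * y ∈ grading R A 𝒜 (i + j)) (by simp)
    (fun x x' hx hx' => by rw [mul_add]; exact add_mem hx hx')
    (fun c x hx => by rw [mul_smul_comm]; exact Submodule.smul_mem _ _ hx)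
    (fun v hv => ?_) hy
  rw [← mon_append, ← hu, ← hv, ← wdeg_append]
  exact mon_mem_grading _

theorem ι_mem_grading {i : ℤ} {a : A} (ha : a ∈ 𝒜 i) :
    TensorAlgebra.ι R a ∈ grading R A 𝒜 (i + 1) := by
  simpa using mon_mem_grading [(⟨i, a, ha⟩ : Σ i, 𝒜 i)]

variable [DirectSum.Decomposition 𝒜]

theorem shuffle_mon_mem_grading (x y : List (Σ i, 𝒜 i)) :
    shuffle 𝒜 (mon x) (mon y) ∈ grading R A 𝒜 (wdeg x + wdeg y) := by
  induction x generalizing y with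
  | nil => simpa using mon_mem_grading y
  | cons l x ihx =>
    induction y with
    | nil => simpa [-mon_cons, -wdeg_cons] using mon_mem_grading (l :: x)
    | cons m y ihy =>
      rw [shuffle_mon_cons]
      refine add_mem ?_ (Submodule.smul_mem _ _ ?_)
      · have := mul_mem_grading (ι_mem_grading l.2.2) (ihx (m :: y))
        rwa [← add_assoc] at this
      · have := mul_mem_grading (ι_mem_grading m.2.2) ihy
        rwa [add_left_comm] at this

theorem shuffle_mem_grading {i j : ℤ} {x y : TA R A} (hx : x ∈ grading R A 𝒜 i)
    (hy : y ∈ grading R A 𝒜 j) : shuffle 𝒜 x y ∈ grading R A 𝒜 (i + j) := by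
  refine grading_induction (P := fun x => shuffle 𝒜 x y ∈ grading R A 𝒜 (i + j)) (by simp)
    (fun x x' hx hx' => by rw [map_add, LinearMap.add_apply]; exact add_mem hx hx')
    (fun c x hx => by
      rw [map_smul, LinearMap.smul_apply]; exact Submodule.smul_mem _ _ hx)
    (fun u hu => ?_) hx
  refine grading_induction (P := fun y => shuffle 𝒜 (mon u) y ∈ grading R A 𝒜 (i + j)) (by simp)
    (fun x x' hx hx' => by rw [map_add]; exact add_mem hx hx')
    (fun c x hx => by rw [map_smul]; exact Submodule.smul_mem _ _ hx)
    (fun v hv => ?_) hy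
  rw [← hu, ← hv]
  exact shuffle_mon_mem_grading u v

variable (𝒜) in
/-- The algebra map `TA → TA[T, T⁻¹]` that multiplies the elements of degree `N` by `T ^ N`. -/
def gradingMap : TA R A →ₐ[R] AddMonoidAlgebra (TA R A) ℤ :=
  TensorAlgebra.lift R (DirectSum.toModule R ℤ (AddMonoidAlgebra (TA R A) ℤ) (fun i =>
    AddMonoidAlgebra.lsingle (i + 1) ∘ₗ TensorAlgebra.ι R ∘ₗ (𝒜 i).subtype) ∘ₗ
      (DirectSum.decomposeLinearEquiv 𝒜).toLinearMap)

theorem gradingMap_mon (w : List (Σ i, 𝒜 i)) :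
    gradingMap 𝒜 (mon w) = AddMonoidAlgebra.single (wdeg w) (mon w) := by
  induction w with
  | nil => rw [mon_nil, map_one]; rfl
  | cons l w ih =>
    have h : gradingMap 𝒜 (TensorAlgebra.ι R (l.2 : A)) =
        AddMonoidAlgebra.single (l.1 + 1) (TensorAlgebra.ι R (l.2 : A)) := by
      rw [gradingMap, TensorAlgebra.lift_ι_apply, LinearMap.comp_apply, LinearEquiv.coe_coe,
        DirectSum.decomposeLinearEquiv_apply, DirectSum.decompose_coe,
        ← DirectSum.lof_eq_of R, DirectSum.toModule_lof]
      rfl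
    rw [mon_cons, map_mul, ih, h, AddMonoidAlgebra.single_mul_single, wdeg_cons]

theorem gradingMap_of_mem {N : ℤ} {x : TA R A} (hx : x ∈ grading R A 𝒜 N) :
    gradingMap 𝒜 x = AddMonoidAlgebra.lsingle (R := R) N x := by
  refine grading_induction (P := fun x => gradingMap 𝒜 x = AddMonoidAlgebra.lsingle (R := R) N x)
    (by simp) (fun x y hx hy => by simp only [map_add, hx, hy])
    (fun c x hx => by simp only [map_smul, hx]) (fun w hw => ?_) hx
  rw [gradingMap_mon, hw]
  rfl

theorem isInternal_grading : DirectSum.IsInternal (grading R A 𝒜) := by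
  have hcoe : ⇑(DirectSum.coeAddMonoidHom (grading R A 𝒜)) =
      DirectSum.coeLinearMap (grading R A 𝒜) := rfl
  rw [DirectSum.IsInternal, hcoe]
  constructor
  · intro x y hxy
    -- The coefficients of `gradingMap` recover the homogeneous components from their sum, which
    -- gives injectivity.
    have key : ∀ (x : ⨁ N, grading R A 𝒜 N) (N : ℤ),
        (gradingMap 𝒜 (DirectSum.coeLinearMap (grading R A 𝒜) x)).coeff N = (x N : TA R A) := by
      intro x N
      induction x using DirectSum.induction_on with
      | zero => simp
      | of i x =>
        rw [DirectSum.coeLinearMap_of, gradingMap_of_mem x.2, AddMonoidAlgebra.lsingle_apply,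
          DirectSum.coe_of_apply]
        simp only [AddMonoidAlgebra.coeff_single, Finsupp.single_apply]
        split_ifs <;> simp
      | add x y hx hy => simp [hx, hy]
    ext N
    rw [← key, hxy, key]
  · intro x
    induction x using TA_induction 𝒜 with
    | h0 => exact ⟨0, map_zero _⟩
    | hadd x y hx hy =>
      obtain ⟨u, rfl⟩ := hx
      obtain ⟨v, rfl⟩ := hy
      exact ⟨u + v, map_add _ _ _⟩
    | hsmul c x hx =>
      obtain ⟨u, rfl⟩ := hx
      exact ⟨c • u, map_smul _ _ _⟩
    | hmon w =>
      exact ⟨DirectSum.of (fun N => grading R A 𝒜 N) _ ⟨_, mon_mem_grading w⟩,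
        DirectSum.coeLinearMap_of _ _ _⟩

theorem shuffle_comm_of_mem {i : ℤ} {x : TA R A} (hx : x ∈ grading R A 𝒜 i) (y : TA R A) :
    shuffle 𝒜 x y = shuffle 𝒜 (ssign 𝒜 i y) x :=
  grading_induction (P := fun x => shuffle 𝒜 x y = shuffle 𝒜 (ssign 𝒜 i y) x) (by simp)
    (fun x x' hx hx' => by simp [hx, hx']) (fun c x hx => by simp [hx])
    (fun u hu => by rw [shuffle_comm_mon, par_eq_wdeg, hu]) hx

variable (𝒜) in
theorem isGradedCommAlgebra_shuffle :
    IsGradedCommAlgebra (grading R A 𝒜) (shuffle 𝒜) 1 where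
  isInternal := isInternal_grading
  one_mem := mon_mem_grading ([] : List (Σ i, 𝒜 i))
  mul_mem _ _ _ _ hx hy := shuffle_mem_grading hx hy
  one_mul := shuffle_one_left
  mul_one := shuffle_one_right
  mul_assoc := shuffle_assoc
  mul_comm i j x y hx hy := by
    rw [shuffle_comm_of_mem hx, ssign_of_mem_grading _ hy, negOnePow_smul R, map_smul,
      LinearMap.smul_apply]
    push_cast
    rfl

/-! ### The degree of the lifts -/

variable {k : ℕ} {f : MultilinearMap R (fun _ : Fin k => A) A}

/-- The shift replaces `k` letters, each counted with an extra `1`, by a single one: `2 - k` becomes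
`2 - k + 1 - k = 3 - 2k`. -/
theorem ι_corestriction_mon_mem (hf : ∀ (d : Fin k → ℤ) (a : Fin k → A), (∀ i, a i ∈ 𝒜 (d i)) →
      f a ∈ 𝒜 ((∑ i, d i) + (2 - (k : ℤ)))) (w : List (Σ i, 𝒜 i)) :
    TensorAlgebra.ι R (corestriction 𝒜 f (mon w)) ∈
      grading R A 𝒜 (wdeg w + (3 - 2 * (k : ℤ))) := by
  obtain ⟨n, d, a, ha, hd, hn, hw⟩ := exists_tprod_eq_mon w
  rw [hw]
  by_cases h : n = k
  · subst h
    rw [corestriction_tprod, shifted, signed_apply 𝒜 _ _ d a ha, uzpow_smul R, map_smul, hd]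
    refine Submodule.smul_mem _ _ ?_
    convert ι_mem_grading (hf d a ha) using 2
    omega
  · rw [corestriction_tprod_ne _ h, map_zero]
    exact zero_mem _

theorem lift_mon_mem (hk : 1 ≤ k) (hf : ∀ (d : Fin k → ℤ) (a : Fin k → A),
    (∀ i, a i ∈ 𝒜 (d i)) → f a ∈ 𝒜 ((∑ i, d i) + (2 - (k : ℤ)))) (w : List (Σ i, 𝒜 i)) :
    lift 𝒜 f (mon w) ∈ grading R A 𝒜 (wdeg w + (3 - 2 * (k : ℤ))) := by
  induction w with
  | nil => rw [mon_nil, lift_one 𝒜 hk]; exact zero_mem _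
  | cons l w ih =>
    rw [mon_cons, lift_ι_mul 𝒜 f l.2.2, ← mon_cons, headOp_mon]
    refine add_mem (cutSum_mem _ fun u v e => ?_) (Submodule.smul_mem _ _ ?_)
    · have := mul_mem_grading (ι_corestriction_mon_mem hf u) (mon_mem_grading v)
      rwa [add_right_comm, ← wdeg_append, e] at this
    · have := mul_mem_grading (ι_mem_grading l.2.2) ih
      rwa [← add_assoc] at this

theorem hasDegree_lift (hk : 1 ≤ k) (hf : ∀ (d : Fin k → ℤ) (a : Fin k → A),
    (∀ i, a i ∈ 𝒜 (d i)) → f a ∈ 𝒜 ((∑ i, d i) + (2 - (k : ℤ)))) :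
    HasDegree (grading R A 𝒜) (lift 𝒜 f) (3 - 2 * (k : ℤ)) := by
  intro i x hx
  refine grading_induction (P := fun x => lift 𝒜 f x ∈ grading R A 𝒜 (i + (3 - 2 * (k : ℤ))))
    (by simp) (fun x y hx hy => by rw [map_add]; exact add_mem hx hy)
    (fun c x hx => by rw [map_smul]; exact Submodule.smul_mem _ _ hx) (fun w hw => ?_) hx
  rw [← hw]
  exact lift_mon_mem hk hf w

theorem ssign_lift (hk : 1 ≤ k) (hf : ∀ (d : Fin k → ℤ) (a : Fin k → A),
    (∀ i, a i ∈ 𝒜 (d i)) → f a ∈ 𝒜 ((∑ i, d i) + (2 - (k : ℤ)))) (p : ZMod 2) (x : TA R A) :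
    ssign 𝒜 p (lift 𝒜 f x) = sg R p • lift 𝒜 f (ssign 𝒜 p x) := by
  induction x using TA_induction 𝒜 with
  | h0 => simp
  | hadd y y' hy hy' => simp only [map_add, smul_add, hy, hy']
  | hsmul c y hy => simp only [map_smul, hy, smul_comm c]
  | hmon w =>
    rw [ssign_of_mem_grading p (lift_mon_mem hk hf w), ssign_mon, map_smul, smul_smul, ← sg_add,
      par_eq_wdeg]
    congr 2
    push_cast
    generalize (wdeg w : ZMod 2) = a, (k : ZMod 2) = b
    clear hf
    revert p a b; decide

/-- For `k = 1` double commutators vanish. Evaluated at `1`, this says that the commutator of the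
lift with `x` is multiplication by its value at `1`, which is the lift applied to `x`. -/
theorem lift_shuffle {f : MultilinearMap R (fun _ : Fin 1 => A) A}
    (hf : ∀ (d : Fin 1 → ℤ) (a : Fin 1 → A),
      (∀ i, a i ∈ 𝒜 (d i)) → f a ∈ 𝒜 ((∑ i, d i) + (2 - ((1 : ℕ) : ℤ)))) {i : ℤ} {x : TA R A}
    (hx : x ∈ grading R A 𝒜 i) (y : TA R A) :
    lift 𝒜 f (shuffle 𝒜 x y) =
      shuffle 𝒜 (lift 𝒜 f x) y + i.negOnePow • shuffle 𝒜 x (lift 𝒜 f y) := by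
  have h1 := shuffleComm_mem_of_mem_grading (lift_mem_orderSpan le_rfl hf) hx
  have h2 : lift 𝒜 f ∘ₗ shuffle 𝒜 x - (shuffle 𝒜).flip x ∘ₗ lift 𝒜 f ∘ₗ ssign 𝒜 i =
      shuffle 𝒜 (lift 𝒜 f x) := by
    refine hom_ext_mon 𝒜 fun w => ?_
    have h3 := LinearMap.congr_fun (orderSpan_zero (shuffleComm_mem h1 w)) 1
    simp only [shuffleComm_apply, shuffle_one_right, ssign_one, lift_one 𝒜 le_rfl,
      map_zero, LinearMap.zero_apply, sub_zero] at h3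
    exact sub_eq_zero.1 h3
  have h4 := sub_eq_iff_eq_add.1 (LinearMap.congr_fun h2 y)
  refine h4.trans (congrArg _ ?_)
  rw [LinearMap.comp_apply, LinearMap.comp_apply, LinearMap.flip_apply, shuffle_comm_of_mem hx,
    ssign_lift le_rfl hf, negOnePow_smul R, map_smul, LinearMap.smul_apply, smul_smul,
    sg_mul_self, one_smul]

end GradedAlgebra

/-! ### The Stasheff relations and the quadratic relations of the lifts -/

/-- The letters before, inside and after the inner operation are compared separately (`h1`, `h2`,
`h3`). The first sum on the right depends only on the whole word, so it factors out of the Stasheff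
relation; what remains is the Stasheff sign. -/
theorem stasheff_sign (r q t : ℕ) (d : ℕ → ZMod 2) :
    (∑ i ∈ Finset.range r, (d i + 1)) +
      (∑ j ∈ Finset.range (q + 1), ((q - j : ℕ) : ZMod 2) * d (r + j)) +
      ((∑ j ∈ Finset.range r, ((r + t - j : ℕ) : ZMod 2) * d j) +
        t * ((∑ i ∈ Finset.range (q + 1), d (r + i)) + (q + 1)) +
        ∑ j ∈ Finset.range t, ((t - 1 - j : ℕ) : ZMod 2) * d (r + (q + 1) + j)) =
    (∑ j ∈ Finset.range (r + (q + 1) + t), ((r + (q + 1) + t - 1 - j : ℕ) : ZMod 2) * d j) +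
      (r + (q + 1) * t + (q + 1) * ∑ i ∈ Finset.range r, d i) := by
  have h1 : (∑ i ∈ Finset.range r, (d i + 1)) +
      (∑ j ∈ Finset.range r, ((r + t - j : ℕ) : ZMod 2) * d j) =
      (∑ j ∈ Finset.range r, ((r + (q + 1) + t - 1 - j : ℕ) : ZMod 2) * d j) +
        (r + (q + 1) * ∑ i ∈ Finset.range r, d i) := by
    have hr : (r : ZMod 2) = ∑ i ∈ Finset.range r, 1 := by simp
    rw [hr, Finset.mul_sum, ← Finset.sum_add_distrib, ← Finset.sum_add_distrib,
      ← Finset.sum_add_distrib]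
    refine Finset.sum_congr rfl fun j hj => ?_
    obtain ⟨i, rfl⟩ := Nat.exists_eq_add_of_lt (Finset.mem_range.1 hj)
    rw [show j + i + 1 + t - j = i + 1 + t by omega,
      show j + i + 1 + (q + 1) + t - 1 - j = i + 1 + q + t by omega]
    push_cast
    generalize (d j) = a, (i : ZMod 2) = b, (t : ZMod 2) = c, (q : ZMod 2) = e
    clear hj hr
    revert a b c e; decide
  have h2 : (∑ j ∈ Finset.range (q + 1), ((q - j : ℕ) : ZMod 2) * d (r + j)) +
      t * (∑ i ∈ Finset.range (q + 1), d (r + i)) =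
      ∑ j ∈ Finset.range (q + 1), ((r + (q + 1) + t - 1 - (r + j) : ℕ) : ZMod 2) * d (r + j) := by
    rw [Finset.mul_sum, ← Finset.sum_add_distrib]
    refine Finset.sum_congr rfl fun j hj => ?_
    have := Finset.mem_range.1 hj
    rw [show r + (q + 1) + t - 1 - (r + j) = (q - j) + t by omega]
    push_cast
    ring
  have h3 : ∑ j ∈ Finset.range t, ((t - 1 - j : ℕ) : ZMod 2) * d (r + (q + 1) + j) =
      ∑ j ∈ Finset.range t, ((r + (q + 1) + t - 1 - (r + (q + 1) + j) : ℕ) : ZMod 2) *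
        d (r + (q + 1) + j) :=
    Finset.sum_congr rfl fun j hj => by congr 2; omega
  have h4 := Finset.sum_range_add
    (fun j => ((r + (q + 1) + t - 1 - j : ℕ) : ZMod 2) * d j) (r + (q + 1)) t
  rw [Finset.sum_range_add _ r (q + 1), ← h2, ← h3] at h4
  rw [h4]
  linear_combination h1

/-! ### The corestriction of a composite of two lifts, and its vanishing -/

section Relation

variable {R A : Type*} [CommRing R] [AddCommGroup A] [Module R A]

theorem tprod_mul_tprod (r t : ℕ) (u v : ℕ → A) :
    TensorAlgebra.tprod R A r (fun i => u i) * TensorAlgebra.tprod R A t (fun i => v i) =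
      TensorAlgebra.tprod R A (r + t) (fun i => glue r u v i) := by
  rw [TensorAlgebra.tprod_apply, TensorAlgebra.tprod_apply, TensorAlgebra.tprod_apply,
    List.ofFn_add, List.prod_append]
  simp [glue]

variable {𝒜 : ℤ → Submodule R A} [DirectSum.Decomposition 𝒜]

theorem corestriction_seq {k N : ℕ} (f : (k : ℕ) → MultilinearMap R (fun _ : Fin k => A) A)
    (e : ℕ → ℤ) (c : ℕ → A) (hc : ∀ i, c i ∈ 𝒜 (e i)) (h : N = k) :
    corestriction 𝒜 (f k) (TensorAlgebra.tprod R A N (fun i => c i)) =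
      sg R (∑ j ∈ Finset.range N, ((N - 1 - j : ℕ) : ZMod 2) * e j) • f N (fun i => c i) := by
  subst h
  rw [corestriction_tprod, shifted, signed_apply 𝒜 _ _ (fun i : Fin N => e i) _ (fun i => hc i),
    uzpow_smul R, Finset.sum_range]

theorem corestriction_insert (S : AInfinityAlgebra 𝒜) {p r q t : ℕ} (hp : p = r + t)
    (d : ℕ → ℤ) (a : ℕ → A) (ha : ∀ i, a i ∈ 𝒜 (d i)) :
    sg R ((∑ i ∈ Finset.range r, ((d i : ZMod 2) + 1)) +
      ∑ j ∈ Finset.range (q + 1), ((q - j : ℕ) : ZMod 2) * d (r + j)) •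
    corestriction 𝒜 (S.μ (p + 1)) (TensorAlgebra.tprod R A r (fun i => a i) *
      TensorAlgebra.ι R (S.μ (q + 1) (fun i => a (r + i))) *
      TensorAlgebra.tprod R A t (fun i => a (r + (q + 1) + i))) =
    sg R (∑ j ∈ Finset.range (r + (q + 1) + t),
      ((r + (q + 1) + t - 1 - j : ℕ) : ZMod 2) * d j) •
    ((r : ℤ) + (q + 1 : ℕ) * t + (q + 1 : ℕ) * ∑ i ∈ Finset.range r, d i).negOnePow •
      S.μ (r + 1 + t) (fun j => if (j : ℕ) < r then a j
        else if (j : ℕ) = r then S.μ (q + 1) (fun i => a (r + i))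
        else a (j + (q + 1) - 1)) := by
  set b := S.μ (q + 1) (fun i => a (r + i)) with hb
  set D : ℤ := (∑ i ∈ Finset.range (q + 1), d (r + i)) + (2 - ((q + 1 : ℕ) : ℤ)) with hD
  have hbD : b ∈ 𝒜 D := by
    have := S.degree (q + 1) (fun i => d (r + i)) (fun i => a (r + i)) fun i => ha _
    rwa [← Finset.sum_range (fun i => d (r + i))] at this
  have hword : TensorAlgebra.tprod R A r (fun i => a i) * TensorAlgebra.ι R b *
      TensorAlgebra.tprod R A t (fun i => a (r + (q + 1) + i)) =
      TensorAlgebra.tprod R A (r + (t + 1))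
        (fun i => glue r a (consSeq b fun i => a (r + (q + 1) + i)) i) := by
    rw [mul_assoc, ι_mul_seq t b fun i => a (r + (q + 1) + i), tprod_mul_tprod]
  have hc : ∀ i, glue r a (consSeq b fun i => a (r + (q + 1) + i)) i ∈
      𝒜 (glue r d (consSeq D fun i => d (r + (q + 1) + i)) i) := by
    intro i
    unfold glue
    split_ifs
    · exact ha i
    · rcases i - r with _ | j
      · exact hbD
      · exact ha _
  rw [hword, corestriction_seq S.μ _ _ hc (by omega), smul_smul, ← sg_add, negOnePow_smul R,
    smul_smul, ← sg_add, show r + 1 + t = r + (t + 1) by omega]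
  congr 1
  · congr 1
    push_cast
    rw [← stasheff_sign r q t (fun i => d i), Finset.sum_range_add _ r (t + 1),
      Finset.sum_range_succ' _ t]
    congr 1
    have e1 : ∀ j ∈ Finset.range r, ((r + (t + 1) - 1 - j : ℕ) : ZMod 2) *
        (glue r d (consSeq D fun i => d (r + (q + 1) + i)) j : ℤ) =
        ((r + t - j : ℕ) : ZMod 2) * d j := by
      intro j hj
      rw [glue, if_pos (Finset.mem_range.1 hj)]
      rfl
    have e2 : ∀ j ∈ Finset.range t, ((r + (t + 1) - 1 - (r + (j + 1)) : ℕ) : ZMod 2) *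
        (glue r d (consSeq D fun i => d (r + (q + 1) + i)) (r + (j + 1)) : ℤ) =
        ((t - 1 - j : ℕ) : ZMod 2) * d (r + (q + 1) + j) := by
      intro j hj
      rw [glue, if_neg (by omega), show r + (j + 1) - r = j + 1 by omega, consSeq_succ]
      congr 2
      omega
    rw [Finset.sum_congr rfl e1, Finset.sum_congr rfl e2]
    -- The inserted letter has `t` letters after it, hence weight `t`, and its degree `D` is
    -- congruent to `∑ d + q + 1` modulo `2`.
    have e3 : ((r + (t + 1) - 1 - (r + 0) : ℕ) : ZMod 2) *
        (glue r d (consSeq D fun i => d (r + (q + 1) + i)) (r + 0) : ℤ) =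
        t * ((∑ i ∈ Finset.range (q + 1), (d (r + i) : ZMod 2)) + (q + 1)) := by
      rw [glue, if_neg (by omega), show r + 0 - r = 0 by omega, consSeq_zero,
        show r + (t + 1) - 1 - (r + 0) = t by omega, hD]
      push_cast
      generalize (∑ i ∈ Finset.range (q + 1), (d (r + i) : ZMod 2)) = x, (q : ZMod 2) = y,
        (t : ZMod 2) = z
      clear hD hword hc hbD hb
      revert x y z; decide
    rw [e3]
    ring
  · congr 1
    funext j
    unfold glue
    split_ifs with h1 h2
    · rfl
    · simp [h2]
    · obtain ⟨i, hi⟩ : ∃ i, (j : ℕ) = r + i + 1 := ⟨j - r - 1, by omega⟩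
      rw [show (j : ℕ) - r = i + 1 by omega, consSeq_succ]
      congr 1
      omega

/-- The term of the Stasheff relation in which `μ s` is applied to `a_r, …, a_{r+s-1}`. -/
def stasheffTerm (S : AInfinityAlgebra 𝒜) (d : ℕ → ℤ) (a : ℕ → A) (r s t : ℕ) : A :=
  ((r : ℤ) + s * t + s * ∑ i ∈ Finset.range r, d i).negOnePow •
    S.μ (r + 1 + t) (fun j => if (j : ℕ) < r then a j
      else if (j : ℕ) = r then S.μ s (fun i => a (r + i)) else a (j + s - 1))

omit [DirectSum.Decomposition 𝒜] in
theorem stasheffTerm_zero (S : AInfinityAlgebra 𝒜) (d : ℕ → ℤ) (a : ℕ → A) (r t : ℕ) :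
    stasheffTerm S d a r 0 t = 0 := by
  rw [stasheffTerm, MultilinearMap.map_coord_zero _ (⟨r, by omega⟩ : Fin (r + 1 + t)), smul_zero]
  simp [S.μ_zero]

omit [DirectSum.Decomposition 𝒜] in
-- Reindexes the Stasheff relation by `s = q + 1`; the terms with `s = 0` drop out because `μ 0 =
-- 0`.
theorem sum_stasheffTerm (S : AInfinityAlgebra 𝒜) (d : ℕ → ℤ) (a : ℕ → A)
    (ha : ∀ i, a i ∈ 𝒜 (d i)) (m : ℕ) :
    ∑ q ∈ Finset.range (m + 1), ∑ r ∈ Finset.range (m + 1 + 1),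
      (if r + (q + 1) ≤ m + 1 then stasheffTerm S d a r (q + 1) (m + 1 - (r + (q + 1))) else 0)
      = 0 := by
  rw [Finset.sum_comm]
  refine Eq.trans (Finset.sum_congr rfl fun r hr => ?_) (S.stasheff (m + 1) d a ha)
  change _ = ∑ st ∈ Finset.HasAntidiagonal.antidiagonal (m + 1 - r), stasheffTerm S d a r st.1 st.2
  have hr := Finset.mem_range.1 hr
  rw [Finset.Nat.sum_antidiagonal_eq_sum_range_succ (stasheffTerm S d a r),
    Finset.sum_range_succ' _ (m + 1 - r), stasheffTerm_zero, add_zero, ← Finset.sum_filter]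
  have : (Finset.range (m + 1)).filter (fun q => r + (q + 1) ≤ m + 1) =
      Finset.range (m + 1 - r) := by
    ext q
    simp only [Finset.mem_filter, Finset.mem_range]
    omega
  rw [this]
  refine Finset.sum_congr rfl fun q _ => ?_
  rw [Nat.sub_sub]

theorem lift_seq {k : ℕ} (f : MultilinearMap R (fun _ : Fin k => A) A) (n : ℕ)
    (d : ℕ → ℤ) (a : ℕ → A) (ha : ∀ i, a i ∈ 𝒜 (d i)) :
    lift 𝒜 f (TensorAlgebra.tprod R A n (fun i => a i)) = ∑ r ∈ Finset.range (n + 1),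
      if r + k ≤ n then
        sg R ((∑ i ∈ Finset.range r, ((d i : ZMod 2) + 1)) +
          ∑ j ∈ Finset.range k, ((k - 1 - j : ℕ) : ZMod 2) * d (r + j)) •
        (TensorAlgebra.tprod R A r (fun i => a i) *
          TensorAlgebra.ι R (f (fun i => a (r + i))) *
          TensorAlgebra.tprod R A (n - (r + k)) (fun i => a (r + k + i)))
      else 0 := by
  rw [lift_tprod 𝒜 f n (fun i => d i) (fun i => a i) (fun i => ha _), Finset.sum_range]
  refine Finset.sum_congr rfl fun r _ => ?_
  by_cases h : (r : ℕ) + k ≤ n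
  · rw [dif_pos h, if_pos h, mul_smul, uzpow_smul R, uzpow_smul R, smul_smul, ← sg_add]
    congr 1
    · congr 2
      · rw [← Finset.sum_range (fun i => if i < (r : ℕ) then (d i : ZMod 2) + 1 else 0),
          ← Finset.sum_filter]
        congr 1
        ext i
        simp only [Finset.mem_filter, Finset.mem_range]
        omega
      · rw [Finset.sum_range]
    · have h0 : seg (fun i : Fin n => a i) 0 r (by omega) = fun i : Fin (r : ℕ) => a i := by
        funext i
        simp [seg]
      rw [h0]
      rfl
  · rw [dif_neg h, if_neg h]

/-- The inner lift shortens words by `q`, and the outer corestriction sees only length `p + 1`;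
hence `n = p + q + 1`. -/
theorem corestriction_lift_seq (S : AInfinityAlgebra 𝒜) (p q n : ℕ)
    (d : ℕ → ℤ) (a : ℕ → A) (ha : ∀ i, a i ∈ 𝒜 (d i)) :
    corestriction 𝒜 (S.μ (p + 1)) (lift 𝒜 (S.μ (q + 1))
      (TensorAlgebra.tprod R A n (fun i => a i))) =
    if n = p + q + 1 then
      sg R (∑ j ∈ Finset.range n, ((n - 1 - j : ℕ) : ZMod 2) * d j) •
        ∑ r ∈ Finset.range (n + 1),
          if r + (q + 1) ≤ n then stasheffTerm S d a r (q + 1) (n - (r + (q + 1))) else 0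
    else 0 := by
  rw [lift_seq _ n d a ha, map_sum]
  split_ifs with hn
  · rw [Finset.smul_sum]
    refine Finset.sum_congr rfl fun r _ => ?_
    split_ifs with h
    · obtain ⟨t, rfl⟩ := Nat.exists_eq_add_of_le h
      have := corestriction_insert S (show p = r + t by omega) (q := q) d a ha
      rw [map_smul, Nat.add_sub_cancel_left]
      exact this
    · rw [map_zero, smul_zero]
  · refine Finset.sum_eq_zero fun r _ => ?_
    split_ifs with h
    · rw [map_smul, mul_assoc, ι_mul_seq (n - (r + (q + 1))) _ fun i => a (r + (q + 1) + i),
        tprod_mul_tprod, corestriction_tprod_ne, smul_zero]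
      omega
    · exact map_zero _

theorem sum_corestriction_lift (S : AInfinityAlgebra 𝒜) (m : ℕ) :
    ∑ pq ∈ Finset.HasAntidiagonal.antidiagonal m,
      corestriction 𝒜 (S.μ (pq.1 + 1)) ∘ₗ lift 𝒜 (S.μ (pq.2 + 1)) = 0 := by
  refine hom_ext_mon 𝒜 fun w => ?_
  obtain ⟨n, d, a, ha, -, -, hw⟩ := exists_seq_eq_mon w
  rw [hw, LinearMap.sum_apply, LinearMap.zero_apply]
  simp only [LinearMap.comp_apply, corestriction_lift_seq S _ _ _ d a ha]
  by_cases hn : n = m + 1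
  · subst hn
    rw [Finset.sum_congr rfl fun pq h => if_pos (by
      rw [Finset.HasAntidiagonal.mem_antidiagonal] at h; omega), ← Finset.smul_sum,
      -- The swap makes the index of the inner operation the summation variable, as in
      -- `sum_stasheffTerm`.
      ← Finset.Nat.sum_antidiagonal_swap]
    simp only [Prod.snd_swap]
    rw [Finset.Nat.sum_antidiagonal_eq_sum_range_succ_mk, sum_stasheffTerm S d a ha, smul_zero]
  · refine Finset.sum_eq_zero fun pq h => if_neg ?_
    rw [Finset.HasAntidiagonal.mem_antidiagonal] at h
    omega

/-- Expands `(T ⊗ 1 + s ⊗ T)(T' ⊗ 1 + s ⊗ T')` with `s = ssign 𝒜 1`. Since `s² = 1` and `s T' = -T'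
s`, the mixed terms are antisymmetric in `T` and `T'`, so they cancel in the sum over the
antidiagonal. -/
theorem coproduct_comp_of_isOddCoderivation {T T' : TA R A →ₗ[R] TA R A}
    (hT : IsOddCoderivation 𝒜 T) (hT' : IsOddCoderivation 𝒜 T')
    (hs : ∀ x, ssign 𝒜 1 (T' x) = -T' (ssign 𝒜 1 x)) :
    coproduct R A ∘ₗ T ∘ₗ T' = (TensorProduct.map (T ∘ₗ T') LinearMap.id +
      TensorProduct.map LinearMap.id (T ∘ₗ T') + (TensorProduct.map (T ∘ₗ ssign 𝒜 1) T' -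
      TensorProduct.map (T' ∘ₗ ssign 𝒜 1) T)) ∘ₗ coproduct R A := by
  have hs' : ssign 𝒜 1 ∘ₗ T' = -(T' ∘ₗ ssign 𝒜 1) := LinearMap.ext hs
  have hss : ssign 𝒜 1 ∘ₗ ssign 𝒜 1 = LinearMap.id := LinearMap.ext (ssign_self 1)
  have hneg : TensorProduct.map (-(T' ∘ₗ ssign 𝒜 1)) T = -TensorProduct.map (T' ∘ₗ ssign 𝒜 1) T :=
    TensorProduct.ext' fun x y => by simp [TensorProduct.neg_tmul]
  rw [IsOddCoderivation, degreeSign_eq_ssign] at hT hT'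
  rw [← LinearMap.comp_assoc, hT, LinearMap.comp_assoc, hT', ← LinearMap.comp_assoc]
  congr 1
  simp only [LinearMap.add_comp, LinearMap.comp_add, ← TensorProduct.map_comp, LinearMap.id_comp,
    LinearMap.comp_id, hss, hs', hneg]
  abel

theorem comp_sum_antidiagonal {X : Type*} [AddCommGroup X] [Module R X] (c : X →ₗ[R] X ⊗[R] X)
    (s : X →ₗ[R] X) (D : ℕ → X →ₗ[R] X)
    (h : ∀ p q, c ∘ₗ D p ∘ₗ D q = (TensorProduct.map (D p ∘ₗ D q) LinearMap.id +
      TensorProduct.map LinearMap.id (D p ∘ₗ D q) + (TensorProduct.map (D p ∘ₗ s) (D q) -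
      TensorProduct.map (D q ∘ₗ s) (D p))) ∘ₗ c) (m : ℕ) :
    c ∘ₗ ∑ pq ∈ Finset.HasAntidiagonal.antidiagonal m, D pq.1 ∘ₗ D pq.2 =
      (TensorProduct.map (∑ pq ∈ Finset.HasAntidiagonal.antidiagonal m, D pq.1 ∘ₗ D pq.2)
        LinearMap.id + TensorProduct.map LinearMap.id
        (∑ pq ∈ Finset.HasAntidiagonal.antidiagonal m, D pq.1 ∘ₗ D pq.2)) ∘ₗ c := by
  have hl : TensorProduct.map (∑ pq ∈ Finset.HasAntidiagonal.antidiagonal m, D pq.1 ∘ₗ D pq.2)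
      LinearMap.id = ∑ pq ∈ Finset.HasAntidiagonal.antidiagonal m,
        TensorProduct.map (D pq.1 ∘ₗ D pq.2) (LinearMap.id : X →ₗ[R] X) :=
    TensorProduct.ext' fun x y => by simp [LinearMap.sum_apply, TensorProduct.sum_tmul]
  have hr : TensorProduct.map LinearMap.id
      (∑ pq ∈ Finset.HasAntidiagonal.antidiagonal m, D pq.1 ∘ₗ D pq.2) =
      ∑ pq ∈ Finset.HasAntidiagonal.antidiagonal m,
        TensorProduct.map (LinearMap.id : X →ₗ[R] X) (D pq.1 ∘ₗ D pq.2) :=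
    TensorProduct.ext' fun x y => by simp [LinearMap.sum_apply, TensorProduct.tmul_sum]
  have hcross := Finset.Nat.sum_antidiagonal_swap (n := m)
    (f := fun pq => TensorProduct.map (D pq.1 ∘ₗ s) (D pq.2))
  simp only [Prod.fst_swap, Prod.snd_swap] at hcross
  rw [hl, hr]
  ext1 x
  simp only [LinearMap.comp_apply, LinearMap.sum_apply, LinearMap.add_apply, map_sum]
  have h' (p q) := LinearMap.congr_fun (h p q) x
  have hx := LinearMap.congr_fun hcross (c x)
  simp only [LinearMap.comp_apply, LinearMap.sum_apply, LinearMap.add_apply,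
    LinearMap.sub_apply] at h' hx
  simp only [h', Finset.sum_add_distrib, Finset.sum_sub_distrib, hx, sub_self, add_zero]

theorem sum_lift_comp_lift (S : AInfinityAlgebra 𝒜) (m : ℕ) :
    ∑ pq ∈ Finset.HasAntidiagonal.antidiagonal m,
      lift 𝒜 (S.μ (pq.1 + 1)) ∘ₗ lift 𝒜 (S.μ (pq.2 + 1)) = 0 := by
  have hext (k : ℕ) := isOddExtension_lift 𝒜 (Nat.le_add_left 1 k) (S.μ (k + 1))
  have hs (k : ℕ) (x : TA R A) : ssign 𝒜 1 (lift 𝒜 (S.μ (k + 1)) x) =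
      -lift 𝒜 (S.μ (k + 1)) (ssign 𝒜 1 x) := by
    rw [ssign_lift (Nat.le_add_left 1 k) (S.degree (k + 1)), sg_one, neg_one_smul]
  refine eq_zero_of_projOne (𝒜 := 𝒜) ?_ ?_ (fun w => ?_) (fun w => ?_)
  · simp [LinearMap.sum_apply, (hext _).map_one]
  · exact comp_sum_antidiagonal _ (ssign 𝒜 1) (fun k => lift 𝒜 (S.μ (k + 1))) (fun p q =>
      coproduct_comp_of_isOddCoderivation (hext p).isOddCoderivation (hext q).isOddCoderivation
        (hs q)) m
  · have h0 (k : ℕ) (x : TA R A) :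
        TensorAlgebra.algebraMapInv (lift 𝒜 (S.μ (k + 1)) x) = 0 :=
      LinearMap.congr_fun (hom_ext_mon 𝒜 (f := TensorAlgebra.algebraMapInv.toLinearMap ∘ₗ
        lift 𝒜 (S.μ (k + 1))) (g := 0) (hext k).algebraMapInv_mon) x
    simp [LinearMap.sum_apply, h0]
  · simp only [LinearMap.sum_apply, map_sum, LinearMap.comp_apply, (hext _).projOne_apply]
    have := LinearMap.congr_fun (sum_corestriction_lift S m) (mon w)
    simpa [LinearMap.sum_apply] using this

end Relation

end HomotopyBV

end

theorem theorem2 {R A : Type*} [CommRing R] [AddCommGroup A] [Module R A]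
    (𝒜 : ℤ → Submodule R A) [DirectSum.Decomposition 𝒜]
    (S : HomotopyBV.AInfinityAlgebra 𝒜) :
    (∀ k : ℕ, 1 ≤ k → HomotopyBV.IsCoderivationLift 𝒜 (S.μ k) (HomotopyBV.lift 𝒜 (S.μ k))) ∧
    HomotopyBV.IsCommBVInfinityAlgebra (HomotopyBV.grading R A 𝒜) (HomotopyBV.shuffle 𝒜) 1
      (fun k => HomotopyBV.lift 𝒜 (S.μ k)) := by
  refine ⟨fun k hk => HomotopyBV.isCoderivationLift_lift 𝒜 hk _, ?_⟩
  exact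
    { isDGCommAlgebra :=
        { toIsGradedCommAlgebra := HomotopyBV.isGradedCommAlgebra_shuffle 𝒜
          d_degree := by
            simpa using HomotopyBV.hasDegree_lift le_rfl (S.degree 1)
          d_sq := by
            simpa using HomotopyBV.sum_lift_comp_lift S 0
          d_mul := fun i x y hx => HomotopyBV.lift_shuffle (S.degree 1) hx y }
      degree := fun k hk => HomotopyBV.hasDegree_lift hk (S.degree k)
      order := fun k hk => HomotopyBV.hasOperatorOrder_of_mem
        (HomotopyBV.lift_mem_orderSpan hk (S.degree k)) (HomotopyBV.lift_one 𝒜 hk _)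
      relation := HomotopyBV.sum_lift_comp_lift S }
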